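/- Let $n,d\ge 0$ be integers, and let $\Omega_{n,d}$ be the set of $d$-regular simple graphs on the ordered vertex set $\{1,\dots,n\}$. The *switch chain* on $\Omega_{n,d}$ is lazy; otherwise it chooses two non-incident edges of the current graph and a perfect matching of their four endvertices, and replaces the two edges by this matching unless multiple edges would result. Its stationary distribution is uniform. A *transition* is a pair $(Z,Z')$ such that $Z'$ can be reached from $Z$ in one step ($Z'=Z$ included). **Pairings.** For $G,G'\in\Omega_{n,d}$ let $H=G\triangle G'$; edges of $G\setminus G'$ are blue, edges of $G'\setminus G$ are red. A *pairing* $\psi$ consists, for each vertex $v$, of a bijection from the blue edges at $v$ to the red edges at $v$. Let $\Psi(G,G')$ be the set of pairings. For each $\psi\in\Psi(G,G')$ the *canonical path* $\gamma_\psi(G,G')$ from $G$ to $G'$ is the following sequence of graphs. *Circuits.* Take the lexicographically least edge $w_0w_1$ of $H$, $w_0<w_1$, follow it from $w_0$ to $w_1$, and leave each vertex by the edge paired by $\psi$ with the edge of arrival, until the walk closes up at $w_0$ with an edge paired with $w_0w_1$. Remove the edges of this circuit from $H$ and repeat until no edge is left. The circuits are processed in the order in which they are found. *1-circuits and 2-circuits.*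 A circuit with start vertex $v=w_0$ is cut at $v$ into closed walks from $v$ to $v$, taken in order. One of even length is a 1-circuit. One of odd length waits for the next one of odd length, and the two together form a 2-circuit. These pieces are processed in the order in which they are completed. *Processing a 1-circuit* $x_0x_1\cdots x_{2k-1}$, $x_0=v$. It is traversed in the direction such that $x_0x_1$ is present (and $x_0x_{2k-1}$ absent) in the current graph. For $1\le s<k$, step $s$ is the switch on the 4-cycle $x_0x_{2s-1}x_{2s}x_{2s+1}$, which exchanges present and absent edges. The steps are done in phases. When steps $1,\dots,a$ are done, the next phase does steps $b,b-1,\dots,a+1$ in this order, where $b>a$ is least such that the odd chord $x_0x_{2b+1}$ is absent from the current graph. If the vertex $x_{2b+1}$ occurs again at a later odd position, $b$ is replaced by the last such occurrence that precedes every later absent odd chord with a different endvertex. *Processing a 2-circuit* $v\,a_1a_2\cdots a_{2p}\;v\;b_1b_2\cdots b_{2q}$. Put $w=a_1$, $x=a_2$, $y=b_{2q}$. - If $x\ne y$ and $xy$ is not an edge of the 2-circuit, use the *shortcut edge* $xy$. Do the switch on $vwxy$, and process the 1-circuit obtained from the 2-circuit by replacing the path $yvwx$ by the edge $yx$; the switch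 is done first if the current graph allows it, and last otherwise. - Otherwise, if the same condition holds with $y$ replaced by $b_1$, reverse the second loop and do the same. - Otherwise the two loops share a vertex $u\neq v$. Let $u=a_i$ be the first vertex of the first loop that lies on the second, and $b_j$ its first occurrence there. If $i\equiv j \pmod 2$, process the 1-circuits $v\,a_1\cdots a_i\,b_{j-1}\cdots b_1$ and then $v\,a_{2p}\cdots a_{i+1}\,u\,b_{j+1}\cdots b_{2q}$. If not, process $v\,a_1\cdots a_i\,b_{j+1}\cdots b_{2q}$ and then $v\,a_{2p}\cdots a_{i+1}\,u\,b_{j-1}\cdots b_1$. **Flow.** The path $\gamma_\psi(G,G')$, $G\ne G'$, carries flow $\dfrac{1}{|\Omega_{n,d}|^2\,|\Psi(G,G')|}$, so that the total flow from $G$ to $G'$ is $\pi(G)\pi(G')=|\Omega_{n,d}|^{-2}$. For a transition $e=(Z,Z')$ let $f(e)$ be the total flow on the paths that pass from $Z$ directly to $Z'$. **Claim.** For every transition $e=(Z,Z')$ of the switch chain, $$ f(e)\;\le\;\frac{2\,d^{20}\,n^5}{|\Omega_{n,d}|}. $$ -/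

import Mathlib

namespace SwitchChain

/-! ## The switch chain on `d`-regular graphs with vertex set `Fin n` -/

open Classical in
/-- `Ω n d`: the set of `d`-regular (simple) graphs on the ordered vertex set `Fin n`. -/
abbrev Ω (n d : ℕ) : Type := {G : SimpleGraph (Fin n) // G.IsRegularOfDegree d}

noncomputable instance (n d : ℕ) : Fintype (Ω n d) := Fintype.ofFinite _

/-- `(Z, Z')` is a transition of the switch chain. Either the chain stays put (it is lazy), or two
non-incident edges `ab`, `cd` of `Z` are replaced by another perfect matching `ac`, `bd` of
`{a, b, c, d}`, none of whose edges is present in `Z`. (The third perfect matching is obtained by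
exchanging the names of `c` and `d`.) -/
def IsTransition {n d : ℕ} (Z Z' : Ω n d) : Prop :=
  Z' = Z ∨
    ∃ a b c e : Fin n, [a, b, c, e].Nodup ∧
      Z.1.Adj a b ∧ Z.1.Adj c e ∧ ¬ Z.1.Adj a c ∧ ¬ Z.1.Adj b e ∧
      Z'.1.edgeSet = (Z.1.edgeSet \ {s(a, b), s(c, e)}) ∪ {s(a, c), s(b, e)}

/-! ## Pairings

The edges of `G \ G'` are blue, those of `G' \ G` are red. -/

/-- A pairing of `(G, G')`: at each vertex `v` a bijection from the blue edges at `v` to the red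
edges at `v` (an edge at `v` is given by its other end). -/
abbrev Pairing {n : ℕ} (G G' : SimpleGraph (Fin n)) : Type :=
  (v : Fin n) → ((G \ G').neighborSet v ≃ (G' \ G).neighborSet v)

noncomputable instance {n : ℕ} (G G' : SimpleGraph (Fin n)) : Fintype (Pairing G G') :=
  Fintype.ofFinite _

open Classical in
/-- `mate ψ v u`: the other end of the edge that is paired with the edge `vu` at `v`. -/
noncomputable def mate {n : ℕ} {G G' : SimpleGraph (Fin n)} (ψ : Pairing G G')
    (v u : Fin n) : Fin n :=
  if h : u ∈ (G \ G').neighborSet v then (ψ v ⟨u, h⟩ : Fin n)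
  else if h' : u ∈ (G' \ G).neighborSet v then ((ψ v).symm ⟨u, h'⟩ : Fin n)
  else u

/-! ## Decomposition into circuits

A closed walk is the list `[x₀, …, xₘ₋₁]` of its vertices; its edges are `xᵢxᵢ₊₁`, indices mod `m`.
The states of the chain are handled here through their edge sets. -/

/-- Edge sets of graphs. -/
abbrev Edges (n : ℕ) : Type := Finset (Sym2 (Fin n))

open Classical in
/-- The edge set of a graph. -/
noncomputable def edges {n : ℕ} (G : SimpleGraph (Fin n)) : Edges n :=
  Finset.univ.filter (· ∈ G.edgeSet)

/-- The edges of a closed walk. -/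
def walkEdges {n : ℕ} (C : List (Fin n)) : Edges n :=
  (List.zipWith (fun x y => s(x, y)) C (C.rotate 1)).toFinset

/-- The lexicographically least edge `{a, b}`, `a < b`, of an edge set. -/
def leastEdge {n : ℕ} (E : Edges n) : Option (Fin n × Fin n) :=
  (List.finRange n ×ˢ List.finRange n).find? fun p => p.1 < p.2 ∧ s(p.1, p.2) ∈ E

/-- Walk along the directed edge `p`, and at each vertex leave by the edge that is paired with the
one of arrival; stop when the next directed edge would be `start`. The number is a bound on the
number of steps. -/
def trace {n : ℕ} (m : Fin n → Fin n → Fin n) (start : Fin n × Fin n) :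
    ℕ → Fin n × Fin n → List (Fin n)
  | 0, _ => []
  | k + 1, p =>
      p.1 :: if (p.2, m p.2 p.1) = start then [] else trace m start k (p.2, m p.2 p.1)

/-- Split the edge set `E` into circuits, each starting with the lexicographically least edge that
is left (whatever its colour), from the smaller to the larger end. The number is a bound on the
number of circuits. -/
def circuits {n : ℕ} (m : Fin n → Fin n → Fin n) : ℕ → Edges n → List (List (Fin n))
  | 0, _ => []
  | k + 1, E =>
      match leastEdge E with
      | none => []
      | some p =>
          let C := trace m p (n * n) p
          C :: circuits m k (E \ walkEdges C)

/-- The pieces of a circuit with start vertex `v`: a 1-circuit is an alternating closed walk that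
visits `v` once, `[v] ++ a`; a 2-circuit is an alternating closed walk that visits `v` twice,
`[v] ++ a ++ [v] ++ b`, where `[v] ++ a` and `[v] ++ b` are closed walks of odd length. -/
inductive Piece (n : ℕ) : Type
  | one (v : Fin n) (a : List (Fin n)) : Piece n
  | two (v : Fin n) (a b : List (Fin n)) : Piece n

/-- Decompose a circuit `[v] ++ a₁ ++ [v] ++ a₂ ++ …`, given by the lists `aᵢ` (which avoid `v`).
Each even closed walk `[v] ++ aᵢ` is a 1-circuit; an odd one waits (in the second argument) for the
next odd one, with which it makes up a 2-circuit. -/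
def pieces {n : ℕ} (v : Fin n) : Option (List (Fin n)) → List (List (Fin n)) → List (Piece n)
  | _, [] => []
  | none, a :: t => if Odd a.length then .one v a :: pieces v none t else pieces v (some a) t
  | some a, b :: t =>
      if Odd b.length then .one v b :: pieces v (some a) t else .two v a b :: pieces v none t

/-- The 1-circuits and 2-circuits of a circuit, in the order in which they are processed. -/
def circuitPieces {n : ℕ} : List (Fin n) → List (Piece n)
  | [] => []
  | v :: t => pieces v none (t.splitOn v)

/-! ## Processing -/

/-- A procedure that, from the current graph, lists the graphs visited after it, in order. -/
abbrev Segment (n : ℕ) : Type := Edges n → List (Edges n)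

/-- First `f`, then `g`. -/
def seq {n : ℕ} (f g : Segment n) : Segment n :=
  fun Z => f Z ++ g ((f Z).getLastD Z)

/-- Perform a list of procedures, one after the other. -/
def seqAll {n : ℕ} (l : List (Segment n)) : Segment n :=
  l.foldr seq (fun _ => [])

/-- The switch on the 4-cycle `abce`: exchange present and absent edges. -/
def switch {n : ℕ} (a b c e : Fin n) : Segment n :=
  fun Z => [symmDiff Z {s(a, b), s(b, c), s(c, e), s(e, a)}]

/-- The phases of the processing of a 1-circuit `x 0, …, x (2 * k - 1)` with `x 0 x 1` present and
`x 0 x (2 * k - 1)` absent. The `s`-th step (`1 ≤ s < k`) is the switch on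
`x 0, x (2 * s - 1), x (2 * s), x (2 * s + 1)`. Suppose that steps `1, …, a` are done. The next
phase performs steps `b, b - 1, …, a + 1`, where `b > a` is such that the odd chord
`x 0 x (2 * b + 1)` is the first one after the `a`-th that is absent from the current graph (if
this chord reoccurs, since the circuit may pass through a vertex several times, then `b` is its last
occurrence before any other absent chord). The first argument bounds the number of phases. -/
def phases {n : ℕ} (x : ℕ → Fin n) (k : ℕ) : ℕ → ℕ → Segment n
  | 0, _ => fun _ => []
  | r + 1, a => fun Z =>
      let b := Nat.findGreatest (fun b => a < b ∧ s(x 0, x (2 * b + 1)) ∉ Z ∧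
        ∀ j ∈ Finset.Ioo a b, s(x 0, x (2 * j + 1)) ∉ Z → x (2 * j + 1) = x (2 * b + 1)) (k - 1)
      if b ≤ a then []
      else
        seq
          (seqAll ((List.range (b - a)).map fun i =>
            switch (x 0) (x (2 * (b - i) - 1)) (x (2 * (b - i))) (x (2 * (b - i) + 1))))
          (phases x k r b) Z

/-- Process the 1-circuit `[v] ++ a`, traversed in the direction that leaves `v` along an edge of
the current graph. -/
def processOne {n : ℕ} (v : Fin n) (a : List (Fin n)) : Segment n :=
  fun Z =>
    let c := if s(v, a.headD v) ∈ Z then a else a.reverse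
    let k := (c.length + 1) / 2
    phases (fun i => (v :: c).getD i v) k k 0 Z

/-- Process the 2-circuit `v w x … v … y` (with `a = w x …`, `b = … y`) by means of the shortcut
edge `xy`. The switch on `vwxy` is done first if it is possible, and otherwise it is done last. What
is left is the 1-circuit in which the path `y v w x` is replaced by the edge `y x`. -/
def processShortcut {n : ℕ} (v : Fin n) (a b : List (Fin n)) : Segment n :=
  let w := a.getD 0 v
  let x := a.getD 1 v
  let y := b.getLastD v
  fun Z =>
    if (s(v, w) ∈ Z ↔ s(x, y) ∈ Z) then
      seq (switch v w x y) (processOne v (a.tail.reverse ++ b.reverse)) Z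
    else
      seq (processOne v (a.tail.reverse ++ b.reverse)) (switch v w x y) Z

/-- Process a 2-circuit both of whose loops at `v` pass through a common vertex `u`, by exchanging
the ends of the loops at `u`; this gives two 1-circuits. Here `u` is the first vertex of `a` that
lies on `b`, and its first occurrence on `b` is taken. -/
def processSplit {n : ℕ} (v : Fin n) (a b : List (Fin n)) : Segment n :=
  let i := a.findIdx (· ∈ b)
  let u := a.getD i v
  let j := b.idxOf u
  if i % 2 = j % 2 then
    seq (processOne v (a.take i ++ [u] ++ (b.take j).reverse))
      (processOne v ((a.drop (i + 1)).reverse ++ [u] ++ b.drop (j + 1)))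
  else
    seq (processOne v (a.take i ++ [u] ++ b.drop (j + 1)))
      (processOne v ((a.drop (i + 1)).reverse ++ [u] ++ (b.take j).reverse))

/-- Process the 2-circuit `[v] ++ a ++ [v] ++ b = v w x … v z … y`: by the shortcut edge `xy` if `x`
and `y` are distinct and `xy` is not an edge of the 2-circuit; otherwise by the shortcut edge `xz`
under the same condition (the second loop is then traversed backwards); otherwise by splitting it
into two 1-circuits. -/
def processTwo {n : ℕ} (v : Fin n) (a b : List (Fin n)) : Segment n :=
  let x := a.getD 1 v
  let y := b.getLastD v
  let z := b.headD v
  let S := walkEdges (v :: a) ∪ walkEdges (v :: b)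
  if x ≠ y ∧ s(x, y) ∉ S then processShortcut v a b
  else if x ≠ z ∧ s(x, z) ∉ S then processShortcut v a b.reverse
  else processSplit v a b

/-- Process a 1-circuit or a 2-circuit. -/
def Piece.process {n : ℕ} : Piece n → Segment n
  | .one v a => processOne v a
  | .two v a b => processTwo v a b

/-- Process all circuits of the edge set `H`, in order, for the pairing given by `m`. -/
def processAll {n : ℕ} (m : Fin n → Fin n → Fin n) (H : Edges n) : Segment n :=
  seqAll (((circuits m H.card H).flatMap circuitPieces).map Piece.process)

/-- The canonical path `γ_ψ(G, G')` from `G` to `G'`, as the list of the edge sets of its graphs. -/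
noncomputable def canonicalPath {n : ℕ} {G G' : SimpleGraph (Fin n)} (ψ : Pairing G G') :
    List (Edges n) :=
  edges G :: processAll (mate ψ) (edges (symmDiff G G')) (edges G)

/-! ## The flow -/

/-- The stationary distribution of the switch chain is uniform. -/
noncomputable def stationary {n d : ℕ} (_ : Ω n d) : ℝ := 1 / (Fintype.card (Ω n d) : ℝ)

/-- The flow along the path `γ_ψ(G, G')`: the demand from `G` to `G'` is divided equally between the
pairings. -/
noncomputable def pathFlow {n d : ℕ} (G G' : Ω n d) : ℝ :=
  stationary G * stationary G' / (Fintype.card (Pairing G.1 G'.1) : ℝ)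

open Classical in
/-- `flow Z Z' = f(e)` for `e = (Z, Z')`: the total flow on the canonical paths, between distinct
states, that pass from `Z` directly to `Z'`. -/
noncomputable def flow {n d : ℕ} (Z Z' : Ω n d) : ℝ :=
  ∑ G : Ω n d, ∑ G' : Ω n d, ∑ ψ : Pairing G.1 G'.1,
    if G ≠ G' ∧ [edges Z.1, edges Z'.1] <:+: canonicalPath ψ then pathFlow G G' else 0

end SwitchChain

/-!
The flow through a transition `(Z, Z')` is, up to normalization, the number of triples `(G, G', ψ)`
whose canonical path passes from `Z` to `Z'`, each with weight `1 / |Ψ(G, G')|`. The proof encodes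
such a triple by a code of the step, the matrix `L = G + G' - Z`, and the pairing `ψ`, and counts the
possible values of each in terms of `Z` and `Z'` alone.

*The graphs on a path.* Modulo 2, edge sets are functions `chi` on the pairs of vertices, and a
switch adds a 4-cycle. The first `j` steps of a 1-circuit add up to an initial part of the circuit,
closed by an odd chord; hence a step of a phase takes place in a graph that differs from the start
graph of the circuit by two parts of the circuit and by at most three chords at the start vertex `v`.
This gives `Z = G + F + (chords)`, where `F` is a set of edges of `G △ G'`. The chords are those of a
star at `v` and possibly a shortcut edge `xy`, and there are only few pairs of edges matched by `ψ`
that have exactly one edge in `F`: five at `v`, one for each end of a chord of the star, one at `x`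
and one at `y`. These facts are carried from the phases (`spec_phases`) to 1-circuits
(`spec_processOne`), 2-circuits (`spec_processTwo`), circuits (`Circuit.spec_pieces`) and whole paths
(`spec_processAll`, `pathStep_of_infix`). The data of a step are collected in `PathData`.

*Reconstruction.* The matrix `L` gives `G △ G'`, as the set where `L + Z` equals `1`, and `ψ` then
gives the circuits. Each circuit is coloured alternately, so that it remains to find the colour of one
of its edges. For the circuits before and after the current one this colour is known from `Z`, and in
the current circuit the step itself contains an edge that has not been exchanged
(`PathData.unique`, `Encodes.unique`).

*Counting.* There are at most `8` 4-cycles `vpqt` on which the switch leads from `Z` to `Z'`, at most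
`d ^ 2 + 1` stars, since two of their chords are edges of `Z`, and at most `n ^ 2` shortcut edges
(`card_stepCodes_le`). The matrix `L` is symmetric with row sums `d`, and has entries `0` and `1`
except at the chords, where `-1` and `2` may occur. Each of these is repaired by a shift along a
4-cycle (`exists_repair`), which can be undone if few parameters are known; so the number of matrices
is at most a constant `matBound` times the number of graphs (`card_stepMats_le`). Finally, in the
current graph without the chords, `ψ` matches edges of different colours, except at the at most ten
pairs that `F` cuts. At a vertex with `θ` blue and `θ` red edges there are `θ!` perfect matchings
between the colours, and each monochromatic pair costs a factor of at most `d`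
(`card_involutions_le`); thus the pairings contribute at most `d ^ 10` relative to `|Ψ(G, G')|`
(`card_stepPairings_le`). The product of these numbers is at most `2 d ^ 20 n ^ 5` (`numeric_bound`).
-/


namespace SwitchChain

/-! ### Edge sets modulo 2 -/

/-- The indicator of an edge set, with values in `ZMod 2`: symmetric differences become sums. -/
def chi {n : ℕ} (E : Edges n) : Sym2 (Fin n) → ZMod 2 := fun e => if e ∈ E then 1 else 0

/-- The indicator of the single edge `ab`. -/
def ed {n : ℕ} (a b : Fin n) : Sym2 (Fin n) → ZMod 2 := Pi.single s(a, b) 1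

lemma zmod_two_eq (a : ZMod 2) : a = 0 ∨ a = 1 := by
  revert a; decide

lemma zmod_two_add_self (a : ZMod 2) : a + a = 0 := by
  revert a; decide

lemma fun_add_self {α : Type*} (f : α → ZMod 2) : f + f = 0 := by
  funext x; exact zmod_two_add_self _

section
variable {n : ℕ}

lemma chi_eq_one {E : Edges n} {e : Sym2 (Fin n)} : chi E e = 1 ↔ e ∈ E := by
  unfold chi; split_ifs with h <;> simp [h]

lemma chi_eq_zero {E : Edges n} {e : Sym2 (Fin n)} : chi E e = 0 ↔ e ∉ E := by
  unfold chi; split_ifs with h <;> simp [h]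

lemma chi_symmDiff (A B : Edges n) : chi (symmDiff A B) = chi A + chi B := by
  funext e
  simp only [chi, Finset.mem_symmDiff, Pi.add_apply]
  by_cases h1 : e ∈ A <;> by_cases h2 : e ∈ B <;> simp [h1, h2]
  decide

lemma ed_apply (a b : Fin n) (e : Sym2 (Fin n)) : ed a b e = if e = s(a, b) then 1 else 0 := by
  simp [ed, Pi.single_apply]

lemma ed_comm (a b : Fin n) : ed a b = ed b a := by
  unfold ed; rw [Sym2.eq_swap]

/-- The edges of a 4-cycle without repeated vertices. -/
lemma chi_cycle {a b c e : Fin n} (hab : a ≠ b) (hac : a ≠ c) (hae : a ≠ e) (hbe : b ≠ e) :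
    chi ({s(a, b), s(b, c), s(c, e), s(e, a)} : Edges n) = ed a b + ed b c + ed c e + ed e a := by
  funext f
  simp only [chi, Pi.add_apply, ed_apply, Finset.mem_insert, Finset.mem_singleton]
  have h1 : s(a, b) ≠ s(b, c) := by simp; grind
  have h2 : s(a, b) ≠ s(c, e) := by simp; grind
  have h3 : s(a, b) ≠ s(e, a) := by simp; grind
  have h4 : s(b, c) ≠ s(c, e) := by simp; grind
  have h5 : s(b, c) ≠ s(e, a) := by simp; grind
  have h6 : s(c, e) ≠ s(e, a) := by simp; grind
  by_cases g1 : f = s(a, b)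
  · subst g1; simp only [h1, h2, h3]; simp
  by_cases g2 : f = s(b, c)
  · subst g2; simp only [h1.symm, h4, h5]; simp
  by_cases g3 : f = s(c, e)
  · subst g3; simp only [h2.symm, h4.symm, h6]; simp
  by_cases g4 : f = s(e, a)
  · subst g4; simp only [h3.symm, h5.symm, h6.symm]; simp
  simp [g1, g2, g3, g4]

/-! ### Sums over the edges of a walk -/

/-- The `i`-th edge of the walk `x 0, x 1, …`. -/
def edgeAt (x : ℕ → Fin n) (i : ℕ) : Sym2 (Fin n) := s(x i, x (i + 1))

/-- The sum of the indicators of the edges of a walk with indices in `I`. -/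
def edgeSum (x : ℕ → Fin n) (I : Finset ℕ) : Sym2 (Fin n) → ZMod 2 :=
  ∑ i ∈ I, ed (x i) (x (i + 1))

lemma edgeSum_apply_of_notMem {x : ℕ → Fin n} {I : Finset ℕ} {e : Sym2 (Fin n)}
    (h : ∀ i ∈ I, edgeAt x i ≠ e) : edgeSum x I e = 0 := by
  simp only [edgeSum, Finset.sum_apply]
  refine Finset.sum_eq_zero fun i hi => ?_
  rw [ed_apply, if_neg]
  exact fun h' => h i hi h'.symm

lemma edgeSum_apply_edgeAt {x : ℕ → Fin n} {N : ℕ}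
    (hinj : Set.InjOn (edgeAt x) (Set.Iio N)) {I : Finset ℕ} (hI : ∀ i ∈ I, i < N) {j : ℕ}
    (hj : j < N) : edgeSum x I (edgeAt x j) = if j ∈ I then 1 else 0 := by
  simp only [edgeSum, Finset.sum_apply]
  rw [← Finset.sum_ite_eq' I j (fun _ => (1 : ZMod 2))]
  refine Finset.sum_congr rfl fun i hi => ?_
  rw [ed_apply]
  have : edgeAt x j = s(x i, x (i + 1)) ↔ i = j :=
    ⟨fun h => (hinj (Set.mem_Iio.2 hj) (Set.mem_Iio.2 (hI i hi)) h).symm, fun h => by subst h; rfl⟩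
  simp [this]

/-- `m` pairs the edges at each vertex; `Cross m φ K` says that, if `φ` takes different values on
two paired edges at `v`, then one of these edges is `vc` for some `(v, c)` in the list `K`. -/
def Cross (m : Fin n → Fin n → Fin n) (φ : Sym2 (Fin n) → ZMod 2) (K : List (Fin n × Fin n)) :
    Prop :=
  ∀ v e, φ s(v, e) ≠ φ s(v, m v e) → (v, e) ∈ K ∨ (v, m v e) ∈ K

/-- The pair of edges of `m` to which the edge `c.1 c.2` belongs at `c.1` is listed in `K`. -/
def Corner (m : Fin n → Fin n → Fin n) (K : List (Fin n × Fin n)) (v e : Fin n) : Prop :=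
  (v, e) ∈ K ∨ (v, m v e) ∈ K

variable {m : Fin n → Fin n → Fin n}

lemma Corner.mono {K K' : List (Fin n × Fin n)} {v e : Fin n} (h : Corner m K v e)
    (hK : K ⊆ K') : Corner m K' v e := h.imp (@hK _) (@hK _)

lemma Corner.mate (hm : ∀ v, Function.Involutive (m v)) {K : List (Fin n × Fin n)} {v e : Fin n}
    (h : Corner m K v e) : Corner m K v (m v e) := by
  unfold Corner at *; rw [hm v e]; exact h.symm

lemma Cross.add {φ φ' : Sym2 (Fin n) → ZMod 2} {K : List (Fin n × Fin n)}
    (h : Cross m φ K) (h' : Cross m φ' K) : Cross m (φ + φ') K := by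
  intro v e hne
  by_cases h1 : φ s(v, e) = φ s(v, m v e)
  · by_cases h2 : φ' s(v, e) = φ' s(v, m v e)
    · exact absurd (by simp [h1, h2]) hne
    · exact h' v e h2
  · exact h v e h1

lemma Cross.mono {φ : Sym2 (Fin n) → ZMod 2} {K K' : List (Fin n × Fin n)} (h : Cross m φ K)
    (hK : K ⊆ K') : Cross m φ K' := fun v e hne => (h v e hne).imp (@hK _) (@hK _)

lemma Cross.zero (K : List (Fin n × Fin n)) : Cross m 0 K := by
  intro v e h; exact absurd rfl h

/-- The paired edges on which a sum of edges of a walk differs are at the ends of the parts of the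
walk that it covers, and where the walk does not leave by the edge paired with the one of
arrival. -/
lemma cross_edgeSum (hm : ∀ v, Function.Involutive (m v)) {x : ℕ → Fin n} {N : ℕ}
    (hinj : Set.InjOn (edgeAt x) (Set.Iio N)) {I : Finset ℕ} (hI : ∀ i ∈ I, i < N)
    {K : List (Fin n × Fin n)}
    (h1 : ∀ k ∈ I, (1 ≤ k ∧ k - 1 ∈ I ∧ x (k + 1) = m (x k) (x (k - 1))) ∨
      Corner m K (x k) (x (k + 1)))
    (h2 : ∀ k ∈ I, (k + 1 ∈ I ∧ x (k + 2) = m (x (k + 1)) (x k)) ∨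
      Corner m K (x (k + 1)) (x k)) :
    Cross m (edgeSum x I) K := by
  -- an edge of the sum whose partner is not one
  have key : ∀ v e, edgeSum x I s(v, e) = 1 → edgeSum x I s(v, m v e) ≠ 1 → Corner m K v e := by
    intro v e ha hb
    have : ∃ k ∈ I, edgeAt x k = s(v, e) := by
      by_contra! hcon
      rw [edgeSum_apply_of_notMem hcon] at ha
      exact absurd ha (by decide)
    obtain ⟨k, hk, hke⟩ := this
    have hone : ∀ j ∈ I, edgeSum x I (edgeAt x j) = 1 := fun j hj => by
      rw [edgeSum_apply_edgeAt hinj hI (hI j hj), if_pos hj]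
    rcases Sym2.eq_iff.1 hke with ⟨rfl, rfl⟩ | ⟨rfl, rfl⟩
    · rcases h1 k hk with ⟨hk1, hk2, hk3⟩ | h
      · exfalso
        apply hb
        rw [hk3, hm, ← hone _ hk2]
        congr 1
        unfold edgeAt
        rw [Nat.sub_add_cancel hk1, Sym2.eq_swap]
      · exact h
    · rcases h2 k hk with ⟨hk2, hk3⟩ | h
      · exfalso
        apply hb
        rw [← hk3, ← hone _ hk2]
        rfl
      · exact h
  intro v e hne
  rcases zmod_two_eq (edgeSum x I s(v, e)) with h0 | h0
  · have hb : edgeSum x I s(v, m v e) = 1 := by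
      rcases zmod_two_eq (edgeSum x I s(v, m v e)) with h | h
      · exact absurd (h0.trans h.symm) hne
      · exact h
    have := key v (m v e) hb (by rw [hm, h0]; decide)
    have h := this.mate hm
    rwa [hm] at h
  · exact key v e h0 (by rw [← h0]; exact hne.symm)

end

section
variable {n : ℕ}

/-! ### Consecutive graphs of a procedure -/

/-- Started at `Z`, the procedure `f` adds `φ` to the current graph, modulo 2, and any two
consecutive graphs that it visits satisfy `P`. -/
def Spec (f : Segment n) (Z : Edges n) (φ : Sym2 (Fin n) → ZMod 2)
    (P : Edges n → Edges n → Prop) : Prop :=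
  chi ((f Z).getLastD Z) = chi Z + φ ∧ ∀ A B, [A, B] <:+: Z :: f Z → P A B

lemma infix_pair_cons {α : Type*} {A B Z Y : α} {l : List α} :
    [A, B] <:+: Z :: Y :: l ↔ (A = Z ∧ B = Y) ∨ [A, B] <:+: Y :: l := by
  rw [List.infix_cons_iff]
  simp [List.cons_prefix_cons]

lemma infix_pair_append {α : Type*} {A B : α} (l l' : List α) (Z : α)
    (h : [A, B] <:+: Z :: (l ++ l')) :
    [A, B] <:+: Z :: l ∨ [A, B] <:+: l.getLastD Z :: l' := by
  induction l generalizing Z with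
  | nil => right; simpa using h
  | cons Y l ih =>
    rw [List.cons_append, infix_pair_cons] at h
    rcases h with h | h
    · left; rw [infix_pair_cons]; exact Or.inl h
    · rcases ih Y h with h | h
      · left; rw [infix_pair_cons]; exact Or.inr h
      · right; rwa [List.getLastD_cons]

lemma Spec.seq {f g : Segment n} {Z : Edges n} {φ φ' : Sym2 (Fin n) → ZMod 2}
    {P : Edges n → Edges n → Prop} (hf : Spec f Z φ P)
    (hg : ∀ Z', chi Z' = chi Z + φ → Spec g Z' φ' P) : Spec (seq f g) Z (φ + φ') P := by
  have h := hg _ hf.1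
  constructor
  · have : (SwitchChain.seq f g Z).getLastD Z
        = (g ((f Z).getLastD Z)).getLastD ((f Z).getLastD Z) := by
      unfold SwitchChain.seq
      simp only [List.getLastD_eq_getLast?, List.getLast?_append]
      cases (g ((f Z).getLast?.getD Z)).getLast? <;> simp
    rw [this, h.1, hf.1, add_assoc]
  · intro A B hAB
    rcases infix_pair_append _ _ _ hAB with h' | h'
    · exact hf.2 A B h'
    · exact h.2 A B h'

lemma Spec.nil (Z : Edges n) (P : Edges n → Edges n → Prop) :
    Spec (fun _ => []) Z 0 P := by
  refine ⟨by simp, fun A B h => ?_⟩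
  have := h.length_le
  simp at this

lemma Spec.congr {f : Segment n} {Z : Edges n} {φ φ' : Sym2 (Fin n) → ZMod 2}
    {P : Edges n → Edges n → Prop} (hf : Spec f Z φ P) (h : φ = φ') : Spec f Z φ' P := h ▸ hf

lemma Spec.mono {f : Segment n} {Z : Edges n} {φ : Sym2 (Fin n) → ZMod 2}
    {P Q : Edges n → Edges n → Prop} (hf : Spec f Z φ P) (h : ∀ A B, P A B → Q A B) :
    Spec f Z φ Q := ⟨hf.1, fun A B hAB => h A B (hf.2 A B hAB)⟩

lemma Spec.switch {a b c e : Fin n} (hab : a ≠ b) (hac : a ≠ c) (hae : a ≠ e) (hbe : b ≠ e)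
    {Z : Edges n} {P : Edges n → Edges n → Prop}
    (h : P Z (symmDiff Z {s(a, b), s(b, c), s(c, e), s(e, a)})) :
    Spec (switch a b c e) Z (ed a b + ed b c + ed c e + ed e a) P := by
  constructor
  · simp only [SwitchChain.switch, List.getLastD_cons, List.getLastD_nil]
    rw [chi_symmDiff, chi_cycle hab hac hae hbe]
  · intro A B hAB
    simp only [SwitchChain.switch] at hAB
    rw [infix_pair_cons] at hAB
    rcases hAB with ⟨rfl, rfl⟩ | hAB
    · exact h
    · have := hAB.length_le
      simp at this

/-- A list of procedures after `i` of which the sum of the changes is `φ i`. -/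
lemma Spec.steps {P : Edges n → Edges n → Prop} (l : ℕ) :
    ∀ (T : ℕ → Segment n) (φ : ℕ → Sym2 (Fin n) → ZMod 2) (c : Sym2 (Fin n) → ZMod 2)
      (Z : Edges n), chi Z = c + φ 0 →
      (∀ i < l, ∀ Z', chi Z' = c + φ i → Spec (T i) Z' (φ i + φ (i + 1)) P) →
      Spec (seqAll ((List.range l).map T)) Z (φ 0 + φ l) P := by
  induction l with
  | zero =>
    intro T φ c Z _ _
    refine (Spec.nil Z P).congr ?_
    rw [fun_add_self]
  | succ l ih =>
    intro T φ c Z hZ hT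
    rw [List.range_succ_eq_map, List.map_cons, List.map_map]
    refine ((hT 0 (Nat.succ_pos l) Z hZ).seq (φ' := φ 1 + φ (l + 1)) ?_).congr ?_
    · intro Z' hZ'
      refine ih (T ∘ Nat.succ) (fun i => φ (i + 1)) c Z' ?_ ?_
      · rw [hZ', hZ, zero_add, add_assoc, ← add_assoc (φ 0), fun_add_self, zero_add]
      · intro i hi Z'' hZ''
        exact hT (i + 1) (by omega) Z'' hZ''
    · rw [zero_add, add_assoc, ← add_assoc (φ 1), fun_add_self, zero_add]

/-! ### The phases of a 1-circuit -/

/-- The closed walk `x 0, …, x (2 * j + 1)`, closed by an odd chord: this is what the first `j` steps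
of the processing exchange. -/
def cyc (x : ℕ → Fin n) (j : ℕ) : Sym2 (Fin n) → ZMod 2 :=
  edgeSum x (Finset.range (2 * j + 1)) + ed (x 0) (x (2 * j + 1))

lemma cyc_zero (x : ℕ → Fin n) : cyc x 0 = 0 := by
  simp [cyc, edgeSum, fun_add_self]

/-- The difference of two consecutive closed walks is the 4-cycle of the step between them. -/
lemma cyc_succ (x : ℕ → Fin n) (j : ℕ) : cyc x (j + 1) + cyc x j =
    ed (x 0) (x (2 * j + 1)) + ed (x (2 * j + 1)) (x (2 * j + 2)) +
      ed (x (2 * j + 2)) (x (2 * j + 3)) + ed (x (2 * j + 3)) (x 0) := by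
  have h : edgeSum x (Finset.range (2 * (j + 1) + 1)) = edgeSum x (Finset.range (2 * j + 1)) +
      ed (x (2 * j + 1)) (x (2 * j + 2)) + ed (x (2 * j + 2)) (x (2 * j + 3)) := by
    unfold edgeSum
    rw [show 2 * (j + 1) + 1 = (2 * j + 1) + 1 + 1 by ring, Finset.sum_range_succ,
      Finset.sum_range_succ]
  unfold cyc
  rw [h, ed_comm (x (2 * j + 3)) (x 0), show 2 * (j + 1) + 1 = 2 * j + 3 by ring]
  have := fun_add_self (edgeSum x (Finset.range (2 * j + 1)))
  generalize edgeSum x (Finset.range (2 * j + 1)) = S at *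
  calc _ = (S + S) + (ed (x 0) (x (2 * j + 1)) + ed (x (2 * j + 1)) (x (2 * j + 2)) +
      ed (x (2 * j + 2)) (x (2 * j + 3)) + ed (x 0) (x (2 * j + 3))) := by abel
    _ = _ := by rw [this, zero_add]

lemma cyc_star {x : ℕ → Fin n} {k : ℕ} (hx0 : ∀ i, 1 ≤ i → i < 2 * k → x i ≠ x 0) {j : ℕ}
    (hj : j < k) (w : Fin n) : cyc x j s(x 0, w) =
      (if w = x 1 then 1 else 0) + (if w = x (2 * j + 1) then 1 else 0) := by
  have h1 : ∀ y, (s(x 0, w) = s(x 0, y) ↔ w = y) := fun y => Sym2.congr_right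
  unfold cyc
  rw [Pi.add_apply, ed_apply, edgeSum, Finset.sum_apply, Finset.sum_range_succ', ed_apply]
  simp only [h1, zero_add]
  congr 1
  rw [Finset.sum_eq_zero, zero_add]
  intro i hi
  rw [Finset.mem_range] at hi
  rw [ed_apply, if_neg]
  intro h
  rcases Sym2.eq_iff.1 h with ⟨h, _⟩ | ⟨h, _⟩
  · exact hx0 (i + 1) (by omega) (by omega) h.symm
  · exact hx0 (i + 1 + 1) (by omega) (by omega) h.symm

/-- A step of a phase. Steps `1, …, a` and `s + 1, …, b` are done in the graph `A`, and `B` is the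
result of step `s`; `x (2 * a + 1)`, `x (2 * s + 1)` and `x (2 * b + 1)` are the ends of the odd
chords that are exchanged in `A`. -/
structure PhaseStep (x : ℕ → Fin n) (k : ℕ) (Z : Edges n) (a s b : ℕ) (A B : Edges n) : Prop where
  lt : a < s
  le : s ≤ b
  lt_k : b < k
  chi_eq : chi A = chi Z + (cyc x a + cyc x s + cyc x b)
  eq_switch : B = symmDiff A {s(x 0, x (2 * s - 1)), s(x (2 * s - 1), x (2 * s)),
    s(x (2 * s), x (2 * s + 1)), s(x (2 * s + 1), x 0)}
  ne : x (2 * a + 1) ≠ x (2 * b + 1)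
  left_mem : x (2 * s + 1) ≠ x (2 * a + 1) → s(x 0, x (2 * a + 1)) ∈ A
  right_mem : x (2 * s + 1) ≠ x (2 * b + 1) → s(x 0, x (2 * b + 1)) ∈ A
  notMem : x (2 * s + 1) ≠ x (2 * a + 1) → x (2 * s + 1) ≠ x (2 * b + 1) →
    s(x 0, x (2 * s + 1)) ∉ A

/-- The phases that remain after the first `a` steps. Every step is described by `PhaseStep`, and in
the end all `k - 1` steps are done. When a phase starts, the odd chords strictly between the `a`-th
and the `b`-th one are present, except for those that are the same edge as the `b`-th one; hence the
chords that are exchanged in a graph `A` have the colours stated in `PhaseStep`. -/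
lemma spec_phases {x : ℕ → Fin n} {k : ℕ} {Z₀ : Edges n}
    (hx0 : ∀ i, 1 ≤ i → i < 2 * k → x i ≠ x 0)
    (h2 : ∀ s, 1 ≤ s → s < k → x (2 * s - 1) ≠ x (2 * s + 1))
    (hfirst : s(x 0, x 1) ∈ Z₀) (hlast : s(x 0, x (2 * (k - 1) + 1)) ∉ Z₀) {P : Edges n → Edges n → Prop}
    (hP : ∀ a s b A B, PhaseStep x k Z₀ a s b A B → P A B) (r : ℕ) :
    ∀ (a : ℕ) (Z : Edges n), a < k → k - 1 - a ≤ r → chi Z = chi Z₀ + cyc x a →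
      s(x 0, x (2 * a + 1)) ∈ Z →
      (a < k - 1 → ∃ j, a < j ∧ j < k ∧ s(x 0, x (2 * j + 1)) ∉ Z) →
      Spec (phases x k r a) Z (cyc x a + cyc x (k - 1)) P := by
  induction r with
  | zero =>
    intro a Z hak hr _ _ _
    obtain rfl : a = k - 1 := by omega
    exact (Spec.nil Z P).congr (fun_add_self _).symm
  | succ r ih =>
    intro a Z hak hr hZ hmem hex
    by_cases hak' : a = k - 1
    · subst hak'
      have hb : Nat.findGreatest (fun b => k - 1 < b ∧ s(x 0, x (2 * b + 1)) ∉ Z ∧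
        ∀ j ∈ Finset.Ioo (k - 1) b, s(x 0, x (2 * j + 1)) ∉ Z → x (2 * j + 1) = x (2 * b + 1))
          (k - 1) ≤ k - 1 := Nat.findGreatest_le _
      have : phases x k (r + 1) (k - 1) Z = [] := by
        simp only [phases]
        rw [if_pos hb]
      have h0 : Spec (fun _ => []) Z 0 P := Spec.nil Z P
      unfold Spec at h0 ⊢
      rw [this, fun_add_self]
      exact h0
    obtain ⟨j₀, hj₀a, hj₀k, hj₀⟩ := hex (by omega)
    set Q : ℕ → Prop := fun b => a < b ∧ s(x 0, x (2 * b + 1)) ∉ Z ∧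
        ∀ j ∈ Finset.Ioo a b, s(x 0, x (2 * j + 1)) ∉ Z → x (2 * j + 1) = x (2 * b + 1) with hQ
    set b := Nat.findGreatest Q (k - 1) with hb
    have hmax : ∀ j, j ≤ k - 1 → Q j → j ≤ b := fun j h1 h2 => Nat.le_findGreatest h1 h2
    have hQb : Q b := by
      -- the first absent odd chord qualifies
      have hne : ∃ j, a < j ∧ s(x 0, x (2 * j + 1)) ∉ Z := ⟨j₀, hj₀a, hj₀⟩
      classical
      have hs := Nat.find_spec hne
      have hle : Nat.find hne ≤ j₀ := Nat.find_min' hne ⟨hj₀a, hj₀⟩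
      refine Nat.findGreatest_spec (P := Q) (m := Nat.find hne) (by omega) ⟨hs.1, hs.2, ?_⟩
      intro j hj hjZ
      rw [Finset.mem_Ioo] at hj
      exact absurd ⟨hj.1, hjZ⟩ (Nat.find_min hne hj.2)
    have hbk : b ≤ k - 1 := Nat.findGreatest_le _
    clear_value b
    obtain ⟨hab, hbZ, hIoo⟩ := hQb
    have hphase : phases x k (r + 1) a Z = seq
          (seqAll ((List.range (b - a)).map fun i =>
            switch (x 0) (x (2 * (b - i) - 1)) (x (2 * (b - i))) (x (2 * (b - i) + 1))))
          (phases x k r b) Z := by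
      have : ¬ Nat.findGreatest Q (k - 1) ≤ a := by rw [← hb]; omega
      rw [hb]
      simp only [phases]
      rw [if_neg this]
    have hkb : k - 1 - b ≤ r := by omega
    clear hb
    have huu : x (2 * a + 1) ≠ x (2 * b + 1) := fun h => hbZ (h ▸ hmem)
    have hsteps : Spec (seqAll ((List.range (b - a)).map fun i =>
            switch (x 0) (x (2 * (b - i) - 1)) (x (2 * (b - i))) (x (2 * (b - i) + 1)))) Z
            (cyc x b + cyc x a) P := by
      refine (Spec.steps (b - a) _ (fun i => cyc x b + cyc x (b - i)) (chi Z) Z ?_ ?_).congr ?_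
      · simp [fun_add_self]
      · intro i hi A hA
        set s := b - i with hs
        have hsa : a < s := by omega
        have hsb : s ≤ b := by omega
        have h2s := h2 s (by omega) (by omega)
        have hval : ∀ w, chi A s(x 0, w) = chi Z s(x 0, w) +
            ((if w = x (2 * b + 1) then 1 else 0) + (if w = x (2 * s + 1) then 1 else 0)) := by
          intro w
          rw [hA]
          simp only [Pi.add_apply]
          rw [cyc_star hx0 (by omega), cyc_star hx0 (by omega)]
          generalize (if w = x 1 then (1 : ZMod 2) else 0) = c
          have := zmod_two_add_self c
          linear_combination this
        refine (Spec.switch (hx0 _ (by omega) (by omega)).symm (hx0 _ (by omega) (by omega)).symm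
          (hx0 _ (by omega) (by omega)).symm h2s
          (hP a s b A _ ⟨hsa, hsb, by omega, ?_, rfl, huu, ?_, ?_, ?_⟩)).congr ?_
        · rw [hA, hZ]; abel
        · intro h
          rw [← chi_eq_one, hval, if_neg huu, if_neg h.symm, chi_eq_one.2 hmem]; rfl
        · intro h
          rw [← chi_eq_one, hval, if_pos rfl, if_neg h.symm, chi_eq_zero.2 hbZ]; rfl
        · intro h h'
          have hsb' : s < b := lt_of_le_of_ne hsb (fun e => h' (by rw [e]))
          have : s(x 0, x (2 * s + 1)) ∈ Z := by
            by_contra hcon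
            exact h' (hIoo s (Finset.mem_Ioo.2 ⟨hsa, hsb'⟩) hcon)
          rw [← chi_eq_zero, hval, if_neg h', if_pos rfl, chi_eq_one.2 this]; rfl
        · obtain ⟨j, hj⟩ : ∃ j, s = j + 1 := ⟨s - 1, by omega⟩
          have hj' : b - (i + 1) = j := by omega
          rw [hj', hj]
          have h := cyc_succ x j
          rw [show 2 * (j + 1) - 1 = 2 * j + 1 by omega, show 2 * (j + 1) = 2 * j + 2 by ring,
            show 2 * j + 2 + 1 = 2 * j + 3 by ring, ← h]
          have h3 := fun_add_self (cyc x b)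
          calc _ = (cyc x b + cyc x b) + (cyc x (j + 1) + cyc x j) := by rw [h3, zero_add]
            _ = _ := by abel
      · have h3 := fun_add_self (cyc x b)
        have : b - (b - a) = a := by omega
        simp only [Nat.sub_zero, this, h3, zero_add]
    have hspec : Spec (seq
          (seqAll ((List.range (b - a)).map fun i =>
            switch (x 0) (x (2 * (b - i) - 1)) (x (2 * (b - i))) (x (2 * (b - i) + 1))))
          (phases x k r b)) Z (cyc x a + cyc x (k - 1)) P := by
      refine (hsteps.seq (φ' := cyc x b + cyc x (k - 1)) ?_).congr ?_
      · intro Z' hZ'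
        have hval : ∀ w, chi Z' s(x 0, w) = chi Z s(x 0, w) +
            ((if w = x (2 * b + 1) then 1 else 0) + (if w = x (2 * a + 1) then 1 else 0)) := by
          intro w
          rw [hZ']
          simp only [Pi.add_apply]
          rw [cyc_star hx0 (by omega), cyc_star hx0 (by omega)]
          generalize (if w = x 1 then (1 : ZMod 2) else 0) = c
          have := zmod_two_add_self c
          linear_combination this
        refine ih b Z' (by omega) hkb ?_ ?_ ?_
        · rw [hZ', hZ]
          have h3 := fun_add_self (cyc x a)
          calc _ = chi Z₀ + cyc x b + (cyc x a + cyc x a) := by abel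
            _ = _ := by rw [h3, add_zero]
        · rw [← chi_eq_one, hval, if_pos rfl, if_neg huu.symm, chi_eq_zero.2 hbZ]; rfl
        · intro hbk'
          by_contra! hcon
          -- the chord to `x (2 * k - 1)` would be present, which it never is unless it is the
          -- one exchanged last
          have hne : ∀ j, b < j → j < k → x (2 * j + 1) ≠ x (2 * a + 1) := by
            intro j h1 h2 h3
            have := chi_eq_one.2 (hcon j h1 h2)
            rw [h3, hval, if_neg huu, if_pos rfl, chi_eq_one.2 hmem] at this
            exact absurd this (by decide)
          have hpres : ∀ j, b < j → j < k → x (2 * j + 1) ≠ x (2 * b + 1) →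
              s(x 0, x (2 * j + 1)) ∈ Z := by
            intro j h1 h2 h3
            have := chi_eq_one.2 (hcon j h1 h2)
            rw [hval, if_neg h3, if_neg (hne j h1 h2)] at this
            rw [← chi_eq_one, ← this]; simp
          by_cases hu' : ∃ j, b < j ∧ j < k ∧ x (2 * j + 1) = x (2 * b + 1)
          · obtain ⟨j, h1, h2, h3⟩ := hu'
            have : j ≤ b := by
              refine hmax j (by omega) ⟨by omega, by rwa [h3], ?_⟩
              intro i hi hiZ
              rw [Finset.mem_Ioo] at hi
              rw [h3]
              rcases lt_trichotomy i b with h | h | h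
              · exact hIoo i (Finset.mem_Ioo.2 ⟨hi.1, h⟩) hiZ
              · rw [h]
              · by_contra hcon'
                exact hiZ (hpres i h (by omega) hcon')
            omega
          · push Not at hu'
            have hp := hpres (k - 1) hbk' (by omega) (hu' _ hbk' (by omega))
            have h1 := hne (k - 1) hbk' (by omega)
            have h2 := chi_eq_one.2 hp
            rw [hZ, Pi.add_apply, cyc_star hx0 (by omega), if_neg h1, chi_eq_zero.2 hlast,
              zero_add, add_zero] at h2
            split_ifs at h2 with h4
            · rw [h4] at hlast
              exact hlast hfirst
            · exact absurd h2 (by decide)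
      · have h3 := fun_add_self (cyc x b)
        calc _ = cyc x a + cyc x (k - 1) + (cyc x b + cyc x b) := by abel
          _ = _ := by rw [h3, add_zero]
    unfold Spec at hspec ⊢
    rw [hphase]
    exact hspec

end

section
variable {n : ℕ} {m : Fin n → Fin n → Fin n}

/-! ### Processing a 1-circuit -/

/-- The chords at `v` that are exchanged in the current graph, during a step whose new chord is `vt`:
none, a single one, or those to `u`, `t` and `u'`. -/
def starSum (v t : Fin n) : Option (Fin n × Fin n) → Sym2 (Fin n) → ZMod 2
  | none => 0
  | some (u, u') => if u = u' then ed v u else ed v u + ed v t + ed v u'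

/-- The chords from `v` that are named by the code are present in `A`, and `vt` is absent if it is
exchanged. -/
def StarOK (A : Edges n) (v t : Fin n) : Option (Fin n × Fin n) → Prop
  | none => True
  | some (u, u') => s(v, u) ∈ A ∧ s(v, u') ∈ A ∧ (u ≠ u' → s(v, t) ∉ A)

/-- The vertices at which the processed part of the circuit may end, with multiplicity. -/
def starEnds (t : Fin n) : Option (Fin n × Fin n) → List (Fin n)
  | none => []
  | some (u, u') => if u = u' then [u, t, t] else [u, t, u']

/-- A closed walk `x 0, …, x N = x 0` that passes `x 0` once and no edge twice. Except for the edge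
`ex`, it leaves each vertex by the edge paired with the one of arrival, or else the pairs of these
edges are listed in `K`. -/
structure Trail (m : Fin n → Fin n → Fin n) (K : List (Fin n × Fin n)) (ex : Sym2 (Fin n))
    (x : ℕ → Fin n) (N : ℕ) : Prop where
  inj : Set.InjOn (edgeAt x) (Set.Iio N)
  noloop : ∀ i < N, x i ≠ x (i + 1)
  closed : x N = x 0
  ne : ∀ i, 1 ≤ i → i < N → x i ≠ x 0
  first : Corner m K (x 0) (x 1)
  last : Corner m K (x 0) (x (N - 1))
  turn : ∀ k, 1 ≤ k → k < N →
    (x (k + 1) = m (x k) (x (k - 1)) ∧ edgeAt x (k - 1) ≠ ex ∧ edgeAt x k ≠ ex) ∨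
    ((edgeAt x (k - 1) = ex ∨ Corner m K (x k) (x (k - 1))) ∧
      (edgeAt x k = ex ∨ Corner m K (x k) (x (k + 1))))

lemma edgeAt_reverse (x : ℕ → Fin n) {N i : ℕ} (h : i < N) :
    edgeAt (fun i => x (N - i)) i = edgeAt x (N - 1 - i) := by
  simp only [edgeAt]
  rw [Sym2.eq_swap, show N - (i + 1) = N - 1 - i by omega, show N - i = N - 1 - i + 1 by omega]

lemma image_edgeAt_reverse (x : ℕ → Fin n) (N : ℕ) :
    edgeAt (fun i => x (N - i)) '' Set.Iio N = edgeAt x '' Set.Iio N := by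
  ext e
  constructor
  · rintro ⟨i, hi, rfl⟩
    rw [Set.mem_Iio] at hi
    exact ⟨N - 1 - i, Set.mem_Iio.2 (by omega), (edgeAt_reverse x hi).symm⟩
  · rintro ⟨i, hi, rfl⟩
    rw [Set.mem_Iio] at hi
    refine ⟨N - 1 - i, Set.mem_Iio.2 (by omega), ?_⟩
    rw [edgeAt_reverse x (by omega), show N - 1 - (N - 1 - i) = i by omega]

lemma edgeSum_reverse (x : ℕ → Fin n) (N : ℕ) :
    edgeSum (fun i => x (N - i)) (Finset.range N) = edgeSum x (Finset.range N) := by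
  unfold edgeSum
  rw [← Finset.sum_range_reflect (fun i => ed (x i) (x (i + 1)))]
  refine Finset.sum_congr rfl fun i hi => ?_
  rw [Finset.mem_range] at hi
  simp only
  rw [ed_comm, show N - (i + 1) = N - 1 - i by omega, show N - i = N - 1 - i + 1 by omega]

lemma Trail.reverse (hm : ∀ v, Function.Involutive (m v)) {K : List (Fin n × Fin n)}
    {ex : Sym2 (Fin n)} {x : ℕ → Fin n} {N : ℕ} (h : Trail m K ex x N) :
    Trail m K ex (fun i => x (N - i)) N where
  inj := by
    intro i hi j hj hij
    rw [Set.mem_Iio] at hi hj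
    rw [edgeAt_reverse x hi, edgeAt_reverse x hj] at hij
    have := h.inj (Set.mem_Iio.2 (by omega)) (Set.mem_Iio.2 (by omega)) hij
    omega
  noloop := by
    intro i hi
    have := h.noloop (N - (i + 1)) (by omega)
    rw [show N - (i + 1) + 1 = N - i by omega] at this
    exact this.symm
  closed := by simp [h.closed]
  ne := by
    intro i hi hi'
    simp only [Nat.sub_zero, h.closed]
    exact h.ne _ (by omega) (by omega)
  first := by simpa [h.closed] using h.last
  last := by
    rcases Nat.eq_zero_or_pos N with h0 | h0
    · have := h.last
      subst h0
      exact this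
    · simp only [Nat.sub_zero, h.closed]
      rw [show N - (N - 1) = 1 by omega]
      exact h.first
  turn := by
    intro k hk hk'
    rw [edgeAt_reverse x hk', edgeAt_reverse x (show k - 1 < N by omega)]
    have := h.turn (N - k) (by omega) (by omega)
    rw [show N - 1 - (k - 1) = N - k by omega, show N - (k - 1) = N - k + 1 by omega,
      show N - (k + 1) = N - k - 1 by omega, show N - 1 - k = N - k - 1 by omega]
    rcases this with ⟨h1, h2, h3⟩ | ⟨h1, h2⟩
    · left
      exact ⟨by rw [h1, hm], h3, h2⟩
    · right
      exact ⟨h2, h1⟩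

lemma Trail.cross (hm : ∀ v, Function.Involutive (m v)) {K : List (Fin n × Fin n)}
    {ex : Sym2 (Fin n)} {x : ℕ → Fin n} {N : ℕ} (h : Trail m K ex x N) {l : ℕ} (hl : l ≤ N) :
    Cross m (edgeSum x ((Finset.range l).filter fun i => edgeAt x i ≠ ex))
      (K ++ [(x l, x (l - 1))]) := by
  have hK : K ⊆ K ++ [(x l, x (l - 1))] := List.subset_append_left _ _
  refine cross_edgeSum hm h.inj (fun i hi => ?_) (fun k hk => ?_) (fun k hk => ?_)
  · rw [Finset.mem_filter, Finset.mem_range] at hi; omega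
  · rw [Finset.mem_filter, Finset.mem_range] at hk
    rcases Nat.eq_zero_or_pos k with rfl | h0
    · exact Or.inr (h.first.mono hK)
    · rcases h.turn k h0 (by omega) with ⟨h1, h2, h3⟩ | ⟨h1, h2⟩
      · left
        refine ⟨h0, ?_, h1⟩
        rw [Finset.mem_filter, Finset.mem_range]
        exact ⟨by omega, h2⟩
      · rcases h2 with h2 | h2
        · exact absurd h2 hk.2
        · exact Or.inr (h2.mono hK)
  · rw [Finset.mem_filter, Finset.mem_range] at hk
    by_cases hkl : k + 1 = l
    · right
      left
      rw [← hkl]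
      simp
    · rcases h.turn (k + 1) (by omega) (by omega) with ⟨h1, h2, h3⟩ | ⟨h1, h2⟩
      · left
        refine ⟨?_, by simpa using h1⟩
        rw [Finset.mem_filter, Finset.mem_range]
        exact ⟨by omega, h3⟩
      · rcases h1 with h1 | h1
        · exact absurd h1 hk.2
        · exact Or.inr (h1.mono hK)

/-- A step of the processing, from `A` to `B`, of a piece with start vertex `v`: it is the switch on
the 4-cycle `vpqt`. The graph `A` arises from `Z` by exchanging the edges of `F`, which are in `S`,
the chords given by `code`, and, if `τ = 1`, the edge `ex`. The edges of `F` are paired with edges of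
`F`, except at `K` and at `K'`. One of `pq` and `qt` is an edge of the piece that is not yet
exchanged. -/
structure OneStep (m : Fin n → Fin n → Fin n) (K : List (Fin n × Fin n)) (ex : Sym2 (Fin n))
    (v : Fin n) (S : Set (Sym2 (Fin n))) (Z A B : Edges n) (p q t : Fin n)
    (code : Option (Fin n × Fin n)) (F : Sym2 (Fin n) → ZMod 2) (K' : List (Fin n × Fin n))
    (τ : ZMod 2) : Prop where
  nodup : [v, p, q, t].Nodup
  eq_switch : B = symmDiff A {s(v, p), s(p, q), s(q, t), s(t, v)}
  chi_eq : chi A = chi Z + (F + starSum v t code + Pi.single ex τ)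
  star : StarOK A v t code
  cross : Cross m F (K ++ K')
  ends : (K'.map Prod.fst).Perm (starEnds t code)
  supp : ∀ e, F e ≠ 0 → e ∈ S ∧ e ≠ ex
  next_mem : (if s(p, q) = ex then s(q, t) else s(p, q)) ∈ S
  next_ne : (if s(p, q) = ex then s(q, t) else s(p, q)) ≠ ex
  next_eq : F (if s(p, q) = ex then s(q, t) else s(p, q)) = 0
  tau : ex ∉ S → τ = 0

lemma edgeSum_split (x : ℕ → Fin n) (I : Finset ℕ) (ex : Sym2 (Fin n)) :
    ∃ τ : ZMod 2, edgeSum x I = edgeSum x (I.filter fun i => edgeAt x i ≠ ex) + Pi.single ex τ ∧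
      ((∀ i ∈ I, edgeAt x i ≠ ex) → τ = 0) := by
  refine ⟨∑ i ∈ I.filter (fun i => ¬ edgeAt x i ≠ ex), 1, ?_, fun h => ?_⟩
  swap
  · rw [Finset.filter_false_of_mem, Finset.sum_empty]
    exact fun i hi => not_not.2 (h i hi)
  unfold edgeSum
  rw [← Finset.sum_filter_add_sum_filter_not I (fun i => edgeAt x i ≠ ex)]
  congr 1
  funext e
  rw [Finset.sum_apply]
  by_cases he : e = ex
  · subst he
    rw [Pi.single_eq_same]
    refine Finset.sum_congr rfl fun i hi => ?_
    rw [Finset.mem_filter, not_not] at hi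
    rw [ed_apply, if_pos]
    exact hi.2.symm
  · rw [Pi.single_eq_of_ne he]
    refine Finset.sum_eq_zero fun i hi => ?_
    rw [Finset.mem_filter, not_not] at hi
    rw [ed_apply, if_neg]
    intro h
    exact he (h.trans hi.2)

lemma PhaseStep.oneStep (hm : ∀ v, Function.Involutive (m v)) {K : List (Fin n × Fin n)}
    {ex : Sym2 (Fin n)} {x : ℕ → Fin n} {k : ℕ} (h : Trail m K ex x (2 * k)) {Z A B : Edges n}
    {a s b : ℕ} (hs : PhaseStep x k Z a s b A B) :
    ∃ p q t code F K' τ, OneStep m K ex (x 0) (edgeAt x '' Set.Iio (2 * k)) Z A B p q t code F K'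
      τ := by
  obtain ⟨hlt, hle, hltk, hchi, hsw, hne, hleft, hright, hnot⟩ := hs
  have hu : ∀ j, j < k → x 0 ≠ x (2 * j + 1) := fun j hj => (h.ne _ (by omega) (by omega)).symm
  set p := x (2 * s - 1) with hp
  set q := x (2 * s) with hq
  set t := x (2 * s + 1) with ht
  set u := x (2 * a + 1) with hu_def
  set u' := x (2 * b + 1) with hu'_def
  have e1 : edgeAt x (2 * s - 1) = s(p, q) := by
    unfold edgeAt; rw [Nat.sub_add_cancel (by omega)]
  have e2 : edgeAt x (2 * s) = s(q, t) := rfl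
  have hpq : s(p, q) ≠ s(q, t) := by
    rw [← e1, ← e2]
    intro he
    have := h.inj (Set.mem_Iio.2 (by omega)) (Set.mem_Iio.2 (by omega)) he
    omega
  have hpt : p ≠ t := fun he => hpq (by rw [he, Sym2.eq_swap])
  set f : ℕ → Sym2 (Fin n) → ZMod 2 := fun j =>
    edgeSum x ((Finset.range (2 * j + 1)).filter fun i => edgeAt x i ≠ ex) with hf
  have hfsplit : ∀ j, ∃ τ : ZMod 2,
      cyc x j = f j + Pi.single ex τ + ed (x 0) (x (2 * j + 1)) ∧
      (j < k → ex ∉ edgeAt x '' Set.Iio (2 * k) → τ = 0) := by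
    intro j
    obtain ⟨τ, hτ, hτ'⟩ := edgeSum_split x (Finset.range (2 * j + 1)) ex
    refine ⟨τ, by rw [cyc, hτ], fun hj hex => hτ' fun i hi he => hex ⟨i, ?_, he⟩⟩
    rw [Finset.mem_range] at hi
    exact Set.mem_Iio.2 (by omega)
  have hcross : ∀ j, j < k → Cross m (f j) (K ++ [(x (2 * j + 1), x (2 * j))]) := by
    intro j hj
    exact h.cross hm (l := 2 * j + 1) (by omega)
  have hfsupp : ∀ j, j < k → ∀ e, f j e ≠ 0 → e ∈ edgeAt x '' Set.Iio (2 * k) ∧ e ≠ ex := by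
    intro j hj e he
    have : ∃ i ∈ (Finset.range (2 * j + 1)).filter fun i => edgeAt x i ≠ ex, edgeAt x i = e := by
      by_contra! hcon
      exact he (edgeSum_apply_of_notMem hcon)
    obtain ⟨i, hi, rfl⟩ := this
    rw [Finset.mem_filter, Finset.mem_range] at hi
    exact ⟨⟨i, Set.mem_Iio.2 (by omega), rfl⟩, hi.2⟩
  obtain ⟨τ₁, h1, h1'⟩ := hfsplit a
  obtain ⟨τ₂, h2, h2'⟩ := hfsplit s
  obtain ⟨τ₃, h3, h3'⟩ := hfsplit b
  -- the edge that is not yet exchanged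
  have hnext : ∃ i, 2 * s - 1 ≤ i ∧ i ≤ 2 * s ∧ edgeAt x i ≠ ex ∧
      (if s(p, q) = ex then s(q, t) else s(p, q)) = edgeAt x i := by
    split_ifs with hex
    · exact ⟨2 * s, by omega, le_rfl, by rw [e2, ← hex]; exact hpq.symm, e2.symm⟩
    · exact ⟨2 * s - 1, le_rfl, by omega, by rwa [e1], e1.symm⟩
  obtain ⟨i, hi1, hi2, hi3, hi4⟩ := hnext
  have hfi : ∀ j, j < k → f j (edgeAt x i) = if i < 2 * j + 1 then 1 else 0 := by
    intro j hj
    rw [hf]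
    simp only
    rw [edgeSum_apply_edgeAt h.inj (fun i hi => ?_) (by omega)]
    · simp only [Finset.mem_filter, Finset.mem_range, ne_eq, hi3, not_false_eq_true, and_true]
    · rw [Finset.mem_filter, Finset.mem_range] at hi; omega
  have hcode : ∃ code, StarOK A (x 0) t code ∧
      ed (x 0) u + ed (x 0) t + ed (x 0) u' = starSum (x 0) t code ∧
      [u, t, u'].Perm (starEnds t code) := by
    by_cases htu : t = u
    · refine ⟨some (u', u'), ⟨hright (by rw [htu]; exact hne), hright (by rw [htu]; exact hne),
        fun h => absurd rfl h⟩, ?_, ?_⟩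
      · rw [htu, fun_add_self, zero_add]; simp [starSum]
      · simp only [starEnds, if_true]
        rw [← htu]
        exact (List.perm_append_comm (l₁ := [t, t]) (l₂ := [u']))
    · by_cases htu' : t = u'
      · refine ⟨some (u, u), ⟨hleft htu, hleft htu, fun h => absurd rfl h⟩, ?_, ?_⟩
        · rw [htu', add_assoc, fun_add_self, add_zero]; simp [starSum]
        · simp only [starEnds, if_true]
          rw [← htu']
      · refine ⟨some (u, u'), ⟨hleft htu, hright htu', fun _ => hnot htu htu'⟩, ?_, ?_⟩
        · simp only [starSum, if_neg hne]
        · simp only [starEnds, if_neg hne]; exact List.Perm.refl _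
  obtain ⟨code, hc1, hc2, hc3⟩ := hcode
  refine ⟨p, q, t, code, f a + f s + f b, [(u, x (2 * a)), (t, x (2 * s)), (u', x (2 * b))],
    τ₁ + τ₂ + τ₃, ⟨?_, hsw, ?_, hc1, ?_, hc3, ?_, ?_, ?_, ?_, ?_⟩⟩
  · have g1 : x 0 ≠ p := (h.ne _ (by omega) (by omega)).symm
    have g2 : x 0 ≠ q := (h.ne _ (by omega) (by omega)).symm
    have g3 : p ≠ q := by
      have := h.noloop (2 * s - 1) (by omega)
      rwa [Nat.sub_add_cancel (by omega)] at this
    have g4 : q ≠ t := h.noloop (2 * s) (by omega)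
    have g5 := hu s (by omega)
    simp only [List.nodup_cons, List.mem_cons, List.not_mem_nil, or_false, not_or, not_false_eq_true,
      List.nodup_nil, and_true]
    exact ⟨⟨g1, g2, g5⟩, ⟨g3, hpt⟩, g4⟩
  · rw [hchi, h1, h2, h3, ← hc2, Pi.single_add, Pi.single_add]
    abel
  · refine Cross.add (Cross.add ?_ ?_) ?_
    · exact (hcross a (by omega)).mono (by simp [hu_def])
    · exact (hcross s (by omega)).mono (by simp [ht])
    · exact (hcross b (by omega)).mono (by simp [hu'_def])
  · intro e he
    by_cases ha : f a e = 0
    · by_cases hs : f s e = 0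
      · have : f b e ≠ 0 := fun hb => he (by simp [ha, hs, hb])
        exact hfsupp b (by omega) e this
      · exact hfsupp s (by omega) e hs
    · exact hfsupp a (by omega) e ha
  · rw [hi4]; exact ⟨i, Set.mem_Iio.2 (by omega), rfl⟩
  · rw [hi4]; exact hi3
  · rw [hi4, Pi.add_apply, Pi.add_apply, hfi a (by omega), hfi s (by omega), hfi b (by omega),
      if_neg (by omega), if_pos (by omega), if_pos (by omega)]
    decide
  · intro hex
    rw [h1' (by omega) hex, h2' (by omega) hex, h3' (by omega) hex]; rfl

/-- The closed walk `[v] ++ a`, as a function of the index. -/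
def walkFun (v : Fin n) (a : List (Fin n)) : ℕ → Fin n := fun i => (v :: a).getD i v

lemma walkFun_reverse (v : Fin n) (a : List (Fin n)) :
    walkFun v a.reverse = fun i => walkFun v a (a.length + 1 - i) := by
  funext i
  unfold walkFun
  rcases Nat.eq_zero_or_pos i with rfl | hi
  · simp
  · obtain ⟨i, rfl⟩ : ∃ j, i = j + 1 := ⟨i - 1, by omega⟩
    by_cases h : i < a.length
    · obtain ⟨l, hl⟩ : ∃ l, a.length + 1 - (i + 1) = l + 1 := ⟨a.length - 1 - i, by omega⟩
      rw [hl]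
      simp only [List.getD_cons_succ]
      rw [List.getD_eq_getElem _ _ (by simpa using h), List.getD_eq_getElem _ _ (by omega)]
      rw [List.getElem_reverse]
      congr 1
      omega
    · rw [show a.length + 1 - (i + 1) = 0 by omega]
      simp only [List.getD_cons_succ, List.getD_cons_zero]
      rw [List.getD_eq_default]
      simpa using h

lemma processOne_eq (v : Fin n) (a : List (Fin n)) (Z : Edges n) :
    processOne v a Z =
      let c := if s(v, a.headD v) ∈ Z then a else a.reverse
      phases (walkFun v c) ((c.length + 1) / 2) ((c.length + 1) / 2) 0 Z := rfl

/-- The processing of a 1-circuit, of whose two edges at the start vertex one is present, exchanges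
its edges. -/
lemma spec_processOne (hm : ∀ v, Function.Involutive (m v)) {K : List (Fin n × Fin n)}
    {ex : Sym2 (Fin n)} {v : Fin n} {a : List (Fin n)}
    (hT : Trail m K ex (walkFun v a) (a.length + 1)) (hodd : Odd a.length) {Z : Edges n}
    (hZ : ¬ (s(v, walkFun v a 1) ∈ Z ↔ s(v, walkFun v a a.length) ∈ Z))
    {P : Edges n → Edges n → Prop}
    (hP : ∀ A B p q t code F K' τ, OneStep m K ex v
      (edgeAt (walkFun v a) '' Set.Iio (a.length + 1)) Z A B p q t code F K' τ → P A B) :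
    Spec (processOne v a) Z (edgeSum (walkFun v a) (Finset.range (a.length + 1))) P := by
  obtain ⟨k, hk⟩ : ∃ k, a.length + 1 = 2 * k := by
    obtain ⟨r, hr⟩ := hodd; exact ⟨r + 1, by omega⟩
  have main : ∀ c : List (Fin n), c.length = a.length →
      Trail m K ex (walkFun v c) (2 * k) → s(v, walkFun v c 1) ∈ Z →
      s(v, walkFun v c (2 * (k - 1) + 1)) ∉ Z →
      edgeAt (walkFun v c) '' Set.Iio (2 * k) = edgeAt (walkFun v a) '' Set.Iio (2 * k) →
      Spec (phases (walkFun v c) k k 0) Z (edgeSum (walkFun v c) (Finset.range (2 * k))) P := by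
    intro c hc hTc h1 h2 hsub
    have hx0 : walkFun v c 0 = v := rfl
    refine (spec_phases (x := walkFun v c) (k := k) (Z₀ := Z) hTc.ne ?_ h1 h2 ?_ k 0 Z (by omega)
      (by omega) (by rw [cyc_zero, add_zero]) h1 ?_).congr ?_
    · intro s hs1 hs2 he
      have : edgeAt (walkFun v c) (2 * s - 1) = edgeAt (walkFun v c) (2 * s) := by
        unfold edgeAt
        rw [Nat.sub_add_cancel (by omega), he, Sym2.eq_swap]
      have := hTc.inj (Set.mem_Iio.2 (by omega)) (Set.mem_Iio.2 (by omega)) this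
      omega
    · intro a' s b A B hstep
      obtain ⟨p, q, t, code, F, K', τ, h⟩ := hstep.oneStep hm hTc
      refine hP A B p q t code F K' τ ⟨h.nodup, h.eq_switch, h.chi_eq, h.star, h.cross, h.ends,
        fun e he => ?_, ?_, h.next_ne, h.next_eq,
        fun hex => h.tau ?_⟩
      · rw [hk]
        exact ⟨hsub.subset (h.supp e he).1, (h.supp e he).2⟩
      · rw [hk]
        exact hsub.subset h.next_mem
      · rwa [hsub, ← hk]
    · intro hk'
      exact ⟨k - 1, hk', by omega, h2⟩
    · rw [cyc_zero, zero_add, cyc, edgeSum, edgeSum]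
      rw [show 2 * k = 2 * (k - 1) + 1 + 1 by omega, Finset.sum_range_succ,
        Finset.sum_range_succ, Finset.sum_range_succ, ed_comm (walkFun v c 0)]
      have := hTc.closed
      rw [show 2 * k = 2 * (k - 1) + 1 + 1 by omega] at this
      rw [this]
  have hhead : a.headD v = walkFun v a 1 := by
    unfold walkFun
    cases a <;> simp
  have hal : a.length = 2 * (k - 1) + 1 := by omega
  have hfinal : Spec (phases (walkFun v (if s(v, a.headD v) ∈ Z then a else a.reverse)) k k 0) Z
      (edgeSum (walkFun v a) (Finset.range (2 * k))) P := by
    rw [hk] at hT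
    split_ifs with hd
    · rw [hhead] at hd
      refine main a rfl hT hd ?_ rfl
      rw [← hal]
      tauto
    · rw [hhead] at hd
      have hrev := walkFun_reverse v a
      rw [hk] at hrev
      refine (main a.reverse (by simp) (hrev ▸ hT.reverse hm) ?_ ?_ ?_).congr ?_
      · rw [hrev]
        simp only
        rw [show 2 * k - 1 = a.length by omega]
        tauto
      · rw [hrev]
        simp only
        rw [show 2 * k - (2 * (k - 1) + 1) = 1 by omega]
        exact hd
      · rw [hrev]
        exact image_edgeAt_reverse _ _
      · rw [hrev, edgeSum_reverse]
  unfold Spec at hfinal ⊢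
  rw [hk, processOne_eq]
  have hlen : (if s(v, a.headD v) ∈ Z then a else a.reverse).length = a.length := by
    split_ifs <;> simp
  simp only [hlen, hk, Nat.mul_div_cancel_left k two_pos]
  exact hfinal

end

section
variable {n : ℕ} {m : Fin n → Fin n → Fin n}

/-! ### Walks put together from parts of the loops of a piece -/

/-- An open walk with the properties of `Trail` away from its ends. -/
structure Half (m : Fin n → Fin n → Fin n) (K : List (Fin n × Fin n)) (ex : Sym2 (Fin n))
    (x : ℕ → Fin n) (N : ℕ) : Prop where
  inj : Set.InjOn (edgeAt x) (Set.Iio N)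
  noloop : ∀ i < N, x i ≠ x (i + 1)
  turn : ∀ k, 1 ≤ k → k < N →
    (x (k + 1) = m (x k) (x (k - 1)) ∧ edgeAt x (k - 1) ≠ ex ∧ edgeAt x k ≠ ex) ∨
    ((edgeAt x (k - 1) = ex ∨ Corner m K (x k) (x (k - 1))) ∧
      (edgeAt x k = ex ∨ Corner m K (x k) (x (k + 1))))

/-- The walk `f` up to its vertex of index `M`, continued by the walk `g`. -/
def glue (f : ℕ → Fin n) (M : ℕ) (g : ℕ → Fin n) : ℕ → Fin n :=
  fun k => if k ≤ M then f k else g (k - M)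

lemma glue_of_le {f g : ℕ → Fin n} {M k : ℕ} (h : k ≤ M) : glue f M g k = f k := if_pos h

lemma glue_of_ge {f g : ℕ → Fin n} {M k : ℕ} (hfg : f M = g 0) (h : M ≤ k) :
    glue f M g k = g (k - M) := by
  rcases h.eq_or_lt with rfl | h
  · rw [glue_of_le le_rfl, hfg, Nat.sub_self]
  · exact if_neg (by omega)

lemma edgeAt_glue_of_lt {f g : ℕ → Fin n} {M k : ℕ} (h : k < M) :
    edgeAt (glue f M g) k = edgeAt f k := by
  unfold edgeAt
  rw [glue_of_le (by omega), glue_of_le (by omega)]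

lemma edgeAt_glue_of_ge {f g : ℕ → Fin n} {M k : ℕ} (hfg : f M = g 0) (h : M ≤ k) :
    edgeAt (glue f M g) k = edgeAt g (k - M) := by
  unfold edgeAt
  rw [glue_of_ge hfg h, glue_of_ge hfg (by omega), show k + 1 - M = k - M + 1 by omega]

lemma edgeSum_glue {f g : ℕ → Fin n} {M M' : ℕ} (hfg : f M = g 0) :
    edgeSum (glue f M g) (Finset.range (M + M')) =
      edgeSum f (Finset.range M) + edgeSum g (Finset.range M') := by
  unfold edgeSum
  rw [Finset.sum_range_add]
  congr 1
  · refine Finset.sum_congr rfl fun i hi => ?_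
    rw [Finset.mem_range] at hi
    rw [glue_of_le (by omega), glue_of_le (by omega)]
  · refine Finset.sum_congr rfl fun i hi => ?_
    rw [glue_of_ge hfg (by omega), glue_of_ge hfg (by omega)]
    rw [show M + i - M = i by omega, show M + i + 1 - M = i + 1 by omega]

lemma image_edgeAt_glue {f g : ℕ → Fin n} {M M' : ℕ} (hfg : f M = g 0) :
    edgeAt (glue f M g) '' Set.Iio (M + M') = edgeAt f '' Set.Iio M ∪ edgeAt g '' Set.Iio M' := by
  ext e
  constructor
  · rintro ⟨i, hi, rfl⟩
    rw [Set.mem_Iio] at hi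
    rcases lt_or_ge i M with h | h
    · exact Or.inl ⟨i, h, (edgeAt_glue_of_lt h).symm⟩
    · exact Or.inr ⟨i - M, Set.mem_Iio.2 (by omega), (edgeAt_glue_of_ge hfg h).symm⟩
  · rintro (⟨i, hi, rfl⟩ | ⟨i, hi, rfl⟩)
    · rw [Set.mem_Iio] at hi
      exact ⟨i, Set.mem_Iio.2 (by omega), edgeAt_glue_of_lt hi⟩
    · rw [Set.mem_Iio] at hi
      refine ⟨M + i, Set.mem_Iio.2 (by omega), ?_⟩
      rw [edgeAt_glue_of_ge hfg (by omega), show M + i - M = i by omega]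

lemma Half.glue {K : List (Fin n × Fin n)} {ex : Sym2 (Fin n)} {f g : ℕ → Fin n} {M M' : ℕ}
    (hf : Half m K ex f M) (hg : Half m K ex g M') (hfg : f M = g 0)
    (hdisj : ∀ i < M, ∀ j < M', edgeAt f i ≠ edgeAt g j)
    (hjf : edgeAt f (M - 1) = ex ∨ Corner m K (f M) (f (M - 1)))
    (hjg : edgeAt g 0 = ex ∨ Corner m K (g 0) (g 1)) :
    Half m K ex (glue f M g) (M + M') where
  inj := by
    intro i hi j hj hij
    rw [Set.mem_Iio] at hi hj
    rcases lt_or_ge i M with h1 | h1 <;> rcases lt_or_ge j M with h2 | h2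
    · rw [edgeAt_glue_of_lt h1, edgeAt_glue_of_lt h2] at hij
      exact hf.inj h1 h2 hij
    · rw [edgeAt_glue_of_lt h1, edgeAt_glue_of_ge hfg h2] at hij
      exact absurd hij (hdisj _ h1 _ (by omega))
    · rw [edgeAt_glue_of_ge hfg h1, edgeAt_glue_of_lt h2] at hij
      exact absurd hij.symm (hdisj _ h2 _ (by omega))
    · rw [edgeAt_glue_of_ge hfg h1, edgeAt_glue_of_ge hfg h2] at hij
      have := hg.inj (Set.mem_Iio.2 (by omega)) (Set.mem_Iio.2 (by omega)) hij
      omega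
  noloop := by
    intro i hi
    rcases lt_or_ge i M with h1 | h1
    · rw [glue_of_le (by omega), glue_of_le (by omega)]
      exact hf.noloop i h1
    · rw [glue_of_ge hfg (by omega), glue_of_ge hfg (by omega), show i + 1 - M = i - M + 1 by omega]
      exact hg.noloop _ (by omega)
  turn := by
    intro k hk hk'
    rcases lt_trichotomy k M with h1 | h1 | h1
    · rw [edgeAt_glue_of_lt h1, edgeAt_glue_of_lt (by omega), glue_of_le (by omega),
        glue_of_le (by omega), glue_of_le (by omega)]
      exact hf.turn k hk h1
    · right
      subst h1
      rw [edgeAt_glue_of_lt (by omega), edgeAt_glue_of_ge hfg le_rfl, glue_of_le (by omega),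
        glue_of_le (by omega), glue_of_ge hfg (by omega), Nat.sub_self, Nat.add_sub_cancel_left]
      refine ⟨hjf, ?_⟩
      rw [hfg]
      exact hjg
    · rw [edgeAt_glue_of_ge hfg h1.le, edgeAt_glue_of_ge hfg (by omega), glue_of_ge hfg (by omega),
        glue_of_ge hfg (by omega), glue_of_ge hfg (by omega), show k + 1 - M = k - M + 1 by omega,
        show k - 1 - M = k - M - 1 by omega]
      exact hg.turn (k - M) (by omega) (by omega)

lemma Half.reverse (hm : ∀ v, Function.Involutive (m v)) {K : List (Fin n × Fin n)}
    {ex : Sym2 (Fin n)} {x : ℕ → Fin n} {N : ℕ} (h : Half m K ex x N) :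
    Half m K ex (fun i => x (N - i)) N where
  inj := by
    intro i hi j hj hij
    rw [Set.mem_Iio] at hi hj
    rw [edgeAt_reverse x hi, edgeAt_reverse x hj] at hij
    have := h.inj (Set.mem_Iio.2 (by omega)) (Set.mem_Iio.2 (by omega)) hij
    omega
  noloop := by
    intro i hi
    have := h.noloop (N - (i + 1)) (by omega)
    rw [show N - (i + 1) + 1 = N - i by omega] at this
    exact this.symm
  turn := by
    intro k hk hk'
    rw [edgeAt_reverse x hk', edgeAt_reverse x (show k - 1 < N by omega)]
    have := h.turn (N - k) (by omega) (by omega)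
    rw [show N - 1 - (k - 1) = N - k by omega, show N - (k - 1) = N - k + 1 by omega,
      show N - (k + 1) = N - k - 1 by omega, show N - 1 - k = N - k - 1 by omega]
    rcases this with ⟨h1, h2, h3⟩ | ⟨h1, h2⟩
    · left
      exact ⟨by rw [h1, hm], h3, h2⟩
    · right
      exact ⟨h2, h1⟩

lemma Half.mono {K : List (Fin n × Fin n)} {ex : Sym2 (Fin n)} {x : ℕ → Fin n} {N : ℕ}
    (h : Half m K ex x N) {M : ℕ} (hM : M ≤ N) : Half m K ex x M where
  inj := h.inj.mono (Set.Iio_subset_Iio hM)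
  noloop := fun i hi => h.noloop i (by omega)
  turn := fun k hk hk' => h.turn k hk (by omega)

/-- A closed walk `x 0, …, x N = x 0` that passes `x 0` once and no edge twice, and leaves each
other vertex by the edge paired with the one of arrival. -/
structure Loop (m : Fin n → Fin n → Fin n) (x : ℕ → Fin n) (N : ℕ) : Prop where
  inj : Set.InjOn (edgeAt x) (Set.Iio N)
  noloop : ∀ i < N, x i ≠ x (i + 1)
  closed : x N = x 0
  ne : ∀ i, 1 ≤ i → i < N → x i ≠ x 0
  follow : ∀ k, 1 ≤ k → k < N → x (k + 1) = m (x k) (x (k - 1))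

lemma Loop.half {x : ℕ → Fin n} {N : ℕ} (h : Loop m x N) {ex : Sym2 (Fin n)}
    (hex : ∀ i < N, edgeAt x i ≠ ex) (K : List (Fin n × Fin n)) : Half m K ex x N where
  inj := h.inj
  noloop := h.noloop
  turn := fun k hk hk' => Or.inl ⟨h.follow k hk hk', hex _ (by omega), hex _ (by omega)⟩

lemma Loop.reverse (hm : ∀ v, Function.Involutive (m v)) {x : ℕ → Fin n} {N : ℕ}
    (h : Loop m x N) : Loop m (fun i => x (N - i)) N where
  inj := by
    intro i hi j hj hij
    rw [Set.mem_Iio] at hi hj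
    rw [edgeAt_reverse x hi, edgeAt_reverse x hj] at hij
    have := h.inj (Set.mem_Iio.2 (by omega)) (Set.mem_Iio.2 (by omega)) hij
    omega
  noloop := by
    intro i hi
    have := h.noloop (N - (i + 1)) (by omega)
    rw [show N - (i + 1) + 1 = N - i by omega] at this
    exact this.symm
  closed := by simp [h.closed]
  ne := by
    intro i hi hi'
    simp only [Nat.sub_zero, h.closed]
    exact h.ne _ (by omega) (by omega)
  follow := by
    intro k hk hk'
    rw [show N - (k - 1) = N - k + 1 by omega, h.follow (N - k) (by omega) (by omega), hm,
      show N - (k + 1) = N - k - 1 by omega]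

lemma Half.trail {K : List (Fin n × Fin n)} {ex : Sym2 (Fin n)} {x : ℕ → Fin n} {N : ℕ}
    (h : Half m K ex x N) (hc : x N = x 0) (hne : ∀ i, 1 ≤ i → i < N → x i ≠ x 0)
    (h1 : Corner m K (x 0) (x 1)) (h2 : Corner m K (x 0) (x (N - 1))) : Trail m K ex x N :=
  ⟨h.inj, h.noloop, hc, hne, h1, h2, h.turn⟩

/-! ### Walks as lists -/

lemma walkFun_of_le {v : Fin n} {a : List (Fin n)} {i : ℕ} (h : a.length < i) :
    walkFun v a i = v := by
  unfold walkFun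
  rw [List.getD_eq_default]
  simpa using h

lemma walkFun_succ {v : Fin n} {a : List (Fin n)} {i : ℕ} (h : i < a.length) :
    walkFun v a (i + 1) = a[i] := by
  unfold walkFun
  rw [List.getD_cons_succ, List.getD_eq_getElem]

lemma walkFun_eq (v : Fin n) (a : List (Fin n)) (k : ℕ) :
    walkFun v a k = if k = 0 then v else a[k - 1]?.getD v := by
  unfold walkFun
  cases k <;> simp

lemma walkFun_take_reverse {v : Fin n} {a b : List (Fin n)} {i j : ℕ} (hi : i < a.length)
    (hj : j < b.length) :
    walkFun v (a.take i ++ [a[i]] ++ (b.take j).reverse) =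
      glue (walkFun v a) (i + 1) (fun k => walkFun v b (j + 1 - k)) := by
  funext k
  simp only [glue, walkFun_eq]
  grind

lemma walkFun_take_drop {v : Fin n} {a b : List (Fin n)} {i j : ℕ} (hi : i < a.length)
    (hj : j < b.length) :
    walkFun v (a.take i ++ [a[i]] ++ b.drop (j + 1)) =
      glue (walkFun v a) (i + 1) (fun k => walkFun v b (j + 1 + k)) := by
  funext k
  simp only [glue, walkFun_eq]
  grind

lemma walkFun_reverse_drop {v : Fin n} {a b : List (Fin n)} {i j : ℕ} (hi : i < a.length)
    (hj : j < b.length) :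
    walkFun v ((a.drop (i + 1)).reverse ++ [a[i]] ++ b.drop (j + 1)) =
      glue (fun k => walkFun v a (a.length + 1 - k)) (a.length - i)
        (fun k => walkFun v b (j + 1 + k)) := by
  funext k
  simp only [glue, walkFun_eq]
  grind

lemma walkFun_reverse_take {v : Fin n} {a b : List (Fin n)} {i j : ℕ} (hi : i < a.length)
    (hj : j < b.length) :
    walkFun v ((a.drop (i + 1)).reverse ++ [a[i]] ++ (b.take j).reverse) =
      glue (fun k => walkFun v a (a.length + 1 - k)) (a.length - i)
        (fun k => walkFun v b (j + 1 - k)) := by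
  funext k
  simp only [glue, walkFun_eq, List.getElem?_append, List.length_append, List.length_reverse,
    List.length_drop, List.length_singleton]
  rcases lt_trichotomy k (a.length - i) with h | h | h
  · grind
  · subst h
    grind
  · rw [if_neg (show ¬ k = 0 by omega), if_neg (show ¬ k ≤ a.length - i by omega),
      if_neg (show ¬ k - 1 < a.length - (i + 1) + 1 by omega)]
    grind

lemma walkFun_tail_reverse {v : Fin n} {a b : List (Fin n)} (ha : 2 ≤ a.length) :
    walkFun v (a.tail.reverse ++ b.reverse) =
      glue (fun k => walkFun v a (a.length + 1 - k)) (a.length - 1)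
        (fun k => if k = 0 then walkFun v a 2 else walkFun v b (b.length + 1 - k)) := by
  funext k
  simp only [glue, walkFun_eq]
  grind

lemma edgeAt_walkFun_mem {v : Fin n} {a : List (Fin n)} {e : Sym2 (Fin n)} :
    e ∈ walkEdges (v :: a) ↔ ∃ i < a.length + 1, edgeAt (walkFun v a) i = e := by
  unfold walkEdges
  rw [List.mem_toFinset, List.mem_iff_getElem]
  have hlen : (List.zipWith (fun x y => s(x, y)) (v :: a) ((v :: a).rotate 1)).length =
    a.length + 1 := by simp
  have : ∀ i (h : i < a.length + 1), (List.zipWith (fun x y => s(x, y)) (v :: a)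
      ((v :: a).rotate 1))[i]'(hlen ▸ h) = edgeAt (walkFun v a) i := by
    intro i h
    simp only [List.getElem_zipWith]
    unfold edgeAt
    congr 1
    · unfold walkFun
      rw [List.getD_eq_getElem]
    · rw [List.getElem_rotate]
      rcases Nat.lt_or_ge i a.length with hl | hl
      · rw [walkFun_succ hl]
        simp only [List.length_cons]
        have : (i + 1) % (a.length + 1) = i + 1 := Nat.mod_eq_of_lt (by omega)
        simp [this]
      · obtain rfl : i = a.length := by omega
        rw [walkFun_of_le (by omega)]
        simp
  constructor
  · rintro ⟨i, hi, rfl⟩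
    exact ⟨i, hlen ▸ hi, (this i (hlen ▸ hi)).symm⟩
  · rintro ⟨i, hi, rfl⟩
    exact ⟨i, hlen ▸ hi, this i hi⟩

end

section
variable {n : ℕ} {m : Fin n → Fin n → Fin n}

/-! ### Processing a piece -/

/-- The shortcut edge `xy`, if it is exchanged in the current graph; this is encoded by the order of
`x` and `y`. -/
def shortSum (x y : Fin n) : Sym2 (Fin n) → ZMod 2 := if x < y then ed x y else 0

/-- A step of the processing of a piece with start vertex `v` and set of edges `S`, from `A` to `B`:
the switch on the 4-cycle `vpqt`. The graph `A` arises from the graph `Z` in which the processing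
starts by exchanging the edges of `F`, and the chords that `code`, `x` and `y` describe. -/
structure StepData (m : Fin n → Fin n → Fin n) (K : List (Fin n × Fin n)) (v : Fin n)
    (S : Set (Sym2 (Fin n))) (Z A B : Edges n) (p q t : Fin n) (code : Option (Fin n × Fin n))
    (x y : Fin n) (F : Sym2 (Fin n) → ZMod 2) (K' : List (Fin n × Fin n)) : Prop where
  nodup : [v, p, q, t].Nodup
  eq_switch : B = symmDiff A {s(v, p), s(p, q), s(q, t), s(t, v)}
  chi_eq : chi A = chi Z + (F + starSum v t code + shortSum x y)
  star : StarOK A v t code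
  cross : Cross m F (K ++ K')
  ends : (K'.map Prod.fst).Subperm (starEnds t code ++ [x, y])
  supp : ∀ e, F e ≠ 0 → e ∈ S
  next_mem : (if s(p, q) = s(x, y) then s(q, t) else s(p, q)) ∈ S
  next_eq : F (if s(p, q) = s(x, y) then s(q, t) else s(p, q)) = 0

/-- Some step of the processing of a piece leads from `A` to `B`; only a 2-circuit, for which the
proposition `two` holds, needs the vertices `x` and `y`. -/
def PieceStep (m : Fin n → Fin n → Fin n) (K : List (Fin n × Fin n)) (v : Fin n)
    (S : Set (Sym2 (Fin n))) (Z : Edges n) (two : Prop) (A B : Edges n) : Prop :=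
  ∃ p q t code x y F K', StepData m K v S Z A B p q t code x y F K' ∧ ((x = v ∧ y = v) ∨ two)

lemma OneStep.piece {Kv Kx K' : List (Fin n × Fin n)} {ex : Sym2 (Fin n)} {v p q t x y : Fin n}
    {S₁ S : Set (Sym2 (Fin n))} {Z₁ Z A B : Edges n} {code : Option (Fin n × Fin n)}
    {F E : Sym2 (Fin n) → ZMod 2} {σ τ : ZMod 2} {two : Prop}
    (h : OneStep m (Kv ++ Kx) ex v S₁ Z₁ A B p q t code F K' τ)
    (hZ : chi Z₁ = chi Z + (E + Pi.single ex σ)) (hE : Cross m E (Kv ++ Kx))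
    (hES : ∀ e, E e ≠ 0 → e ∈ S ∧ e ∉ S₁) (hS : ∀ e ∈ S₁, e ≠ ex → e ∈ S)
    (hxy : s(x, y) = ex) (hsh : shortSum x y = Pi.single ex (σ + τ))
    (hKx : (Kx.map Prod.fst).Subperm [x, y]) (htwo : (x = v ∧ y = v) ∨ two) :
    PieceStep m Kv v S Z two A B := by
  subst hxy
  refine ⟨p, q, t, code, x, y, E + F, K' ++ Kx, ⟨h.nodup, h.eq_switch, ?_, h.star, ?_, ?_, ?_, ?_,
    ?_⟩, htwo⟩
  · rw [h.chi_eq, hZ, hsh, Pi.single_add]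
    abel
  · have hsub : Kv ++ Kx ++ K' ⊆ Kv ++ (K' ++ Kx) := by
      intro c hc
      simp only [List.mem_append] at hc ⊢
      tauto
    refine Cross.add (hE.mono ?_) (h.cross.mono hsub)
    exact fun c hc => hsub (List.mem_append_left _ hc)
  · rw [List.map_append]
    exact h.ends.subperm.append hKx
  · intro e he
    by_cases hE0 : E e = 0
    · have : F e ≠ 0 := fun hF => he (by simp [hE0, hF])
      have := h.supp e this
      exact hS e this.1 this.2
    · exact (hES e hE0).1
  · exact hS _ h.next_mem h.next_ne
  · rw [Pi.add_apply, h.next_eq, add_zero]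
    by_contra hcon
    exact (hES _ hcon).2 h.next_mem

lemma shortSum_self (x : Fin n) : shortSum x x = 0 := by simp [shortSum]

lemma exists_shortSum {x y : Fin n} (h : x ≠ y) (τ : ZMod 2) :
    ∃ x' y', s(x', y') = s(x, y) ∧ shortSum x' y' = Pi.single s(x, y) τ ∧
      [x, y].Subperm [x', y'] := by
  have hswap : [x, y].Subperm [y, x] := (List.Perm.swap y x []).subperm
  rcases zmod_two_eq τ with rfl | rfl <;> rcases lt_or_gt_of_ne h with hlt | hlt
  · exact ⟨y, x, Sym2.eq_swap, by simp [shortSum, hlt.le, not_lt], hswap⟩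
  · exact ⟨x, y, rfl, by simp [shortSum, hlt.le, not_lt], List.Subperm.refl _⟩
  · exact ⟨x, y, rfl, by simp [shortSum, hlt, ed], List.Subperm.refl _⟩
  · exact ⟨y, x, Sym2.eq_swap, by simp [shortSum, hlt, ed, Sym2.eq_swap], hswap⟩

/-- A key for a corner that is listed already is superfluous. -/
lemma Cross.absorb (hm : ∀ v, Function.Involutive (m v)) {φ : Sym2 (Fin n) → ZMod 2}
    {K : List (Fin n × Fin n)} {v e : Fin n} (h : Cross m φ (K ++ [(v, e)]))
    (hc : Corner m K v e) : Cross m φ K := by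
  intro a b hab
  have := h a b hab
  simp only [List.mem_append, List.mem_singleton, Prod.mk.injEq] at this
  rcases this with (h1 | ⟨rfl, rfl⟩) | (h1 | ⟨rfl, h1⟩)
  · exact Or.inl h1
  · exact hc
  · exact Or.inr h1
  · subst h1
    have := hc.mate hm
    rwa [hm] at this

lemma mem_iff_of_chi {A B : Edges n} {e : Sym2 (Fin n)} (h : chi A e = chi B e) :
    e ∈ A ↔ e ∈ B := by rw [← chi_eq_one, ← chi_eq_one, h]

lemma Loop.trail {x : ℕ → Fin n} {N : ℕ} (h : Loop m x N) {K : List (Fin n × Fin n)}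
    {ex : Sym2 (Fin n)} (hex : ∀ i < N, edgeAt x i ≠ ex) (h1 : Corner m K (x 0) (x 1))
    (h2 : Corner m K (x 0) (x (N - 1))) : Trail m K ex x N :=
  (h.half hex K).trail h.closed h.ne h1 h2

lemma edgeAt_ne_diag {x : ℕ → Fin n} {i : ℕ} (h : x i ≠ x (i + 1)) (v : Fin n) :
    edgeAt x i ≠ s(v, v) := by
  unfold edgeAt
  intro he
  rcases Sym2.eq_iff.1 he with ⟨h1, h2⟩ | ⟨h1, h2⟩ <;> exact h (h1.trans h2.symm)

lemma spec_process_one (hm : ∀ v, Function.Involutive (m v)) {K : List (Fin n × Fin n)}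
    {v : Fin n} {a : List (Fin n)} (hL : Loop m (walkFun v a) (a.length + 1)) (hodd : Odd a.length)
    (h1 : Corner m K v (walkFun v a 1)) (h2 : Corner m K v (walkFun v a a.length)) {Z : Edges n}
    (hZ : ¬ (s(v, walkFun v a 1) ∈ Z ↔ s(v, walkFun v a a.length) ∈ Z)) (two : Prop) :
    Spec (processOne v a) Z (edgeSum (walkFun v a) (Finset.range (a.length + 1)))
      (PieceStep m K v (edgeAt (walkFun v a) '' Set.Iio (a.length + 1)) Z two) := by
  have hex : ∀ i < a.length + 1, edgeAt (walkFun v a) i ≠ s(v, v) := fun i hi =>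
    edgeAt_ne_diag (hL.noloop i hi) v
  refine spec_processOne (K := K ++ []) (ex := s(v, v)) hm (hL.trail hex ?_ ?_) hodd hZ ?_
  · rw [List.append_nil]; exact h1
  · rw [List.append_nil]; exact h2
  · intro A B p q t code F K' τ h
    have hτ : τ = 0 := h.tau (by rintro ⟨i, hi, he⟩; exact hex i hi he)
    refine h.piece (E := 0) (σ := 0) (x := v) (y := v) (by simp) (Cross.zero _) (by simp)
      (fun e he _ => he) rfl ?_ (by simp) (Or.inl ⟨rfl, rfl⟩)
    rw [hτ, shortSum_self]; simp

/-! ### Two arcs -/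

/-- A walk of length `M` from `v` to `u` that does not return to `v`, with set of edges `T`. -/
structure Arc (m : Fin n → Fin n → Fin n) (K : List (Fin n × Fin n)) (ex : Sym2 (Fin n))
    (v u : Fin n) (f : ℕ → Fin n) (M : ℕ) (T : Set (Sym2 (Fin n))) : Prop where
  half : Half m K ex f M
  start : f 0 = v
  end_eq : f M = u
  pos : 1 ≤ M
  ne : ∀ k, 1 ≤ k → k ≤ M → f k ≠ v
  first : Corner m K v (f 1)
  last : edgeAt f (M - 1) = ex ∨ Corner m K u (f (M - 1))
  image : edgeAt f '' Set.Iio M = T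

/-- Two arcs from `v` to `u` make up a closed walk. -/
lemma Arc.trail (hm : ∀ v, Function.Involutive (m v)) {K : List (Fin n × Fin n)}
    {ex : Sym2 (Fin n)} {v u : Fin n} {f g : ℕ → Fin n} {M M' : ℕ} {T T' : Set (Sym2 (Fin n))}
    (hf : Arc m K ex v u f M T) (hg : Arc m K ex v u g M' T') (hd : Disjoint T T') :
    Trail m K ex (glue f M fun k => g (M' - k)) (M + M') := by
  have hfg : f M = g (M' - 0) := by rw [hf.end_eq, Nat.sub_zero, hg.end_eq]
  have hpos := hf.pos
  have hpos' := hg.pos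
  have h0 : glue f M (fun k => g (M' - k)) 0 = v := by rw [glue_of_le (Nat.zero_le _), hf.start]
  refine Half.trail (hf.half.glue (hg.half.reverse hm) hfg ?_ ?_ ?_) ?_ ?_ ?_ ?_
  · intro i hi j hj he
    have h1 : edgeAt f i ∈ T := hf.image ▸ ⟨i, hi, rfl⟩
    have h2 : edgeAt f i ∈ T' := by
      rw [he, ← hg.image, ← image_edgeAt_reverse]; exact ⟨j, hj, rfl⟩
    exact Set.disjoint_left.1 hd h1 h2
  · rw [hf.end_eq]; exact hf.last
  · rw [edgeAt_reverse _ (by omega), Nat.sub_zero, Nat.sub_zero, hg.end_eq]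
    exact hg.last
  · rw [h0, glue_of_ge hfg (by omega), show M' - (M + M' - M) = 0 by omega, hg.start]
  · intro i hi hi'
    rw [h0]
    rcases le_or_gt i M with h | h
    · rw [glue_of_le h]; exact hf.ne i hi h
    · rw [glue_of_ge hfg h.le]; exact hg.ne _ (by omega) (by omega)
  · rw [h0, glue_of_le (by omega)]; exact hf.first
  · rw [h0, glue_of_ge hfg (by omega), show M' - (M + M' - 1 - M) = 1 by omega]
    exact hg.first

lemma Arc.image_glue {K : List (Fin n × Fin n)}
    {ex : Sym2 (Fin n)} {v u : Fin n} {f g : ℕ → Fin n} {M M' : ℕ} {T T' : Set (Sym2 (Fin n))}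
    (hf : Arc m K ex v u f M T) (hg : Arc m K ex v u g M' T') :
    edgeAt (glue f M fun k => g (M' - k)) '' Set.Iio (M + M') = T ∪ T' := by
  rw [image_edgeAt_glue (by rw [hf.end_eq, Nat.sub_zero, hg.end_eq]), image_edgeAt_reverse, hf.image,
    hg.image]

lemma Arc.edgeSum_glue {K : List (Fin n × Fin n)}
    {ex : Sym2 (Fin n)} {v u : Fin n} {f g : ℕ → Fin n} {M M' : ℕ} {T T' : Set (Sym2 (Fin n))}
    (hf : Arc m K ex v u f M T) (hg : Arc m K ex v u g M' T') :
    edgeSum (glue f M fun k => g (M' - k)) (Finset.range (M + M')) =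
      edgeSum f (Finset.range M) + edgeSum g (Finset.range M') := by
  rw [SwitchChain.edgeSum_glue (by rw [hf.end_eq, Nat.sub_zero, hg.end_eq]), edgeSum_reverse]

/-- The processing of a 1-circuit that is made up of two arcs. -/
lemma spec_arcs (hm : ∀ v, Function.Involutive (m v)) {K : List (Fin n × Fin n)}
    {ex : Sym2 (Fin n)} {v u : Fin n} {f g : ℕ → Fin n} {M M' : ℕ} {T T' : Set (Sym2 (Fin n))}
    (hf : Arc m K ex v u f M T) (hg : Arc m K ex v u g M' T') (hd : Disjoint T T')
    {c : List (Fin n)} (hc : walkFun v c = glue f M fun k => g (M' - k))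
    (hlen : c.length + 1 = M + M') (hodd : Odd c.length) {Z : Edges n}
    (hZ : ¬ (s(v, f 1) ∈ Z ↔ s(v, g 1) ∈ Z)) {P : Edges n → Edges n → Prop}
    (hP : ∀ A B p q t code F K' τ, OneStep m K ex v (T ∪ T') Z A B p q t code F K' τ → P A B) :
    Spec (processOne v c) Z (edgeSum f (Finset.range M) + edgeSum g (Finset.range M')) P := by
  have hpos := hf.pos
  have hpos' := hg.pos
  have hT := hf.trail hm hg hd
  rw [← hc, ← hlen] at hT
  refine (spec_processOne hm hT hodd ?_ ?_).congr ?_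
  · have h1 : walkFun v c 1 = f 1 := by rw [hc, glue_of_le (by omega)]
    have h2 : walkFun v c c.length = g 1 := by
      rw [hc, glue_of_ge (by rw [hf.end_eq, Nat.sub_zero, hg.end_eq]) (by omega)]
      congr 1
      omega
    rwa [h1, h2]
  · rw [hlen, hc, hf.image_glue hg]
    exact hP
  · rw [hlen, hc, hf.edgeSum_glue hg]

end

section
variable {n : ℕ} {m : Fin n → Fin n → Fin n}

/-! ### Processing a 2-circuit -/

lemma Loop.arc {x : ℕ → Fin n} {N : ℕ} (h : Loop m x N) {K : List (Fin n × Fin n)}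
    {ex : Sym2 (Fin n)} (hex : ∀ i < N, edgeAt x i ≠ ex) {v u : Fin n} {r : ℕ} (hv : x 0 = v)
    (hu : x r = u) (hr : 1 ≤ r) (hr' : r < N) (h1 : Corner m K v (x 1))
    (h2 : Corner m K u (x (r - 1))) : Arc m K ex v u x r (edgeAt x '' Set.Iio r) where
  half := (h.half hex K).mono hr'.le
  start := hv
  end_eq := hu
  pos := hr
  ne := fun k hk hk' => by rw [← hv]; exact h.ne k hk (by omega)
  first := h1
  last := Or.inr h2
  image := rfl

lemma image_edgeAt_reverse' (x : ℕ → Fin n) {N r : ℕ} (hr : r ≤ N) :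
    edgeAt (fun i => x (N - i)) '' Set.Iio (N - r) = edgeAt x '' Set.Ico r N := by
  ext e
  constructor
  · rintro ⟨i, hi, rfl⟩
    rw [Set.mem_Iio] at hi
    exact ⟨N - 1 - i, Set.mem_Ico.2 (by omega), (edgeAt_reverse x (by omega)).symm⟩
  · rintro ⟨i, hi, rfl⟩
    rw [Set.mem_Ico] at hi
    refine ⟨N - 1 - i, Set.mem_Iio.2 (by omega), ?_⟩
    rw [edgeAt_reverse x (by omega), show N - 1 - (N - 1 - i) = i by omega]

lemma Loop.arc_reverse (hm : ∀ v, Function.Involutive (m v)) {x : ℕ → Fin n} {N : ℕ}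
    (h : Loop m x N) {K : List (Fin n × Fin n)}
    {ex : Sym2 (Fin n)} (hex : ∀ i < N, edgeAt x i ≠ ex) {v u : Fin n} {r : ℕ} (hv : x 0 = v)
    (hu : x r = u) (hr : 1 ≤ r) (hr' : r < N) (h1 : Corner m K v (x (N - 1)))
    (h2 : Corner m K u (x (r - 1))) :
    Arc m K ex v u (fun i => x (N - i)) (N - r) (edgeAt x '' Set.Ico r N) := by
  rw [← image_edgeAt_reverse' x hr'.le]
  refine (h.reverse hm).arc ?_ ?_ ?_ (by omega) (by omega) h1 ?_
  · intro i hi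
    rw [edgeAt_reverse x hi]
    exact hex _ (by omega)
  · simp only [Nat.sub_zero]
    rw [h.closed, hv]
  · rw [show N - (N - r) = r by omega, hu]
  · rw [show N - (N - r - 1) = r + 1 by omega, h.follow r hr hr', hu]
    exact h2.mate hm

lemma Trail.cross_full (hm : ∀ v, Function.Involutive (m v)) {K : List (Fin n × Fin n)}
    {ex : Sym2 (Fin n)} {x : ℕ → Fin n} {N : ℕ} (h : Trail m K ex x N) :
    Cross m (edgeSum x ((Finset.range N).filter fun i => edgeAt x i ≠ ex)) K := by
  refine (h.cross hm le_rfl).absorb hm ?_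
  rw [h.closed]
  exact h.last

lemma edgeSum_ne_zero {x : ℕ → Fin n} {I : Finset ℕ} {e : Sym2 (Fin n)} (h : edgeSum x I e ≠ 0) :
    ∃ i ∈ I, edgeAt x i = e := by
  by_contra! hcon
  exact h (edgeSum_apply_of_notMem hcon)

/-- The processing of a 2-circuit that is split into two 1-circuits at a vertex `u`. -/
lemma spec_two_arcs (hm : ∀ v, Function.Involutive (m v)) {Kv Kx : List (Fin n × Fin n)}
    {v u : Fin n} {f₁ g₁ f₂ g₂ : ℕ → Fin n} {M₁ M₁' M₂ M₂' : ℕ}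
    {S T₁ T₁' T₂ T₂' : Set (Sym2 (Fin n))}
    (hf₁ : Arc m (Kv ++ Kx) s(u, u) v u f₁ M₁ T₁) (hg₁ : Arc m (Kv ++ Kx) s(u, u) v u g₁ M₁' T₁')
    (hf₂ : Arc m (Kv ++ Kx) s(u, u) v u f₂ M₂ T₂) (hg₂ : Arc m (Kv ++ Kx) s(u, u) v u g₂ M₂' T₂')
    (hd₁ : Disjoint T₁ T₁') (hd₂ : Disjoint T₂ T₂') (hd : Disjoint (T₁ ∪ T₁') (T₂ ∪ T₂'))
    (hS₁ : T₁ ∪ T₁' ⊆ S) (hS₂ : T₂ ∪ T₂' ⊆ S) (hu : s(u, u) ∉ S)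
    (hKx : Kx.map Prod.fst = [u, u]) {c₁ c₂ : List (Fin n)}
    (hc₁ : walkFun v c₁ = glue f₁ M₁ fun k => g₁ (M₁' - k))
    (hc₂ : walkFun v c₂ = glue f₂ M₂ fun k => g₂ (M₂' - k))
    (hlen₁ : c₁.length + 1 = M₁ + M₁') (hlen₂ : c₂.length + 1 = M₂ + M₂')
    (hodd₁ : Odd c₁.length) (hodd₂ : Odd c₂.length) {Z : Edges n}
    (hZ₁ : ¬ (s(v, f₁ 1) ∈ Z ↔ s(v, g₁ 1) ∈ Z)) (hZ₂ : ¬ (s(v, f₂ 1) ∈ Z ↔ s(v, g₂ 1) ∈ Z))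
    {two : Prop} (htwo : two) :
    Spec (seq (processOne v c₁) (processOne v c₂)) Z
      (edgeSum f₁ (Finset.range M₁) + edgeSum g₁ (Finset.range M₁') +
        (edgeSum f₂ (Finset.range M₂) + edgeSum g₂ (Finset.range M₂')))
      (PieceStep m Kv v S Z two) := by
  refine (spec_arcs hm hf₁ hg₁ hd₁ hc₁ hlen₁ hodd₁ hZ₁ ?_).seq ?_
  · intro A B p q t code F K' τ h
    have hτ : τ = 0 := h.tau fun hcon => hu (hS₁ hcon)
    refine h.piece (E := 0) (σ := 0) (x := u) (y := u) (by simp) (Cross.zero _) (by simp)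
      (fun e he _ => hS₁ he) rfl ?_ (by rw [hKx]) (Or.inr htwo)
    rw [hτ, shortSum_self]; simp
  · intro Z₁ hZ
    set E := edgeSum f₁ (Finset.range M₁) + edgeSum g₁ (Finset.range M₁') with hE
    have hET : ∀ e, E e ≠ 0 → e ∈ T₁ ∪ T₁' := by
      intro e he
      rw [hE, ← hf₁.edgeSum_glue hg₁] at he
      obtain ⟨i, hi, rfl⟩ := edgeSum_ne_zero he
      rw [← hf₁.image_glue hg₁]
      exact ⟨i, by simpa using hi, rfl⟩
    have hstay : ∀ e ∈ T₂ ∪ T₂', (e ∈ Z₁ ↔ e ∈ Z) := by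
      intro e he
      apply mem_iff_of_chi
      rw [hZ, Pi.add_apply]
      have : E e = 0 := by
        by_contra hcon
        exact Set.disjoint_left.1 hd (hET e hcon) he
      rw [this, add_zero]
    have hfirst : ∀ {f : ℕ → Fin n} {M T}, Arc m (Kv ++ Kx) s(u, u) v u f M T → s(v, f 1) ∈ T := by
      intro f M T hf
      rw [← hf.image, ← hf.start]
      exact ⟨0, Set.mem_Iio.2 (by have := hf.pos; omega), rfl⟩
    have hcr : Cross m E (Kv ++ Kx) := by
      have := (hf₁.trail hm hg₁ hd₁).cross_full hm
      rwa [Finset.filter_true_of_mem, hf₁.edgeSum_glue hg₁] at this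
      intro i hi he
      apply hu
      apply hS₁
      rw [← hf₁.image_glue hg₁, ← he]
      exact ⟨i, by simpa using hi, rfl⟩
    refine spec_arcs hm hf₂ hg₂ hd₂ hc₂ hlen₂ hodd₂ ?_ ?_
    · rw [hstay _ (Or.inl (hfirst hf₂)), hstay _ (Or.inr (hfirst hg₂))]
      exact hZ₂
    · intro A B p q t code F K' τ h
      have hτ : τ = 0 := h.tau fun hcon => hu (hS₂ hcon)
      refine h.piece (E := E) (σ := 0) (x := u) (y := u) (by rw [hZ]; simp) hcr ?_
        (fun e he _ => hS₂ he) rfl ?_ (by rw [hKx]) (Or.inr htwo)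
      · intro e he
        exact ⟨hS₁ (hET e he), Set.disjoint_left.1 hd (hET e he)⟩
      · rw [hτ, shortSum_self]; simp

lemma disjoint_image_edgeAt {x : ℕ → Fin n} {N : ℕ} (h : Set.InjOn (edgeAt x) (Set.Iio N))
    {s t : Set ℕ} (hs : s ⊆ Set.Iio N) (ht : t ⊆ Set.Iio N) (hst : Disjoint s t) :
    Disjoint (edgeAt x '' s) (edgeAt x '' t) := by
  rw [Set.disjoint_left]
  rintro e ⟨i, hi, rfl⟩ ⟨j, hj, hij⟩
  have := h (ht hj) (hs hi) hij
  subst this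
  exact Set.disjoint_left.1 hst hi hj

lemma edgeSum_split_at {x : ℕ → Fin n} {N r : ℕ} (hr : r ≤ N) :
    edgeSum x (Finset.range r) + edgeSum (fun i => x (N - i)) (Finset.range (N - r)) =
      edgeSum x (Finset.range N) := by
  have h := edgeSum_reverse (fun i => x (r + i)) (N - r)
  have h2 : edgeSum (fun i => x (N - i)) (Finset.range (N - r)) =
      edgeSum (fun i => x (r + (N - r - i))) (Finset.range (N - r)) := by
    unfold edgeSum
    refine Finset.sum_congr rfl fun i hi => ?_
    rw [Finset.mem_range] at hi
    beta_reduce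
    rw [show r + (N - r - i) = N - i by omega, show r + (N - r - (i + 1)) = N - (i + 1) by omega]
  rw [h2, h]
  unfold edgeSum
  conv_rhs => rw [show N = r + (N - r) by omega, Finset.sum_range_add]
  rfl

/-- The processing of a 2-circuit by splitting it at a common vertex of its loops. -/
lemma spec_processSplit (hm : ∀ v, Function.Involutive (m v)) {K : List (Fin n × Fin n)}
    {v : Fin n} {a b : List (Fin n)} (hA : Loop m (walkFun v a) (a.length + 1))
    (hB : Loop m (walkFun v b) (b.length + 1)) (ha : Even a.length) (hb : Even b.length)
    (hd : Disjoint (edgeAt (walkFun v a) '' Set.Iio (a.length + 1))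
      (edgeAt (walkFun v b) '' Set.Iio (b.length + 1)))
    (ha1 : Corner m K v (walkFun v a 1)) (ha2 : Corner m K v (walkFun v a a.length))
    (hb1 : Corner m K v (walkFun v b 1)) (hb2 : Corner m K v (walkFun v b b.length)) {Z : Edges n}
    (hZa : s(v, walkFun v a 1) ∈ Z ↔ s(v, walkFun v a a.length) ∈ Z)
    (hZb : s(v, walkFun v b 1) ∈ Z ↔ s(v, walkFun v b b.length) ∈ Z)
    (hZab : ¬ (s(v, walkFun v a 1) ∈ Z ↔ s(v, walkFun v b 1) ∈ Z))
    (hcommon : ∃ u ∈ a, u ∈ b) {two : Prop} (htwo : two) :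
    Spec (processSplit v a b) Z (edgeSum (walkFun v a) (Finset.range (a.length + 1)) +
        edgeSum (walkFun v b) (Finset.range (b.length + 1)))
      (PieceStep m K v (edgeAt (walkFun v a) '' Set.Iio (a.length + 1) ∪
        edgeAt (walkFun v b) '' Set.Iio (b.length + 1)) Z two) := by
  set i := a.findIdx (· ∈ b) with hi
  have hia : i < a.length := by
    rw [hi, List.findIdx_lt_length]
    simpa using hcommon
  have hib : a[i] ∈ b := by
    have := List.findIdx_getElem (xs := a) (p := (· ∈ b)) (w := hia)
    simpa using this
  have hgetD : a.getD i v = a[i] := by rw [List.getD_eq_getElem]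
  set u := a[i] with hu
  set j := b.idxOf u with hj
  have hjb : j < b.length := List.idxOf_lt_length_iff.2 hib
  have hbj : b[j] = u := List.getElem_idxOf hjb
  have hxa : walkFun v a (i + 1) = u := walkFun_succ hia
  have hxb : walkFun v b (j + 1) = u := by rw [walkFun_succ hjb, hbj]
  have huv : u ≠ v := by rw [← hxa]; exact hA.ne _ (by omega) (by omega)
  set wa := walkFun v a with hwa
  set wb := walkFun v b with hwb
  have hva : wa 0 = v := rfl
  have hvb : wb 0 = v := rfl
  set Kx : List (Fin n × Fin n) := [(u, wa i), (u, wb j)] with hKx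
  have hua : Corner m (K ++ Kx) u (wa i) := Or.inl (by simp [hKx])
  have hub : Corner m (K ++ Kx) u (wb j) := Or.inl (by simp [hKx])
  have hmono : ∀ {w e}, Corner m K w e → Corner m (K ++ Kx) w e := fun h =>
    h.mono (List.subset_append_left _ _)
  have hexa : ∀ i < a.length + 1, edgeAt wa i ≠ s(u, u) := fun i hi =>
    edgeAt_ne_diag (hA.noloop i hi) u
  have hexb : ∀ i < b.length + 1, edgeAt wb i ≠ s(u, u) := fun i hi =>
    edgeAt_ne_diag (hB.noloop i hi) u
  have A1 : Arc m (K ++ Kx) s(u, u) v u wa (i + 1) (edgeAt wa '' Set.Iio (i + 1)) :=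
    hA.arc hexa hva hxa (by omega) (by omega) (hmono ha1) hua
  have A2 := hA.arc_reverse hm hexa hva hxa (by omega) (by omega) (hmono ha2) hua
  have B1 : Arc m (K ++ Kx) s(u, u) v u wb (j + 1) (edgeAt wb '' Set.Iio (j + 1)) :=
    hB.arc hexb hvb hxb (by omega) (by omega) (hmono hb1) hub
  have B2 := hB.arc_reverse hm hexb hvb hxb (by omega) (by omega) (hmono hb2) hub
  have sA1 : edgeAt wa '' Set.Iio (i + 1) ⊆ edgeAt wa '' Set.Iio (a.length + 1) :=
    Set.image_mono fun k hk => by rw [Set.mem_Iio] at hk ⊢; omega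
  have sA2 : edgeAt wa '' Set.Ico (i + 1) (a.length + 1) ⊆ edgeAt wa '' Set.Iio (a.length + 1) :=
    Set.image_mono fun k hk => hk.2
  have sB1 : edgeAt wb '' Set.Iio (j + 1) ⊆ edgeAt wb '' Set.Iio (b.length + 1) :=
    Set.image_mono fun k hk => by rw [Set.mem_Iio] at hk ⊢; omega
  have sB2 : edgeAt wb '' Set.Ico (j + 1) (b.length + 1) ⊆ edgeAt wb '' Set.Iio (b.length + 1) :=
    Set.image_mono fun k hk => hk.2
  have dA : Disjoint (edgeAt wa '' Set.Iio (i + 1)) (edgeAt wa '' Set.Ico (i + 1) (a.length + 1)) :=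
    disjoint_image_edgeAt hA.inj (fun k hk => by rw [Set.mem_Iio] at hk ⊢; omega)
      (fun k hk => hk.2) (Set.disjoint_left.2 fun k hk hk' => by
        rw [Set.mem_Iio] at hk; rw [Set.mem_Ico] at hk'; omega)
  have dB : Disjoint (edgeAt wb '' Set.Iio (j + 1)) (edgeAt wb '' Set.Ico (j + 1) (b.length + 1)) :=
    disjoint_image_edgeAt hB.inj (fun k hk => by rw [Set.mem_Iio] at hk ⊢; omega)
      (fun k hk => hk.2) (Set.disjoint_left.2 fun k hk hk' => by
        rw [Set.mem_Iio] at hk; rw [Set.mem_Ico] at hk'; omega)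
  set Sa := edgeAt wa '' Set.Iio (a.length + 1) with hSa
  set Sb := edgeAt wb '' Set.Iio (b.length + 1) with hSb
  have hdiag : s(u, u) ∉ Sa ∪ Sb := by
    rintro (⟨k, hk, he⟩ | ⟨k, hk, he⟩)
    · exact hexa k hk he
    · exact hexb k hk he
  have la : a.length + 1 - (i + 1) = a.length - i := by omega
  have lb : b.length + 1 - (j + 1) = b.length - j := by omega
  have eqA : edgeSum wa (Finset.range (i + 1)) + edgeSum (fun k => wa (a.length + 1 - k))
      (Finset.range (a.length + 1 - (i + 1))) = edgeSum wa (Finset.range (a.length + 1)) :=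
    edgeSum_split_at (by omega)
  have eqB : edgeSum wb (Finset.range (j + 1)) + edgeSum (fun k => wb (b.length + 1 - k))
      (Finset.range (b.length + 1 - (j + 1))) = edgeSum wb (Finset.range (b.length + 1)) :=
    edgeSum_split_at (by omega)
  have dropB : (fun k => wb (b.length + 1 - (b.length + 1 - (j + 1) - k))) =
      fun k => wb (j + 1 + k) := by
    funext k
    rcases le_or_gt k (b.length + 1 - (j + 1)) with h | h
    · congr 1; omega
    · rw [show b.length + 1 - (b.length + 1 - (j + 1) - k) = b.length + 1 by omega, hB.closed, hvb,
        hwb, walkFun_of_le (by omega)]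
  have hproc : processSplit v a b = if i % 2 = j % 2 then
      seq (processOne v (a.take i ++ [u] ++ (b.take j).reverse))
        (processOne v ((a.drop (i + 1)).reverse ++ [u] ++ b.drop (j + 1)))
    else seq (processOne v (a.take i ++ [u] ++ b.drop (j + 1)))
      (processOne v ((a.drop (i + 1)).reverse ++ [u] ++ (b.take j).reverse)) := by
    have : a.getD (a.findIdx (· ∈ b)) v = u := hgetD
    simp only [processSplit, this]
    rfl
  have d12 : Disjoint Sa Sb := hd
  have t1 : a.length + 1 - 1 = a.length := by omega
  have t2 : b.length + 1 - 1 = b.length := by omega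
  obtain ⟨ra, hra⟩ := ha
  obtain ⟨rb, hrb⟩ := hb
  rw [hproc]
  split_ifs with hpar
  · refine (spec_two_arcs hm A1 B1 A2 B2 (d12.mono sA1 sB1) (d12.mono sA2 sB2) ?_
      (Set.union_subset_union sA1 sB1) (Set.union_subset_union sA2 sB2) hdiag rfl
      (walkFun_take_reverse hia hjb) ?_ ?_ ?_ ?_ ?_ ?_ ?_ htwo).congr ?_
    · rw [Set.disjoint_union_left, Set.disjoint_union_right, Set.disjoint_union_right]
      exact ⟨⟨dA, d12.mono sA1 sB2⟩, d12.symm.mono sB1 sA2, dB⟩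
    · rw [dropB, la]; exact walkFun_reverse_drop hia hjb
    · simp; omega
    · simp; omega
    · simp only [List.length_append, List.length_take, List.length_singleton, List.length_reverse]
      rw [Nat.odd_iff]; omega
    · simp only [List.length_append, List.length_drop, List.length_singleton, List.length_reverse]
      rw [Nat.odd_iff]; omega
    · exact hZab
    · simp only [t1, t2]; tauto
    · rw [← eqA, ← eqB]; abel
  · refine (spec_two_arcs hm A1 B2 A2 B1 (d12.mono sA1 sB2) (d12.mono sA2 sB1) ?_
      (Set.union_subset_union sA1 sB2) (Set.union_subset_union sA2 sB1) hdiag rfl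
      ?_ ?_ ?_ ?_ ?_ ?_ ?_ ?_ htwo).congr ?_
    · rw [Set.disjoint_union_left, Set.disjoint_union_right, Set.disjoint_union_right]
      exact ⟨⟨dA, d12.mono sA1 sB1⟩, d12.symm.mono sB2 sA2, dB.symm⟩
    · rw [dropB]; exact walkFun_take_drop hia hjb
    · rw [la]; exact walkFun_reverse_take hia hjb
    · simp; omega
    · simp; omega
    · simp only [List.length_append, List.length_take, List.length_singleton, List.length_drop]
      rw [Nat.odd_iff]; omega
    · simp only [List.length_append, List.length_drop, List.length_singleton, List.length_reverse,
        List.length_take]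
      rw [Nat.odd_iff]; omega
    · simp only [t2]; tauto
    · simp only [t1]; tauto
    · rw [← eqA, ← eqB]; abel

end

section
variable {n : ℕ} {m : Fin n → Fin n → Fin n}

lemma Loop.two_le {v : Fin n} {a : List (Fin n)} (h : Loop m (walkFun v a) (a.length + 1))
    (ha : Even a.length) : 2 ≤ a.length := by
  rcases Nat.eq_zero_or_pos a.length with h0 | h0
  · exfalso
    have h1 := h.noloop 0 (by omega)
    have h2 := h.closed
    rw [h0] at h2
    exact h1 h2.symm
  · obtain ⟨r, hr⟩ := ha
    omega

/-- The processing of a 2-circuit by means of a shortcut edge. -/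
lemma spec_processShortcut (hm : ∀ v, Function.Involutive (m v)) {K : List (Fin n × Fin n)}
    {v : Fin n} {a b : List (Fin n)} (hA : Loop m (walkFun v a) (a.length + 1))
    (hB : Loop m (walkFun v b) (b.length + 1)) (ha : Even a.length) (hb : Even b.length)
    (hd : Disjoint (edgeAt (walkFun v a) '' Set.Iio (a.length + 1))
      (edgeAt (walkFun v b) '' Set.Iio (b.length + 1)))
    (ha1 : Corner m K v (walkFun v a 1)) (ha2 : Corner m K v (walkFun v a a.length))
    (hb1 : Corner m K v (walkFun v b 1)) (hb2 : Corner m K v (walkFun v b b.length)) {Z : Edges n}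
    (hZa : s(v, walkFun v a 1) ∈ Z ↔ s(v, walkFun v a a.length) ∈ Z)
    (hZb : s(v, walkFun v b 1) ∈ Z ↔ s(v, walkFun v b b.length) ∈ Z)
    (hZab : ¬ (s(v, walkFun v a 1) ∈ Z ↔ s(v, walkFun v b 1) ∈ Z))
    (hxy : walkFun v a 2 ≠ walkFun v b b.length)
    (hxyS : s(walkFun v a 2, walkFun v b b.length) ∉
      edgeAt (walkFun v a) '' Set.Iio (a.length + 1) ∪
        edgeAt (walkFun v b) '' Set.Iio (b.length + 1)) {two : Prop} (htwo : two) :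
    Spec (processShortcut v a b) Z (edgeSum (walkFun v a) (Finset.range (a.length + 1)) +
        edgeSum (walkFun v b) (Finset.range (b.length + 1)))
      (PieceStep m K v (edgeAt (walkFun v a) '' Set.Iio (a.length + 1) ∪
        edgeAt (walkFun v b) '' Set.Iio (b.length + 1)) Z two) := by
  have ha3 := hA.two_le ha
  have hb3 := hB.two_le hb
  set wa := walkFun v a with hwa
  set wb := walkFun v b with hwb
  have hva : wa 0 = v := rfl
  have hvb : wb 0 = v := rfl
  set w := wa 1 with hw
  set x := wa 2 with hx
  set y := wb b.length with hy
  have gw : a.getD 0 v = w := by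
    rw [List.getD_eq_getElem _ _ (by omega), hw, hwa, walkFun_succ (by omega)]
  have gx : a.getD 1 v = x := by
    rw [List.getD_eq_getElem _ _ (by omega), hx, hwa, walkFun_succ (by omega)]
  have gy : b.getLastD v = y := by
    obtain ⟨l, hl⟩ : ∃ l, b.length = l + 1 := ⟨b.length - 1, by omega⟩
    rw [hy, hwb, hl, walkFun_succ (by omega), List.getLastD_eq_getLast?, List.getLast?_eq_getElem?]
    simp [hl]
  have hvw : v ≠ w := (hA.ne 1 (by omega) (by omega)).symm
  have hvx : v ≠ x := (hA.ne 2 (by omega) (by omega)).symm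
  have hvy : v ≠ y := (hB.ne b.length (by omega) (by omega)).symm
  have hwx : w ≠ x := hA.noloop 1 (by omega)
  set Sa := edgeAt wa '' Set.Iio (a.length + 1) with hSa
  set Sb := edgeAt wb '' Set.Iio (b.length + 1) with hSb
  have mA : ∀ i, i < a.length + 1 → edgeAt wa i ∈ Sa := fun i hi => ⟨i, hi, rfl⟩
  have mB : ∀ i, i < b.length + 1 → edgeAt wb i ∈ Sb := fun i hi => ⟨i, hi, rfl⟩
  have evw : edgeAt wa 0 = s(v, w) := rfl
  have ewx : edgeAt wa 1 = s(w, x) := rfl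
  have eyv : edgeAt wb b.length = s(y, v) := by
    unfold edgeAt; rw [hB.closed, hvb]
  have hwy : w ≠ y := by
    intro he
    refine Set.disjoint_left.1 hd (mA 0 (by omega)) ?_
    rw [evw, he, Sym2.eq_swap, ← eyv]
    exact mB _ (by omega)
  set ex := s(x, y) with hex
  have exa : ∀ i < a.length + 1, edgeAt wa i ≠ ex := fun i hi he => hxyS (Or.inl ⟨i, hi, he⟩)
  have exb : ∀ i < b.length + 1, edgeAt wb i ≠ ex := fun i hi he => hxyS (Or.inr ⟨i, hi, he⟩)
  set Kx : List (Fin n × Fin n) := [(x, w), (y, v)] with hKx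
  have hmono : ∀ {c e}, Corner m K c e → Corner m (K ++ Kx) c e := fun h =>
    h.mono (List.subset_append_left _ _)
  have cx : Corner m (K ++ Kx) x w := Or.inl (by simp [hKx])
  have cy : Corner m (K ++ Kx) y v := Or.inl (by simp [hKx])
  have hfy : v = m y (wb (b.length - 1)) := by
    have := hB.follow b.length (by omega) (by omega)
    rwa [hB.closed, hvb] at this
  have cy' : Corner m (K ++ Kx) y (wb (b.length - 1)) := by
    right; rw [← hfy]; simp [hKx]
  -- the two arcs from `v` to `x`, the second one over the shortcut edge
  set T := edgeAt wa '' Set.Ico 2 (a.length + 1) with hT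
  set f : ℕ → Fin n := fun i => wa (a.length + 1 - i) with hf
  have Af : Arc m (K ++ Kx) ex v x f (a.length + 1 - 2) T :=
    hA.arc_reverse hm exa hva rfl (by omega) (by omega) (hmono ha2) cx
  set e₁ : ℕ → Fin n := fun k => if k = 0 then y else x with he₁
  set g : ℕ → Fin n := glue wb b.length e₁ with hg
  set T' := edgeAt wb '' Set.Iio b.length ∪ {ex} with hT'
  have hge : wb b.length = e₁ 0 := rfl
  have ee : edgeAt e₁ 0 = ex := Sym2.eq_swap
  have hgy : ∀ k, b.length < k → g k = x := by
    intro k hk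
    rw [hg, glue_of_ge hge hk.le, he₁]
    simp only
    rw [if_neg (by omega)]
  have Ag : Arc m (K ++ Kx) ex v x g (b.length + 1) T' := by
    refine ⟨?_, ?_, hgy _ (by omega), by omega, ?_, ?_, ?_, ?_⟩
    · refine ((hB.half exb _).mono (by omega)).glue ?_ hge ?_ (Or.inr cy') (Or.inl ee)
      · refine ⟨?_, ?_, ?_⟩
        · intro i hi j hj _
          rw [Set.mem_Iio] at hi hj
          omega
        · intro i hi
          obtain rfl : i = 0 := by omega
          exact hxy.symm
        · intro k hk hk'; omega
      · intro i hi j hj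
        obtain rfl : j = 0 := by omega
        rw [ee]
        exact exb i (by omega)
    · rw [hg, glue_of_le (by omega)]; exact hvb
    · intro k hk hk'
      rcases le_or_gt k b.length with h | h
      · rw [hg, glue_of_le h]; exact hB.ne k hk (by omega)
      · rw [hgy k h]; exact hvx.symm
    · rw [hg, glue_of_le (by omega)]; exact hmono hb1
    · left
      rw [hg, Nat.add_sub_cancel, edgeAt_glue_of_ge hge le_rfl, Nat.sub_self, ee]
    · rw [hg, image_edgeAt_glue hge, hT']
      congr 1
      ext e
      constructor
      · rintro ⟨i, hi, rfl⟩
        rw [Set.mem_Iio] at hi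
        obtain rfl : i = 0 := by omega
        exact ee
      · rintro rfl
        exact ⟨0, by simp, ee⟩
  have sT : T ⊆ Sa := Set.image_mono fun k hk => hk.2
  have sT' : edgeAt wb '' Set.Iio b.length ⊆ Sb :=
    Set.image_mono fun k hk => by rw [Set.mem_Iio] at hk ⊢; omega
  have hTT : Disjoint T T' := by
    rw [hT', Set.disjoint_union_right, Set.disjoint_singleton_right]
    exact ⟨hd.mono sT sT', fun h => hxyS (Or.inl (sT h))⟩
  have hnot0 : edgeAt wa 0 ∉ T ∪ T' := by
    rintro (⟨i, hi, he⟩ | ⟨i, hi, he⟩ | he)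
    · rw [Set.mem_Ico] at hi
      have := hA.inj (Set.mem_Iio.2 (by omega)) (Set.mem_Iio.2 (by omega)) he
      omega
    · exact Set.disjoint_left.1 hd (mA 0 (by omega)) (he ▸ sT' ⟨i, hi, rfl⟩)
    · exact exa 0 (by omega) he
  have hnot1 : edgeAt wa 1 ∉ T ∪ T' := by
    rintro (⟨i, hi, he⟩ | ⟨i, hi, he⟩ | he)
    · rw [Set.mem_Ico] at hi
      have := hA.inj (Set.mem_Iio.2 (by omega)) (Set.mem_Iio.2 (by omega)) he
      omega
    · exact Set.disjoint_left.1 hd (mA 1 (by omega)) (he ▸ sT' ⟨i, hi, rfl⟩)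
    · exact exa 1 (by omega) he
  have hnotb : edgeAt wb b.length ∉ T ∪ T' := by
    rintro (h | ⟨i, hi, he⟩ | he)
    · exact Set.disjoint_left.1 hd (sT h) (mB _ (by omega))
    · rw [Set.mem_Iio] at hi
      have := hB.inj (Set.mem_Iio.2 (by omega)) (Set.mem_Iio.2 (by omega)) he
      omega
    · exact exb _ (by omega) he
  have hTS : ∀ e ∈ T ∪ T', e ≠ ex → e ∈ Sa ∪ Sb := by
    rintro e (h | h | h) hne
    · exact Or.inl (sT h)
    · exact Or.inr (sT' h)
    · exact absurd h hne
  set c := a.tail.reverse ++ b.reverse with hc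
  have hcfun : walkFun v c = glue f (a.length + 1 - 2) fun k => g (b.length + 1 - k) := by
    rw [hc, walkFun_tail_reverse ha3]
    have : (fun k => if k = 0 then walkFun v a 2 else walkFun v b (b.length + 1 - k)) =
        fun k => g (b.length + 1 - k) := by
      funext k
      split_ifs with hk
      · rw [hk, hgy _ (by omega)]
      · rw [hg, glue_of_le (by omega)]
    rw [this]
    rfl
  have hlen : c.length + 1 = a.length + 1 - 2 + (b.length + 1) := by
    simp [hc]; omega
  have hodd : Odd c.length := by
    obtain ⟨ra, hra⟩ := ha
    obtain ⟨rb, hrb⟩ := hb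
    rw [Nat.odd_iff]; omega
  have hf1 : f 1 = wa a.length := rfl
  have hg1 : g 1 = wb 1 := by rw [hg, glue_of_le (by omega)]
  have mf1 : s(v, f 1) ∈ T ∪ T' ∧ s(v, f 1) ≠ ex := by
    have : s(v, f 1) = edgeAt wa a.length := by
      unfold edgeAt
      rw [hA.closed, hva, Sym2.eq_swap, hf1]
    rw [this]
    exact ⟨Or.inl ⟨_, Set.mem_Ico.2 ⟨by omega, by omega⟩, rfl⟩, exa _ (by omega)⟩
  have mg1 : s(v, g 1) ∈ T ∪ T' ∧ s(v, g 1) ≠ ex := by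
    have : s(v, g 1) = edgeAt wb 0 := by rw [hg1]; rfl
    rw [this]
    exact ⟨Or.inr (Or.inl ⟨0, Set.mem_Iio.2 (by omega), rfl⟩), exb _ (by omega)⟩
  have hZfg : ¬ (s(v, f 1) ∈ Z ↔ s(v, g 1) ∈ Z) := by rw [hf1, hg1]; tauto
  have sumA : edgeSum f (Finset.range (a.length + 1 - 2)) + (ed v w + ed w x) =
      edgeSum wa (Finset.range (a.length + 1)) := by
    rw [← edgeSum_split_at (x := wa) (r := 2) (N := a.length + 1) (by omega), add_comm]
    congr 1
    simp [edgeSum, Finset.sum_range_succ, hva, hw, hx]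
  have sumB : edgeSum g (Finset.range (b.length + 1)) + (ed x y + ed y v) =
      edgeSum wb (Finset.range (b.length + 1)) := by
    rw [hg, edgeSum_glue hge]
    have h1 : edgeSum e₁ (Finset.range 1) = ed x y := by
      simp [edgeSum, he₁, ed_comm]
    have h2 : edgeSum wb (Finset.range (b.length + 1)) =
        edgeSum wb (Finset.range b.length) + ed y v := by
      unfold edgeSum
      rw [Finset.sum_range_succ, hB.closed, hvb]
    rw [h1, h2]
    have := fun_add_self (ed x y)
    calc _ = edgeSum wb (Finset.range b.length) + ed y v + (ed x y + ed x y) := by abel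
      _ = _ := by rw [this, add_zero]
  have hnodup : [v, w, x, y].Nodup := by
    simp only [List.nodup_cons, List.mem_cons, List.not_mem_nil, or_false, not_or,
      not_false_eq_true, List.nodup_nil, and_true]
    exact ⟨⟨hvw, hvx, hvy⟩, ⟨hwx, hwy⟩, hxy⟩
  have hproc : processShortcut v a b Z = if (s(v, w) ∈ Z ↔ s(x, y) ∈ Z) then
      seq (switch v w x y) (processOne v c) Z
    else seq (processOne v c) (switch v w x y) Z := by
    rw [← gw, ← gx, ← gy]
    simp only [processShortcut]
    rfl
  have main : Spec (fun Z => if (s(v, w) ∈ Z ↔ s(x, y) ∈ Z) then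
      seq (switch v w x y) (processOne v c) Z
    else seq (processOne v c) (switch v w x y) Z) Z
      (edgeSum wa (Finset.range (a.length + 1)) + edgeSum wb (Finset.range (b.length + 1)))
      (PieceStep m K v (Sa ∪ Sb) Z two) := by
    unfold Spec
    simp only
    split_ifs with hcond
    · -- the switch on `vwxy` first
      refine ((Spec.switch hvw hvx hvy hwy (P := PieceStep m K v (Sa ∪ Sb) Z two) ?_).seq ?_).congr
        (φ := ed v w + ed w x + ed x y + ed y v + (edgeSum f (Finset.range (a.length + 1 - 2)) +
          edgeSum g (Finset.range (b.length + 1)))) ?_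
      · have hne : s(w, x) ≠ s(v, v) := by
          rw [← ewx]; exact edgeAt_ne_diag hwx v
        refine ⟨w, x, y, none, v, v, 0, [], ⟨hnodup, rfl, ?_, trivial, Cross.zero _, by simp,
          by simp, ?_, by simp⟩, Or.inl ⟨rfl, rfl⟩⟩
        · rw [shortSum_self]; simp [starSum]
        · rw [if_neg hne, ← ewx]; exact Or.inl (mA 1 (by omega))
      · intro Z₁ hZ₁
        set E := ed v w + ed w x + ed v y with hE
        have hEs : chi Z₁ = chi Z + (E + Pi.single ex 1) := by
          rw [hZ₁, hE, ed_comm y v]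
          unfold ed
          abel
        have hE1 : E = edgeSum wa ((Finset.range 2).filter fun i => edgeAt wa i ≠ ex) +
            edgeSum (fun i => wb (b.length + 1 - i))
              ((Finset.range 1).filter fun i => edgeAt (fun i => wb (b.length + 1 - i)) i ≠ ex) := by
          rw [Finset.filter_true_of_mem, Finset.filter_true_of_mem]
          · simp [edgeSum, Finset.sum_range_succ, hB.closed, hva, hvb, hE, hw, hx, hy]
          · intro i hi
            rw [Finset.mem_range] at hi
            rw [edgeAt_reverse wb (by omega)]
            exact exb _ (by omega)
          · intro i hi
            rw [Finset.mem_range] at hi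
            exact exa _ (by omega)
        have hEe : ∀ e, E e ≠ 0 → e ∈ Sa ∪ Sb ∧ e ∉ T ∪ T' := by
          intro e he
          rw [hE, Pi.add_apply, Pi.add_apply, ed_apply, ed_apply, ed_apply] at he
          by_cases h1 : e = s(v, w)
          · rw [h1, ← evw]; exact ⟨Or.inl (mA 0 (by omega)), hnot0⟩
          by_cases h2 : e = s(w, x)
          · rw [h2, ← ewx]; exact ⟨Or.inl (mA 1 (by omega)), hnot1⟩
          by_cases h3 : e = s(v, y)
          · rw [h3, Sym2.eq_swap, ← eyv]; exact ⟨Or.inr (mB _ (by omega)), hnotb⟩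
          simp [h1, h2, h3] at he
        have hstay : ∀ e, e ∈ T ∪ T' ∧ e ≠ ex → (e ∈ Z₁ ↔ e ∈ Z) := by
          intro e he
          apply mem_iff_of_chi
          rw [hEs, Pi.add_apply, Pi.add_apply, Pi.single_eq_of_ne he.2]
          have : E e = 0 := by
            by_contra hcon
            exact (hEe e hcon).2 he.1
          rw [this]; simp
        refine spec_arcs hm Af Ag hTT hcfun hlen hodd ?_ ?_
        · rw [hstay _ mf1, hstay _ mg1]; exact hZfg
        · intro A B p q t code F K' τ h
          obtain ⟨x', y', h1, h2, h3⟩ := exists_shortSum hxy (1 + τ)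
          refine h.piece hEs ?_ hEe hTS h1 h2 h3 (Or.inr htwo)
          rw [hE1]
          refine Cross.add ?_ ?_
          · exact (((hA.trail exa (hmono ha1) (hmono ha2)).cross hm (l := 2) (by omega)).absorb hm
              cx)
          · refine (((hB.reverse hm).trail (K := K ++ Kx) (ex := ex) ?_ ?_ ?_).cross hm (l := 1)
              (by omega)).absorb hm ?_
            · intro i hi
              rw [edgeAt_reverse wb hi]
              exact exb _ (by omega)
            · simp only [Nat.sub_zero, hB.closed, hvb]
              exact hmono hb2
            · simp only [Nat.sub_zero, hB.closed, hvb]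
              rw [show b.length + 1 - (b.length + 1 - 1) = 1 by omega]
              exact hmono hb1
            · simp only [Nat.sub_self, Nat.sub_zero, hB.closed, hvb]
              exact cy
      · rw [← sumA, ← sumB]; abel
    · -- the switch on `vwxy` last
      refine ((spec_arcs hm Af Ag hTT hcfun hlen hodd hZfg ?_).seq (φ' :=
        ed v w + ed w x + ed x y + ed y v) ?_).congr ?_
      · intro A B p q t code F K' τ h
        obtain ⟨x', y', h1, h2, h3⟩ := exists_shortSum hxy (0 + τ)
        exact h.piece (E := 0) (σ := 0) (by simp) (Cross.zero _) (by simp) hTS h1 h2 h3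
          (Or.inr htwo)
      · intro Z₁ hZ₁
        refine Spec.switch hvw hvx hvy hwy ?_
        rw [← Af.edgeSum_glue Ag] at hZ₁
        obtain ⟨τ, hτ, _⟩ := edgeSum_split (glue f (a.length + 1 - 2) fun k => g (b.length + 1 - k))
          (Finset.range (a.length + 1 - 2 + (b.length + 1))) ex
        have hcr := (Af.trail hm Ag hTT).cross_full hm
        set F := edgeSum (glue f (a.length + 1 - 2) fun k => g (b.length + 1 - k))
          ((Finset.range (a.length + 1 - 2 + (b.length + 1))).filter fun i =>
            edgeAt (glue f (a.length + 1 - 2) fun k => g (b.length + 1 - k)) i ≠ ex) with hF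
        have hFe : ∀ e, F e ≠ 0 → e ∈ T ∪ T' ∧ e ≠ ex := by
          intro e he
          obtain ⟨i, hi, rfl⟩ := edgeSum_ne_zero he
          rw [Finset.mem_filter, Finset.mem_range] at hi
          refine ⟨?_, hi.2⟩
          rw [← Af.image_glue Ag]
          exact ⟨i, hi.1, rfl⟩
        obtain ⟨x', y', h1, h2, h3⟩ := exists_shortSum hxy τ
        have hne : s(w, x) ≠ s(x', y') := by
          rw [h1, ← ewx]; exact exa 1 (by omega)
        refine ⟨w, x, y, none, x', y', F, Kx, ⟨hnodup, rfl, ?_, trivial, hcr, ?_, ?_, ?_, ?_⟩,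
          Or.inr htwo⟩
        · rw [hZ₁, hτ, h2]; simp [starSum, hex]
        · simpa [starEnds, hKx] using h3
        · intro e he
          exact hTS e (hFe e he).1 (hFe e he).2
        · rw [if_neg hne, ← ewx]; exact Or.inl (mA 1 (by omega))
        · rw [if_neg hne, ← ewx]
          by_contra hcon
          exact hnot1 (hFe _ hcon).1
      · rw [← sumA, ← sumB]; abel
  unfold Spec at main ⊢
  rw [hproc]
  exact main

end

section
variable {n : ℕ} {m : Fin n → Fin n → Fin n}

lemma Loop.mem_of_edge {v : Fin n} {a : List (Fin n)} {p q : Fin n} (hq : q ≠ v)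
    (h : s(p, q) ∈ edgeAt (walkFun v a) '' Set.Iio (a.length + 1)) : q ∈ a := by
  have key : ∀ i, walkFun v a i = q → q ∈ a := by
    intro i hi
    rcases Nat.eq_zero_or_pos i with rfl | h0
    · exact absurd hi.symm hq
    · obtain ⟨i, rfl⟩ : ∃ j, i = j + 1 := ⟨i - 1, by omega⟩
      rcases lt_or_ge i a.length with hl | hl
      · rw [walkFun_succ hl] at hi
        rw [← hi]
        exact List.getElem_mem hl
      · rw [walkFun_of_le (by omega)] at hi
        exact absurd hi.symm hq
  obtain ⟨i, _, he⟩ := h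
  rcases Sym2.eq_iff.1 he with ⟨_, h2⟩ | ⟨h1, _⟩
  · exact key _ h2
  · exact key _ h1

/-- The processing of a 2-circuit. If neither shortcut is available, then an end of the shortcut
edge is a common vertex of the two loops. -/
lemma spec_processTwo (hm : ∀ v, Function.Involutive (m v)) {K : List (Fin n × Fin n)}
    {v : Fin n} {a b : List (Fin n)} (hA : Loop m (walkFun v a) (a.length + 1))
    (hB : Loop m (walkFun v b) (b.length + 1)) (ha : Even a.length) (hb : Even b.length)
    (hd : Disjoint (edgeAt (walkFun v a) '' Set.Iio (a.length + 1))
      (edgeAt (walkFun v b) '' Set.Iio (b.length + 1)))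
    (ha1 : Corner m K v (walkFun v a 1)) (ha2 : Corner m K v (walkFun v a a.length))
    (hb1 : Corner m K v (walkFun v b 1)) (hb2 : Corner m K v (walkFun v b b.length)) {Z : Edges n}
    (hZa : s(v, walkFun v a 1) ∈ Z ↔ s(v, walkFun v a a.length) ∈ Z)
    (hZb : s(v, walkFun v b 1) ∈ Z ↔ s(v, walkFun v b b.length) ∈ Z)
    (hZab : ¬ (s(v, walkFun v a 1) ∈ Z ↔ s(v, walkFun v b 1) ∈ Z)) {two : Prop} (htwo : two) :
    Spec (processTwo v a b) Z (edgeSum (walkFun v a) (Finset.range (a.length + 1)) +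
        edgeSum (walkFun v b) (Finset.range (b.length + 1)))
      (PieceStep m K v (edgeAt (walkFun v a) '' Set.Iio (a.length + 1) ∪
        edgeAt (walkFun v b) '' Set.Iio (b.length + 1)) Z two) := by
  have ha3 := hA.two_le ha
  have hb3 := hB.two_le hb
  have gx : a.getD 1 v = walkFun v a 2 := rfl
  have gy : b.getLastD v = walkFun v b b.length := by
    obtain ⟨l, hl⟩ : ∃ l, b.length = l + 1 := ⟨b.length - 1, by omega⟩
    rw [hl, walkFun_succ (by omega), List.getLastD_eq_getLast?, List.getLast?_eq_getElem?]
    simp [hl]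
  have gz : b.headD v = walkFun v b 1 := by
    cases b <;> rfl
  have hS : ∀ e, e ∈ walkEdges (v :: a) ∪ walkEdges (v :: b) ↔
      e ∈ edgeAt (walkFun v a) '' Set.Iio (a.length + 1) ∪
        edgeAt (walkFun v b) '' Set.Iio (b.length + 1) := by
    intro e
    rw [Finset.mem_union, edgeAt_walkFun_mem, edgeAt_walkFun_mem]
    rfl
  unfold Spec
  simp only [processTwo]
  split_ifs with h1 h2 <;> rw [gx, gy, hS] at h1 <;> try rw [gx, gz, hS] at h2
  · exact spec_processShortcut hm hA hB ha hb hd ha1 ha2 hb1 hb2 hZa hZb hZab h1.1 h1.2 htwo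
  · have hr : walkFun v b.reverse = fun i => walkFun v b (b.length + 1 - i) := walkFun_reverse v b
    have hr1 : walkFun v b.reverse 1 = walkFun v b b.length := by rw [hr]; rfl
    have hr2 : walkFun v b.reverse b.length = walkFun v b 1 := by
      rw [hr]; simp
    have hi : edgeAt (walkFun v b.reverse) '' Set.Iio (b.length + 1) =
        edgeAt (walkFun v b) '' Set.Iio (b.length + 1) := by
      rw [hr]; exact image_edgeAt_reverse _ _
    have hs : edgeSum (walkFun v b.reverse) (Finset.range (b.length + 1)) =
        edgeSum (walkFun v b) (Finset.range (b.length + 1)) := by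
      rw [hr]; exact edgeSum_reverse _ _
    have key := spec_processShortcut (K := K) (b := b.reverse) (Z := Z) (two := two) hm hA
      (by rw [hr, List.length_reverse]; exact hB.reverse hm) ha (by simpa using hb)
      (by rw [List.length_reverse, hi]; exact hd) ha1 ha2 (by rw [hr1]; exact hb2)
      (by rw [List.length_reverse, hr2]; exact hb1) hZa
      (by rw [List.length_reverse, hr1, hr2]; exact hZb.symm)
      (by rw [hr1]; tauto) (by rw [List.length_reverse, hr2]; exact h2.1)
      (by rw [List.length_reverse, hr2, hi]; exact h2.2) htwo
    rw [List.length_reverse, hi, hs] at key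
    exact key
  · refine spec_processSplit hm hA hB ha hb hd ha1 ha2 hb1 hb2 hZa hZb hZab ?_ htwo
    have hxa : walkFun v a 2 ∈ a := by
      rw [walkFun_succ (by omega)]; exact List.getElem_mem _
    have hyb : walkFun v b b.length ∈ b := by
      obtain ⟨l, hl⟩ : ∃ l, b.length = l + 1 := ⟨b.length - 1, by omega⟩
      rw [hl, walkFun_succ (by omega)]; exact List.getElem_mem _
    have hxv : walkFun v a 2 ≠ v := hA.ne 2 (by omega) (by omega)
    have hyv : walkFun v b b.length ≠ v := hB.ne _ (by omega) (by omega)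
    by_cases hxy : walkFun v a 2 = walkFun v b b.length
    · exact ⟨_, hxa, hxy ▸ hyb⟩
    · have h3 := not_not.1 fun h => h1 ⟨hxy, h⟩
      rcases h3 with h3 | h3
      · exact ⟨_, Loop.mem_of_edge hyv h3, hyb⟩
      · rw [Sym2.eq_swap] at h3
        exact ⟨_, hxa, Loop.mem_of_edge hxv h3⟩

end

section
variable {n : ℕ} {m : Fin n → Fin n → Fin n}

/-! ### The decomposition into circuits -/

/-- The edge set `E` is a union of pairs of distinct edges that are paired by `m`. -/
structure Paired (m : Fin n → Fin n → Fin n) (E : Edges n) : Prop where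
  mate_mem : ∀ v e, s(v, e) ∈ E → s(v, m v e) ∈ E
  mate_ne : ∀ v e, s(v, e) ∈ E → m v e ≠ e
  loopless : ∀ v, s(v, v) ∉ E

/-- A walk with period `L` that leaves each vertex by the edge paired with the one of arrival, and
whose `L` edges are distinct. -/
structure Circuit (m : Fin n → Fin n → Fin n) (E : Edges n) (w : ℕ → Fin n) (L : ℕ) : Prop where
  pos : 0 < L
  mem : ∀ i, edgeAt w i ∈ E
  follow : ∀ i, w (i + 2) = m (w (i + 1)) (w i)
  period : ∀ i, w (i + L) = w i
  inj : Set.InjOn (edgeAt w) (Set.Iio L)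

/-- The step of a walk from a directed edge to the next one. -/
def nextDart (m : Fin n → Fin n → Fin n) (p : Fin n × Fin n) : Fin n × Fin n := (p.2, m p.2 p.1)

lemma nextDart_injective (hm : ∀ v, Function.Involutive (m v)) :
    Function.Injective (nextDart m) := by
  rintro ⟨a, b⟩ ⟨a', b'⟩ h
  simp only [nextDart, Prod.mk.injEq] at h
  obtain ⟨rfl, h2⟩ := h
  rw [(hm b).injective h2]

lemma nextDart_swap (hm : ∀ v, Function.Involutive (m v)) (p : Fin n × Fin n) :
    nextDart m (nextDart m p).swap = p.swap := by
  simp [nextDart, (hm p.2) p.1, Prod.swap]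

/-- No walk along paired edges passes through an edge in both directions: between the two passages,
it would have to turn round at a vertex or at an edge. -/
lemma iterate_nextDart_ne_swap (hm : ∀ v, Function.Involutive (m v)) {E : Edges n}
    (hE : Paired m E) (p : Fin n × Fin n) (hp : ∀ i, s(((nextDart m)^[i] p).1, ((nextDart m)^[i] p).2) ∈ E) (k : ℕ) :
    ∀ i, (nextDart m)^[i + k] p ≠ ((nextDart m)^[i] p).swap := by
  induction k using Nat.strong_induction_on with
  | _ k ih =>
    intro i h
    match k with
    | 0 =>
      have h1 : ((nextDart m)^[i] p).1 = ((nextDart m)^[i] p).2 := by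
        have := congrArg Prod.fst h
        simpa using this
      have h2 := hp i
      rw [h1] at h2
      exact hE.loopless _ h2
    | 1 =>
      rw [Function.iterate_succ_apply'] at h
      have h1 : m ((nextDart m)^[i] p).2 ((nextDart m)^[i] p).1 = ((nextDart m)^[i] p).1 :=
        congrArg Prod.snd h
      refine hE.mate_ne _ _ ?_ h1
      rw [Sym2.eq_swap]
      exact hp i
    | k + 2 =>
      refine ih k (by omega) (i + 1) (nextDart_injective hm ?_)
      rw [Function.iterate_succ_apply' _ i, nextDart_swap hm, ← h,
        ← Function.iterate_succ_apply' (nextDart m), Nat.succ_eq_add_one,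
        show i + 1 + k + 1 = i + (k + 2) by omega]

lemma trace_eq {p : Fin n × Fin n} (k : ℕ) : ∀ j, j < Function.minimalPeriod (nextDart m) p →
    Function.minimalPeriod (nextDart m) p ≤ j + k →
    trace m p k ((nextDart m)^[j] p) =
      (List.range (Function.minimalPeriod (nextDart m) p - j)).map
        fun i => ((nextDart m)^[j + i] p).1 := by
  induction k with
  | zero => intro j h1 h2; omega
  | succ k ih =>
    intro j h1 h2
    obtain ⟨r, hr⟩ : ∃ r, Function.minimalPeriod (nextDart m) p - j = r + 1 :=
      ⟨Function.minimalPeriod (nextDart m) p - j - 1, by omega⟩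
    have hstep : (((nextDart m)^[j] p).2, m ((nextDart m)^[j] p).2 ((nextDart m)^[j] p).1) =
        (nextDart m)^[j + 1] p := by
      rw [Function.iterate_succ_apply']; rfl
    rw [trace, hstep, hr, List.range_succ_eq_map, List.map_cons, List.map_map, add_zero]
    congr 1
    split_ifs with hp
    · have h3 : Function.IsPeriodicPt (nextDart m) (j + 1) p := hp
      have := h3.minimalPeriod_le (Nat.succ_pos j)
      obtain rfl : r = 0 := by omega
      rfl
    · have hne : j + 1 ≠ Function.minimalPeriod (nextDart m) p := by
        intro hh
        apply hp
        rw [hh]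
        exact Function.iterate_minimalPeriod
      rw [ih (j + 1) (by omega) (by omega),
        show Function.minimalPeriod (nextDart m) p - (j + 1) = r by omega]
      refine List.map_congr_left fun i _ => ?_
      simp only [Function.comp]
      congr 2
      omega

/-- The circuit through a given directed edge. -/
lemma exists_circuit (hm : ∀ v, Function.Involutive (m v)) {E : Edges n} (hE : Paired m E)
    {p : Fin n × Fin n} (hp : s(p.1, p.2) ∈ E) :
    ∃ w L, Circuit m E w L ∧ trace m p (n * n) p = (List.range L).map w := by
  set L := Function.minimalPeriod (nextDart m) p with hL
  have hper : p ∈ Function.periodicPts (nextDart m) := (nextDart_injective hm).mem_periodicPts p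
  have hpos : 0 < L := Function.minimalPeriod_pos_of_mem_periodicPts hper
  have hle : L ≤ n * n := by
    have := Function.minimalPeriod_le_card (f := nextDart m) (x := p)
    simpa using this
  have hsnd : ∀ i, ((nextDart m)^[i] p).2 = ((nextDart m)^[i + 1] p).1 := fun i => by
    rw [Function.iterate_succ_apply']; rfl
  have hedge : ∀ i, edgeAt (fun i => ((nextDart m)^[i] p).1) i =
      s(((nextDart m)^[i] p).1, ((nextDart m)^[i] p).2) := by
    intro i
    rw [hsnd]
    rfl
  have hmem : ∀ i, s(((nextDart m)^[i] p).1, ((nextDart m)^[i] p).2) ∈ E := by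
    intro i
    induction i with
    | zero => exact hp
    | succ i ih =>
      rw [Function.iterate_succ_apply']
      refine hE.mate_mem _ _ ?_
      rw [Sym2.eq_swap]
      exact ih
  refine ⟨fun i => ((nextDart m)^[i] p).1, L, ⟨hpos, ?_, ?_, ?_, ?_⟩, ?_⟩
  · intro i; rw [hedge]; exact hmem i
  · intro i
    rw [← hsnd (i + 1), Function.iterate_succ_apply']
    simp only [nextDart]
  · intro i
    exact congrArg Prod.fst Function.iterate_add_minimalPeriod_eq
  · intro i hi j hj hij
    rw [Set.mem_Iio] at hi hj
    rw [hedge, hedge] at hij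
    rcases Sym2.eq_iff.1 hij with ⟨h1, h2⟩ | ⟨h1, h2⟩
    · have h := Prod.ext h1 h2
      exact (Function.iterate_eq_iterate_iff_of_lt_minimalPeriod hi hj).1 h
    · have h : (nextDart m)^[i] p = ((nextDart m)^[j] p).swap := Prod.ext h1 h2
      exfalso
      rcases le_total i j with hle | hle
      · obtain ⟨k, rfl⟩ := Nat.exists_eq_add_of_le hle
        refine iterate_nextDart_ne_swap hm hE p hmem k i ?_
        rw [h, Prod.swap_swap]
      · obtain ⟨k, rfl⟩ := Nat.exists_eq_add_of_le hle
        exact iterate_nextDart_ne_swap hm hE p hmem k j h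
  · have := trace_eq (m := m) (p := p) (n * n) 0 hpos (by omega)
    simpa using this

lemma Circuit.exists_walkFun {E : Edges n} {w : ℕ → Fin n} {L : ℕ} (h : Circuit m E w L) :
    ∃ t, (List.range L).map w = w 0 :: t ∧ t.length + 1 = L ∧
      ∀ i ≤ L, walkFun (w 0) t i = w i := by
  obtain ⟨r, rfl⟩ : ∃ r, L = r + 1 := ⟨L - 1, by have := h.pos; omega⟩
  refine ⟨(List.range r).map fun i => w (i + 1), ?_, by simp, ?_⟩
  · rw [List.range_succ_eq_map, List.map_cons, List.map_map]
    rfl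
  · intro i hi
    rcases Nat.eq_zero_or_pos i with rfl | h0
    · rfl
    obtain ⟨i, rfl⟩ : ∃ j, i = j + 1 := ⟨i - 1, by omega⟩
    rcases lt_or_ge i r with hl | hl
    · rw [walkFun_succ (by simpa using hl)]; simp
    · rw [walkFun_of_le (by simp; omega), show i + 1 = 0 + (r + 1) by omega, h.period]

lemma Circuit.mem_walkEdges {E : Edges n} {w : ℕ → Fin n} {L : ℕ} (h : Circuit m E w L)
    {e : Sym2 (Fin n)} : e ∈ walkEdges ((List.range L).map w) ↔ ∃ i < L, edgeAt w i = e := by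
  obtain ⟨t, h1, h2, h3⟩ := h.exists_walkFun
  rw [h1, edgeAt_walkFun_mem, h2]
  refine exists_congr fun i => and_congr_right fun hi => ?_
  unfold edgeAt
  rw [h3 i hi.le, h3 (i + 1) hi]

lemma Circuit.edgeAt_mem {E : Edges n} {w : ℕ → Fin n} {L : ℕ} (h : Circuit m E w L) (i : ℕ) :
    edgeAt w i ∈ walkEdges ((List.range L).map w) := by
  rw [h.mem_walkEdges]
  refine ⟨i % L, Nat.mod_lt _ h.pos, ?_⟩
  have hp : Function.Periodic w L := h.period
  have hp1 : Function.Periodic (edgeAt w) L := by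
    intro i
    unfold edgeAt
    rw [hp, show i + L + 1 = i + 1 + L by omega, hp]
  exact hp1.map_mod_nat i

lemma Circuit.subset {E : Edges n} {w : ℕ → Fin n} {L : ℕ} (h : Circuit m E w L) :
    walkEdges ((List.range L).map w) ⊆ E := by
  intro e he
  obtain ⟨i, _, rfl⟩ := h.mem_walkEdges.1 he
  exact h.mem i

lemma Circuit.mate_mem (hm : ∀ v, Function.Involutive (m v)) {E : Edges n} {w : ℕ → Fin n} {L : ℕ}
    (h : Circuit m E w L) {v e : Fin n} (he : s(v, e) ∈ walkEdges ((List.range L).map w)) :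
    s(v, m v e) ∈ walkEdges ((List.range L).map w) := by
  obtain ⟨i, _, hi⟩ := h.mem_walkEdges.1 he
  rcases Sym2.eq_iff.1 hi with ⟨rfl, rfl⟩ | ⟨rfl, rfl⟩
  · obtain ⟨r, hr⟩ : ∃ r, i + L = r + 1 := ⟨i + L - 1, by have := h.pos; omega⟩
    have h1 : w (r + 1) = w i := by rw [← hr, h.period]
    have h2 : w (r + 2) = w (i + 1) := by
      rw [← h.period (i + 1)]; congr 1; omega
    have h3 : m (w i) (w (i + 1)) = w r := by
      rw [← h2, h.follow, h1, hm]
    rw [h3, Sym2.eq_swap, ← h1]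
    exact h.edgeAt_mem r
  · rw [← h.follow]
    exact h.edgeAt_mem (i + 1)

lemma Paired.sdiff (hm : ∀ v, Function.Involutive (m v)) {E : Edges n} (hE : Paired m E)
    {w : ℕ → Fin n} {L : ℕ} (h : Circuit m E w L) :
    Paired m (E \ walkEdges ((List.range L).map w)) where
  mate_mem v e he := by
    rw [Finset.mem_sdiff] at he ⊢
    refine ⟨hE.mate_mem v e he.1, fun hc => he.2 ?_⟩
    have := h.mate_mem hm hc
    rwa [hm v e] at this
  mate_ne v e he := hE.mate_ne v e (Finset.mem_sdiff.1 he).1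
  loopless v hv := hE.loopless v (Finset.mem_sdiff.1 hv).1

lemma leastEdge_eq_none {E : Edges n} (h : leastEdge E = none) (hE : ∀ v, s(v, v) ∉ E) :
    E = ∅ := by
  rw [Finset.eq_empty_iff_forall_notMem]
  intro e
  induction e with
  | _ a b =>
    intro he
    unfold leastEdge at h
    rw [List.find?_eq_none] at h
    have key : ∀ a b, a < b → s(a, b) ∉ E := fun a b hab hmem => by
      refine h (a, b) ?_ ?_
      · simp [List.mem_finRange]
      · simp [hab, hmem]
    rcases lt_trichotomy a b with hab | rfl | hab
    · exact key a b hab he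
    · exact hE a he
    · exact key b a hab (by rwa [Sym2.eq_swap])

lemma leastEdge_mem {E : Edges n} {p : Fin n × Fin n} (h : leastEdge E = some p) :
    s(p.1, p.2) ∈ E := by
  have := List.find?_some h
  simp only [decide_eq_true_eq] at this
  exact this.2

/-- The list `l` decomposes the edge set `E` into circuits. -/
inductive CircuitList (m : Fin n → Fin n → Fin n) : Edges n → List (List (Fin n)) → Prop
  | nil : CircuitList m ∅ []
  | cons {E : Edges n} {w : ℕ → Fin n} {L : ℕ} {l : List (List (Fin n))} (h : Circuit m E w L)
      (hl : CircuitList m (E \ walkEdges ((List.range L).map w)) l) :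
      CircuitList m E ((List.range L).map w :: l)

lemma circuitList_circuits (hm : ∀ v, Function.Involutive (m v)) (k : ℕ) :
    ∀ E : Edges n, Paired m E → E.card ≤ k → CircuitList m E (circuits m k E) := by
  induction k with
  | zero =>
    intro E _ hk
    obtain rfl := Finset.card_eq_zero.1 (Nat.le_zero.1 hk)
    exact CircuitList.nil
  | succ k ih =>
    intro E hE hk
    unfold circuits
    rcases hl : leastEdge E with _ | p
    · rw [leastEdge_eq_none hl hE.loopless]
      exact CircuitList.nil
    · simp only
      obtain ⟨w, L, hC, hw⟩ := exists_circuit hm hE (leastEdge_mem hl)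
      rw [hw]
      refine CircuitList.cons hC (ih _ (hE.sdiff hm hC) ?_)
      have hlt : (E \ walkEdges ((List.range L).map w)).card < E.card := by
        refine Finset.card_lt_card ⟨Finset.sdiff_subset, fun hsub => ?_⟩
        exact (Finset.mem_sdiff.1 (hsub (hC.mem 0))).2 (hC.edgeAt_mem 0)
      omega

lemma CircuitList.subset {E : Edges n} {l : List (List (Fin n))} (h : CircuitList m E l) :
    ∀ c ∈ l, walkEdges c ⊆ E := by
  induction h with
  | nil => simp
  | cons h hl ih =>
    intro c hc
    rcases List.mem_cons.1 hc with rfl | hc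
    · exact h.subset
    · exact (ih c hc).trans Finset.sdiff_subset

lemma CircuitList.exists_mem {E : Edges n} {l : List (List (Fin n))} (h : CircuitList m E l) :
    ∀ e ∈ E, ∃ c ∈ l, e ∈ walkEdges c := by
  induction h with
  | nil => simp
  | @cons E w L l h hl ih =>
    intro e he
    by_cases hc : e ∈ walkEdges ((List.range L).map w)
    · exact ⟨_, List.mem_cons_self, hc⟩
    · obtain ⟨c, hc1, hc2⟩ := ih e (Finset.mem_sdiff.2 ⟨he, hc⟩)
      exact ⟨c, List.mem_cons_of_mem _ hc1, hc2⟩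

lemma CircuitList.pairwise {E : Edges n} {l : List (List (Fin n))} (h : CircuitList m E l) :
    l.Pairwise fun c c' => Disjoint (walkEdges c) (walkEdges c') := by
  induction h with
  | nil => exact List.Pairwise.nil
  | cons h hl ih =>
    refine List.Pairwise.cons (fun c hc => ?_) ih
    exact Finset.disjoint_of_subset_right (hl.subset c hc) Finset.disjoint_sdiff

/-- The loops at `v` into which the walk `x` is cut between the times `s` and `L`. -/
def Blocks (x : ℕ → Fin n) (v : Fin n) (L : ℕ) : ℕ → List (List (Fin n)) → Prop
  | s, [] => s = L
  | s, a :: ls => (∀ i ≤ a.length + 1, walkFun v a i = x (s + i)) ∧ v ∉ a ∧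
      s + a.length + 1 ≤ L ∧ Blocks x v L (s + a.length + 1) ls

lemma blocks_splitOn {x : ℕ → Fin n} {v : Fin n} {L : ℕ} (hL : x L = v) (t : List (Fin n)) :
    ∀ s, s + 1 + t.length = L → (∀ i (h : i < t.length), t[i] = x (s + 1 + i)) →
    ∃ a ls, t.splitOn v = a :: ls ∧ v ∉ a ∧ (∀ i (h : i < a.length), a[i] = x (s + 1 + i)) ∧
      x (s + 1 + a.length) = v ∧ s + a.length + 1 ≤ L ∧ Blocks x v L (s + a.length + 1) ls := by
  induction t with
  | nil =>
    intro s hs _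
    simp only [List.length_nil, add_zero] at hs
    refine ⟨[], [], by simp, by simp, by simp, ?_, ?_, ?_⟩
    · simpa [hs] using hL
    · simp [hs]
    · simpa [Blocks] using hs
  | cons u t ih =>
    intro s hs hx
    rw [List.length_cons] at hs
    obtain ⟨a, ls, h1, h2, h3, h4, h5, h6⟩ := ih (s + 1) (by omega) (fun i hi => by
      have := hx (i + 1) (by simpa using hi)
      rw [List.getElem_cons_succ] at this
      rw [this]; congr 1; omega)
    have hu : u = x (s + 1) := hx 0 (by simp)
    have hcons : (u :: t).splitOn v = if u = v then [] :: a :: ls else (u :: a) :: ls := by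
      unfold List.splitOn at h1 ⊢
      rw [List.splitOnP_cons_eq_if_modifyHead, h1]
      by_cases huv : u = v <;> simp [huv]
    by_cases huv : u = v
    · refine ⟨[], a :: ls, by rw [hcons, if_pos huv], by simp, by simp, ?_, ?_, ?_⟩
      · simp [← hu, huv]
      · simp; omega
      · refine ⟨?_, h2, by simp; omega, ?_⟩
        · intro i hi
          rcases Nat.eq_zero_or_pos i with rfl | h0
          · simp [walkFun, ← hu, huv]
          obtain ⟨i, rfl⟩ : ∃ j, i = j + 1 := ⟨i - 1, by omega⟩
          rcases lt_or_ge i a.length with hl | hl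
          · rw [walkFun_succ hl, h3 i hl]; congr 1; simp; omega
          · rw [walkFun_of_le (by omega), ← h4]; congr 1; simp; omega
        · rwa [show s + ([] : List (Fin n)).length + 1 + a.length + 1 = s + 1 + a.length + 1 by simp]
    · refine ⟨u :: a, ls, by rw [hcons, if_neg huv], ?_, ?_, ?_, ?_, ?_⟩
      · rw [List.mem_cons, not_or]
        exact ⟨fun h => huv h.symm, h2⟩
      · intro i hi
        rcases Nat.eq_zero_or_pos i with rfl | h0
        · simpa using hu
        obtain ⟨i, rfl⟩ : ∃ j, i = j + 1 := ⟨i - 1, by omega⟩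
        rw [List.getElem_cons_succ, h3]; congr 1; omega
      · rw [← h4, List.length_cons]; congr 1; omega
      · rw [List.length_cons]; omega
      · rw [List.length_cons]
        rwa [show s + (a.length + 1) + 1 = s + 1 + a.length + 1 by omega]

lemma blocks_splitOn_zero {x : ℕ → Fin n} {v : Fin n} {L : ℕ} (h0 : x 0 = v) (hL : x L = v)
    (t : List (Fin n)) (ht : 1 + t.length = L)
    (hx : ∀ i (h : i < t.length), t[i] = x (1 + i)) : Blocks x v L 0 (t.splitOn v) := by
  obtain ⟨a, ls, h1, h2, h3, h4, h5, h6⟩ := blocks_splitOn hL t 0 (by omega) (by simpa using hx)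
  rw [h1]
  refine ⟨?_, h2, h5, h6⟩
  intro i hi
  rcases Nat.eq_zero_or_pos i with rfl | h0'
  · simp [walkFun, h0]
  obtain ⟨i, rfl⟩ : ∃ j, i = j + 1 := ⟨i - 1, by omega⟩
  rcases lt_or_ge i a.length with hl | hl
  · rw [walkFun_succ hl, h3 i hl]; congr 1; omega
  · rw [walkFun_of_le (by omega), ← h4]; congr 1; omega

end

section
variable {n : ℕ} {m : Fin n → Fin n → Fin n}

/-! ### Processing a circuit -/

lemma PieceStep.transport {K : List (Fin n × Fin n)} {v : Fin n} {S S₀ : Set (Sym2 (Fin n))}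
    {Z Z₀ A B : Edges n} {two : Prop} {D : Sym2 (Fin n) → ZMod 2}
    (h : PieceStep m K v S Z two A B) (hZ : chi Z = chi Z₀ + D) (hD : Cross m D K)
    (hDS : ∀ e ∈ S, D e = 0) (hDS₀ : ∀ e, D e ≠ 0 → e ∈ S₀) (hS : S ⊆ S₀) :
    PieceStep m K v S₀ Z₀ two A B := by
  obtain ⟨p, q, t, code, x, y, F, K', h, htwo⟩ := h
  refine ⟨p, q, t, code, x, y, D + F, K', ⟨h.nodup, h.eq_switch, ?_, h.star, ?_, h.ends, ?_, hS h.next_mem, ?_⟩,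
    htwo⟩
  · rw [h.chi_eq, hZ]; abel
  · exact (hD.mono (List.subset_append_left _ _)).add h.cross
  · intro e he
    by_cases hDe : D e = 0
    · refine hS (h.supp e fun hF => he ?_)
      rw [Pi.add_apply, hDe, hF, add_zero]
    · exact hDS₀ e hDe
  · rw [Pi.add_apply, hDS _ h.next_mem, h.next_eq, add_zero]

/-- Some step of the processing of a circuit with start vertex `v` and set of edges `S`, which is
started in the graph `Z`, leads from `A` to `B`. The part that is done is cut at `v` at most five
times: at the start of the circuit, at the start and at the end of a loop that waits or has waited,
and at the start and at the end of the current loop. -/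
def CircuitStep (m : Fin n → Fin n → Fin n) (v : Fin n) (S : Set (Sym2 (Fin n))) (Z : Edges n)
    (two : Prop) (A B : Edges n) : Prop :=
  ∃ K : List (Fin n × Fin n), K.map Prod.fst = List.replicate 5 v ∧ PieceStep m K v S Z two A B

lemma edgeSum_Ico_add (x : ℕ → Fin n) {i j k : ℕ} (hij : i ≤ j) (hjk : j ≤ k) :
    edgeSum x (Finset.Ico i j) + edgeSum x (Finset.Ico j k) = edgeSum x (Finset.Ico i k) :=
  Finset.sum_Ico_consecutive _ hij hjk

lemma edgeSum_union (x : ℕ → Fin n) {i j : ℕ} (s : ℕ) (hij : i ≤ j) :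
    edgeSum x (Finset.Ico 0 i ∪ Finset.Ico j s) =
      edgeSum x (Finset.Ico 0 i) + edgeSum x (Finset.Ico j s) := by
  refine Finset.sum_union ?_
  rw [Finset.disjoint_left]
  intro k hk hk'
  rw [Finset.mem_Ico] at hk hk'
  omega

lemma Circuit.loop {E : Edges n} (hE : Paired m E) {w : ℕ → Fin n} {L : ℕ} (hC : Circuit m E w L)
    {a : List (Fin n)} {s : ℕ} (ha : ∀ i ≤ a.length + 1, walkFun (w 0) a i = w (s + i))
    (hv : w 0 ∉ a) (hs : s + a.length + 1 ≤ L) : Loop m (walkFun (w 0) a) (a.length + 1) where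
  inj := by
    intro i hi j hj hij
    rw [Set.mem_Iio] at hi hj
    unfold edgeAt at hij
    rw [ha i (by omega), ha j (by omega), ha (i + 1) (by omega), ha (j + 1) (by omega)] at hij
    have := hC.inj (Set.mem_Iio.2 (by omega : s + i < L)) (Set.mem_Iio.2 (by omega : s + j < L)) hij
    omega
  noloop i hi := by
    rw [ha i (by omega), ha (i + 1) (by omega)]
    intro h
    have h1 := hC.mem (s + i)
    unfold edgeAt at h1
    rw [h] at h1
    exact hE.loopless _ h1
  closed := by rw [walkFun_of_le (by omega)]; rfl
  ne i h1 h2 := by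
    obtain ⟨i, rfl⟩ : ∃ j, i = j + 1 := ⟨i - 1, by omega⟩
    rw [walkFun_succ (by omega)]
    intro h
    apply hv
    have : a[i] = w 0 := h
    rw [← this]
    exact List.getElem_mem _
  follow k h1 h2 := by
    rw [ha k (by omega), ha (k + 1) (by omega), ha (k - 1) (by omega)]
    obtain ⟨k, rfl⟩ : ∃ j, k = j + 1 := ⟨k - 1, by omega⟩
    exact hC.follow (s + k)

lemma edgeSum_walkFun {w : ℕ → Fin n} {a : List (Fin n)} {s : ℕ}
    (ha : ∀ i ≤ a.length + 1, walkFun (w 0) a i = w (s + i)) :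
    edgeSum (walkFun (w 0) a) (Finset.range (a.length + 1)) =
      edgeSum w (Finset.Ico s (s + a.length + 1)) := by
  unfold edgeSum
  rw [Finset.sum_Ico_eq_sum_range, show s + a.length + 1 - s = a.length + 1 by omega]
  refine Finset.sum_congr rfl fun i hi => ?_
  rw [Finset.mem_range] at hi
  rw [ha i (by omega), ha (i + 1) (by omega)]
  rfl

lemma image_edgeAt_walkFun {w : ℕ → Fin n} {a : List (Fin n)} {s : ℕ}
    (ha : ∀ i ≤ a.length + 1, walkFun (w 0) a i = w (s + i)) :
    edgeAt (walkFun (w 0) a) '' Set.Iio (a.length + 1) =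
      edgeAt w '' Set.Ico s (s + a.length + 1) := by
  have key : ∀ i < a.length + 1, edgeAt (walkFun (w 0) a) i = edgeAt w (s + i) := fun i hi => by
    unfold edgeAt
    rw [ha i (by omega), ha (i + 1) (by omega)]
    rfl
  ext e
  constructor
  · rintro ⟨i, hi, rfl⟩
    rw [Set.mem_Iio] at hi
    exact ⟨s + i, ⟨by omega, by omega⟩, (key i hi).symm⟩
  · rintro ⟨i, ⟨h1, h2⟩, rfl⟩
    refine ⟨i - s, Set.mem_Iio.2 (by omega), ?_⟩
    rw [key _ (by omega), Nat.add_sub_cancel' h1]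

/-- Blue and red edges alternate along a circuit. -/
lemma Circuit.alternating {E : Edges n} {w : ℕ → Fin n} {L : ℕ} (hC : Circuit m E w L)
    {Z : Edges n} (hcol : ∀ v e, s(v, e) ∈ E → (s(v, m v e) ∈ Z ↔ s(v, e) ∉ Z)) (i : ℕ) :
    edgeAt w i ∈ Z ↔ (Even i ↔ edgeAt w 0 ∈ Z) := by
  induction i with
  | zero => simp
  | succ i ih =>
    have h1 : edgeAt w (i + 1) ∈ Z ↔ edgeAt w i ∉ Z := by
      have := hcol (w (i + 1)) (w i) (by rw [Sym2.eq_swap]; exact hC.mem i)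
      rw [← hC.follow, Sym2.eq_swap (a := w (i + 1)) (b := w i)] at this
      exact this
    rw [h1, ih, Nat.even_add_one]
    tauto

lemma Circuit.even {E : Edges n} {w : ℕ → Fin n} {L : ℕ} (hC : Circuit m E w L)
    {Z : Edges n} (hcol : ∀ v e, s(v, e) ∈ E → (s(v, m v e) ∈ Z ↔ s(v, e) ∉ Z)) : Even L := by
  have h := hC.alternating hcol L
  have h1 : edgeAt w L = edgeAt w 0 := by
    unfold edgeAt
    rw [show L = 0 + L by omega, hC.period, show 0 + L + 1 = 1 + L by omega, hC.period]
  rw [h1] at h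
  tauto

lemma Circuit.corners {E : Edges n} {w : ℕ → Fin n} {L : ℕ}
    (hC : Circuit m E w L) {K : List (Fin n × Fin n)} {v : Fin n} {k : ℕ} (hk : w k = v)
    (hK : (v, w (k + 1)) ∈ K) :
    Corner m K v (w (k + 1)) ∧ (1 ≤ k → Corner m K v (w (k - 1))) := by
  refine ⟨Or.inl hK, fun h1 => Or.inr ?_⟩
  obtain ⟨k, rfl⟩ : ∃ j, k = j + 1 := ⟨k - 1, by omega⟩
  rw [Nat.add_sub_cancel, ← hk, ← hC.follow, hk]
  exact hK

section
variable {E : Edges n} {w : ℕ → Fin n} {L : ℕ} {Z₀ : Edges n} {two : Prop}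

/-- The keys of the corners at the start vertex of a circuit at which the part that is done is
cut. -/
def cutKeys (w : ℕ → Fin n) (i j s s' : ℕ) : List (Fin n × Fin n) :=
  [(w 0, w (0 + 1)), (w 0, w (i + 1)), (w 0, w (j + 1)), (w 0, w (s + 1)), (w 0, w (s' + 1))]

/-- The part of a circuit that is done consists of the edges before time `i` and of those between the
times `j` and `s`: a loop that waits occupies the times between `i` and `j`. -/
lemma Circuit.cross_done (hm : ∀ v, Function.Involutive (m v)) (hC : Circuit m E w L)
    {i j s s' : ℕ} (hij : i ≤ j) (hjs : j ≤ s) (hsL : s ≤ L) (hi : w i = w 0)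
    (hj : w j = w 0) (hs : w s = w 0) :
    Cross m (edgeSum w (Finset.Ico 0 i ∪ Finset.Ico j s)) (cutKeys w i j s s') := by
  have mem : ∀ k, k ∈ Finset.Ico 0 i ∪ Finset.Ico j s ↔ k < i ∨ (j ≤ k ∧ k < s) := fun k => by
    simp [Finset.mem_union, Finset.mem_Ico]
  refine cross_edgeSum hm hC.inj (fun k hk => ?_) (fun k hk => ?_) (fun k hk => ?_)
  · rw [mem] at hk; omega
  · rw [mem] at hk
    by_cases h0 : k = 0
    · subst h0
      exact Or.inr (hC.corners rfl (by simp [cutKeys])).1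
    by_cases hkj : k = j
    · subst hkj
      rw [hj]
      exact Or.inr (hC.corners hj (by simp [cutKeys])).1
    left
    refine ⟨by omega, ?_, ?_⟩
    · rw [mem]; omega
    · obtain ⟨k, rfl⟩ : ∃ j, k = j + 1 := ⟨k - 1, by omega⟩
      exact hC.follow k
  · rw [mem] at hk
    by_cases hki : k + 1 = i
    · right
      have := (hC.corners hi (K := cutKeys w i j s s') (by simp [cutKeys])).2 (by omega)
      rw [← hki, Nat.add_sub_cancel] at this
      rwa [hki, hi, ← hki]
    by_cases hks : k + 1 = s
    · right
      have := (hC.corners hs (K := cutKeys w i j s s') (by simp [cutKeys])).2 (by omega)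
      rw [← hks, Nat.add_sub_cancel] at this
      rwa [hks, hs, ← hks]
    left
    exact ⟨by rw [mem]; omega, hC.follow k⟩

/-- Outside the part that is done, the edges of a circuit have kept their colours. -/
lemma Circuit.mem_iff (hC : Circuit m E w L)
    (hcol : ∀ v e, s(v, e) ∈ E → (s(v, m v e) ∈ Z₀ ↔ s(v, e) ∉ Z₀)) {Z : Edges n} {i j s : ℕ}
    (hij : i ≤ j) (hjs : j ≤ s) (hsL : s ≤ L)
    (hZ : chi Z = chi Z₀ + edgeSum w (Finset.Ico 0 i ∪ Finset.Ico j s)) {k : ℕ} (hk : k < L)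
    (hk' : (i ≤ k ∧ k < j) ∨ s ≤ k) : edgeAt w k ∈ Z ↔ (Even k ↔ edgeAt w 0 ∈ Z₀) := by
  rw [← hC.alternating hcol k]
  refine mem_iff_of_chi ?_
  rw [hZ, Pi.add_apply, edgeSum_apply_edgeAt hC.inj (fun l hl => ?_) hk, if_neg, add_zero]
  · simp only [Finset.mem_union, Finset.mem_Ico]; omega
  · simp only [Finset.mem_union, Finset.mem_Ico] at hl; omega

lemma Circuit.done_zero (hC : Circuit m E w L) {i j s : ℕ} (hjs : j ≤ s) (hsL : s ≤ L)
    (hij : i ≤ j) : (∀ e ∈ edgeAt w '' {k | k < L ∧ ((i ≤ k ∧ k < j) ∨ s ≤ k)},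
      edgeSum w (Finset.Ico 0 i ∪ Finset.Ico j s) e = 0) ∧
    (∀ e, edgeSum w (Finset.Ico 0 i ∪ Finset.Ico j s) e ≠ 0 → e ∈ edgeAt w '' Set.Iio L) := by
  constructor
  · rintro e ⟨k, ⟨hk1, hk2⟩, rfl⟩
    rw [edgeSum_apply_edgeAt hC.inj (fun l hl => ?_) hk1, if_neg]
    · simp only [Finset.mem_union, Finset.mem_Ico]; omega
    · simp only [Finset.mem_union, Finset.mem_Ico] at hl; omega
  · intro e he
    obtain ⟨k, hk, rfl⟩ := edgeSum_ne_zero he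
    refine ⟨k, ?_, rfl⟩
    simp only [Finset.mem_union, Finset.mem_Ico] at hk
    rw [Set.mem_Iio]
    omega

set_option maxHeartbeats 400000 in
/-- The processing of what is left of a circuit, when no loop waits and when a loop waits. -/
lemma Circuit.spec_pieces (hm : ∀ v, Function.Involutive (m v)) (hE : Paired m E)
    (hC : Circuit m E w L) (hcol : ∀ v e, s(v, e) ∈ E → (s(v, m v e) ∈ Z₀ ↔ s(v, e) ∉ Z₀))
    (htwo : ∀ v u u', u ≠ u' → s(v, u) ∈ E → s(v, u') ∈ E → (s(v, u) ∈ Z₀ ↔ s(v, u') ∈ Z₀) → two)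
    (ls : List (List (Fin n))) :
    ∀ s, s ≤ L → w s = w 0 → Blocks w (w 0) L s ls →
      (Even s → ∀ Z, chi Z = chi Z₀ + edgeSum w (Finset.Ico 0 s) →
        Spec (seqAll ((pieces (w 0) none ls).map Piece.process)) Z (edgeSum w (Finset.Ico s L))
          (CircuitStep m (w 0) (edgeAt w '' Set.Iio L) Z₀ two)) ∧
      (∀ a i, (∀ k ≤ a.length + 1, walkFun (w 0) a k = w (i + k)) → w 0 ∉ a →
        i + a.length + 1 ≤ s → Even a.length → Even i → ¬ Even s →
        ∀ Z, chi Z = chi Z₀ + edgeSum w (Finset.Ico 0 i ∪ Finset.Ico (i + a.length + 1) s) →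
        Spec (seqAll ((pieces (w 0) (some a) ls).map Piece.process)) Z
          (edgeSum w (Finset.Ico i (i + a.length + 1)) + edgeSum w (Finset.Ico s L))
          (CircuitStep m (w 0) (edgeAt w '' Set.Iio L) Z₀ two)) := by
  have hL := hC.even hcol
  induction ls with
  | nil =>
    intro s hs _ hb
    have hb : s = L := hb
    subst hb
    refine ⟨fun _ Z _ => ?_, fun a i _ _ _ _ _ h => absurd hL h⟩
    refine (Spec.nil Z _).congr ?_
    simp [edgeSum]
  | cons b ls ih =>
    rintro s hsL hws ⟨hb, hvb, hbL, hB⟩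
    set s' := s + b.length + 1 with hs'
    have hws' : w s' = w 0 := by
      have := hb (b.length + 1) le_rfl
      rw [walkFun_of_le (by omega)] at this
      rw [this]; rfl
    have ih := ih s' hbL hws' hB
    have lB := hC.loop hE hb hvb hbL
    have b1 : walkFun (w 0) b 1 = w (s + 1) := hb 1 (by omega)
    have b2 : walkFun (w 0) b b.length = w (s' - 1) := by rw [hb _ (by omega)]; rfl
    have eb1 : s(w 0, w (s + 1)) = edgeAt w s := by rw [← hws]; rfl
    have eb2 : s(w 0, w (s' - 1)) = edgeAt w (s + b.length) := by
      rw [← hws', Sym2.eq_swap]; rfl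
    have sB := edgeSum_walkFun hb
    have iB := image_edgeAt_walkFun hb
    rw [← hs'] at sB iB
    have hsplit : edgeSum w (Finset.Ico s s') + edgeSum w (Finset.Ico s' L) =
        edgeSum w (Finset.Ico s L) := edgeSum_Ico_add w (by omega) hbL
    have hIB : edgeAt w '' Set.Ico s s' ⊆ edgeAt w '' Set.Iio L :=
      Set.image_mono fun k hk => by rw [Set.mem_Ico] at hk; rw [Set.mem_Iio]; omega
    -- the processing of the current loop, when it is a 1-circuit
    have one : Odd b.length → ∀ i j Z, i ≤ j → j ≤ s → w i = w 0 → w j = w 0 →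
        chi Z = chi Z₀ + edgeSum w (Finset.Ico 0 i ∪ Finset.Ico j s) →
        Spec (processOne (w 0) b) Z (edgeSum w (Finset.Ico s s'))
          (CircuitStep m (w 0) (edgeAt w '' Set.Iio L) Z₀ two) := by
      intro hodd i j Z hij hjs hi hj hZ
      have c1 := hC.corners hws (K := cutKeys w i j s s') (by simp [cutKeys])
      have c2 := hC.corners hws' (K := cutKeys w i j s s') (by simp [cutKeys])
      have hspec := spec_process_one (K := cutKeys w i j s s') (Z := Z) hm lB hodd
        (by rw [b1]; exact c1.1) (by rw [b2]; exact c2.2 (by omega)) (by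
          rw [b1, b2, eb1, eb2, hC.mem_iff hcol hij hjs hsL hZ (by omega) (Or.inr le_rfl),
            hC.mem_iff hcol hij hjs hsL hZ (by omega) (Or.inr (by omega)), Nat.even_add]
          rw [← Nat.not_even_iff_odd] at hodd
          tauto) two
      rw [sB, iB] at hspec
      refine hspec.mono fun A B h => ⟨cutKeys w i j s s', rfl, h.transport hZ
        (hC.cross_done hm hij hjs hsL hi hj hws) ?_ (hC.done_zero hjs hsL hij).2 hIB⟩
      rintro e ⟨k, hk, rfl⟩
      rw [Set.mem_Ico] at hk
      exact (hC.done_zero hjs hsL hij).1 _ ⟨k, ⟨by omega, Or.inr hk.1⟩, rfl⟩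
    constructor
    · intro hs Z hZ
      have hZ' : chi Z = chi Z₀ + edgeSum w (Finset.Ico 0 s ∪ Finset.Ico s s) := by
        rw [hZ, Finset.Ico_self, Finset.union_empty]
      by_cases hodd : Odd b.length
      · simp only [pieces, if_pos hodd]
        refine ((one hodd s s Z le_rfl le_rfl hws hws hZ').seq fun Z' h' => ih.1 ?_ Z' ?_).congr
          hsplit
        · rw [hs', add_assoc, Nat.even_add]
          exact iff_of_true hs (hodd.add_odd odd_one)
        · rw [h', hZ, add_assoc, edgeSum_Ico_add w (Nat.zero_le _) (by omega)]
      · simp only [pieces, if_neg hodd]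
        rw [Nat.not_odd_iff_even] at hodd
        refine (ih.2 b s hb hvb le_rfl hodd hs ?_ Z ?_).congr hsplit
        · rw [hs', Nat.even_add_one, not_not, Nat.even_add]
          exact iff_of_true hs hodd
        · rw [hZ, ← hs', Finset.Ico_self, Finset.union_empty]
    · intro a i ha hva has haE hiE hsO Z hZ
      set j := i + a.length + 1 with hj
      have hij : i ≤ j := by omega
      have hwj : w j = w 0 := by
        have := ha (a.length + 1) le_rfl
        rw [walkFun_of_le (by omega)] at this
        rw [this]; rfl
      have hwi : w i = w 0 := (ha 0 (by omega)).symm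
      by_cases hodd : Odd b.length
      · simp only [pieces, if_pos hodd]
        refine ((one hodd i j Z hij has hwi hwj hZ).seq fun Z' h' =>
          ih.2 a i ha hva (by omega) haE hiE ?_ Z' ?_).congr ?_
        · rw [hs', add_assoc, Nat.even_add]
          have : Even (b.length + 1) := hodd.add_odd odd_one
          tauto
        · rw [h', hZ, ← hj, edgeSum_union w _ hij, edgeSum_union w _ hij,
            ← edgeSum_Ico_add w has (show s ≤ s' by omega)]
          abel
        · rw [← hsplit]; abel
      · simp only [pieces, if_neg hodd]
        rw [Nat.not_odd_iff_even] at hodd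
        have lA := hC.loop hE ha hva (by omega)
        have a1 : walkFun (w 0) a 1 = w (i + 1) := ha 1 (by omega)
        have a2 : walkFun (w 0) a a.length = w (j - 1) := by rw [ha _ (by omega)]; rfl
        have ea1 : s(w 0, w (i + 1)) = edgeAt w i := by rw [← hwi]; rfl
        have ea2 : s(w 0, w (j - 1)) = edgeAt w (i + a.length) := by
          rw [← hwj, Sym2.eq_swap]; rfl
        have sA := edgeSum_walkFun ha
        have iA := image_edgeAt_walkFun ha
        rw [← hj] at sA iA
        have ha3 := lA.two_le haE
        have c1 := hC.corners hwi (K := cutKeys w i j s s') (by simp [cutKeys])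
        have c2 := hC.corners hwj (K := cutKeys w i j s s') (by simp [cutKeys])
        have c3 := hC.corners hws (K := cutKeys w i j s s') (by simp [cutKeys])
        have c4 := hC.corners hws' (K := cutKeys w i j s s') (by simp [cutKeys])
        have htw : two := by
          refine htwo (w 0) (w (i + 1)) (w (j - 1)) ?_ ?_ ?_ ?_
          · intro h
            have h1 : edgeAt w i = edgeAt w (i + a.length) := by rw [← ea1, ← ea2, h]
            have := hC.inj (Set.mem_Iio.2 (by omega)) (Set.mem_Iio.2 (by omega)) h1
            omega
          · rw [ea1]; exact hC.mem _
          · rw [ea2]; exact hC.mem _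
          · rw [ea1, ea2, hC.alternating hcol, hC.alternating hcol (i + a.length), Nat.even_add]
            simp [hiE, haE]
        have mi := fun k h1 h2 => hC.mem_iff hcol (k := k) hij has hsL hZ h1 h2
        have hspec := spec_processTwo (K := cutKeys w i j s s') (Z := Z) (two := two) hm lA lB haE
          hodd (by
            rw [iA, iB]
            refine disjoint_image_edgeAt hC.inj ?_ ?_ ?_
            · intro k hk; rw [Set.mem_Ico] at hk; rw [Set.mem_Iio]; omega
            · intro k hk; rw [Set.mem_Ico] at hk; rw [Set.mem_Iio]; omega
            · rw [Set.disjoint_left]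
              intro k hk hk'
              rw [Set.mem_Ico] at hk hk'
              omega)
          (by rw [a1]; exact c1.1) (by rw [a2]; exact c2.2 (by omega))
          (by rw [b1]; exact c3.1) (by rw [b2]; exact c4.2 (by omega))
          (by
            rw [a1, a2, ea1, ea2, mi i (by omega) (Or.inl ⟨le_rfl, by omega⟩),
              mi (i + a.length) (by omega) (Or.inl ⟨by omega, by omega⟩), Nat.even_add]
            simp [hiE, haE])
          (by
            rw [b1, b2, eb1, eb2, mi s (by omega) (Or.inr le_rfl),
              mi (s + b.length) (by omega) (Or.inr (by omega)), Nat.even_add]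
            simp [hsO, hodd])
          (by
            rw [a1, b1, ea1, eb1, mi i (by omega) (Or.inl ⟨le_rfl, by omega⟩),
              mi s (by omega) (Or.inr le_rfl)]
            simp [hiE, hsO]) htw
        rw [sA, sB, iA, iB] at hspec
        have hdone : ∀ e ∈ edgeAt w '' Set.Ico i j ∪ edgeAt w '' Set.Ico s s',
            edgeSum w (Finset.Ico 0 i ∪ Finset.Ico j s) e = 0 := by
          rintro e (⟨k, hk, rfl⟩ | ⟨k, hk, rfl⟩) <;> rw [Set.mem_Ico] at hk
          · exact (hC.done_zero has hsL hij).1 _ ⟨k, ⟨by omega, Or.inl hk⟩, rfl⟩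
          · exact (hC.done_zero has hsL hij).1 _ ⟨k, ⟨by omega, Or.inr hk.1⟩, rfl⟩
        have hsub : edgeAt w '' Set.Ico i j ∪ edgeAt w '' Set.Ico s s' ⊆ edgeAt w '' Set.Iio L := by
          refine Set.union_subset (Set.image_mono fun k hk => ?_) hIB
          rw [Set.mem_Ico] at hk; rw [Set.mem_Iio]; omega
        have hspec' := hspec.mono (Q := CircuitStep m (w 0) (edgeAt w '' Set.Iio L) Z₀ two)
          fun A B h => ⟨cutKeys w i j s s', rfl, h.transport hZ
            (hC.cross_done hm hij has hsL hwi hwj hws) hdone (hC.done_zero has hsL hij).2 hsub⟩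
        refine (hspec'.seq fun Z' h' => ih.1 ?_ Z' ?_).congr ?_
        · rw [hs', Nat.even_add_one, Nat.even_add]
          simp [hsO, hodd]
        · rw [h', hZ, edgeSum_union w _ hij,
            ← edgeSum_Ico_add w (Nat.zero_le s) (show s ≤ s' by omega),
            ← edgeSum_Ico_add w (Nat.zero_le j) has, ← edgeSum_Ico_add w (Nat.zero_le i) hij]
          abel
        · rw [← hsplit]; abel

/-- The processing of a circuit. Since blue and red edges alternate, a circuit that is cut into a
2-circuit has two edges of the same colour at its start vertex; `two` holds in this case. -/
lemma Circuit.spec (hm : ∀ v, Function.Involutive (m v)) (hE : Paired m E)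
    (hC : Circuit m E w L) (hcol : ∀ v e, s(v, e) ∈ E → (s(v, m v e) ∈ Z₀ ↔ s(v, e) ∉ Z₀))
    (htwo : ∀ v u u', u ≠ u' → s(v, u) ∈ E → s(v, u') ∈ E → (s(v, u) ∈ Z₀ ↔ s(v, u') ∈ Z₀) → two) :
    Spec (seqAll ((circuitPieces ((List.range L).map w)).map Piece.process)) Z₀
      (chi (walkEdges ((List.range L).map w)))
      (CircuitStep m (w 0) (walkEdges ((List.range L).map w)) Z₀ two) := by
  obtain ⟨t, h1, h2, h3⟩ := hC.exists_walkFun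
  have hL : w L = w 0 := by
    have := hC.period 0
    rwa [zero_add] at this
  have hB : Blocks w (w 0) L 0 (t.splitOn (w 0)) := by
    refine blocks_splitOn_zero rfl hL t (by omega) fun i hi => ?_
    have := h3 (i + 1) (by omega)
    rw [walkFun_succ hi] at this
    rw [this, add_comm]
  have key := (hC.spec_pieces hm hE hcol htwo _ 0 (Nat.zero_le _) rfl hB).1 Even.zero Z₀
    (by simp [edgeSum])
  have hS : edgeAt w '' Set.Iio L = (walkEdges ((List.range L).map w) : Set (Sym2 (Fin n))) := by
    ext e
    rw [Finset.mem_coe, hC.mem_walkEdges]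
    rfl
  rw [hS] at key
  have hp : circuitPieces ((List.range L).map w) = pieces (w 0) none (t.splitOn (w 0)) := by
    rw [h1]; rfl
  rw [hp]
  refine key.congr ?_
  funext e
  by_cases he : e ∈ walkEdges ((List.range L).map w)
  · obtain ⟨i, hi, rfl⟩ := hC.mem_walkEdges.1 he
    rw [edgeSum_apply_edgeAt hC.inj (fun k hk => (Finset.mem_Ico.1 hk).2) hi, chi_eq_one.2 he,
      if_pos (Finset.mem_Ico.2 ⟨Nat.zero_le _, hi⟩)]
  · rw [chi_eq_zero.2 he, edgeSum_apply_of_notMem]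
    intro i hi h
    exact he (hC.mem_walkEdges.2 ⟨i, (Finset.mem_Ico.1 hi).2, h⟩)

end

end

section
variable {n : ℕ} {m : Fin n → Fin n → Fin n}

/-! ### Processing all circuits -/

/-- A step from `A` to `B` of the processing of the circuits `l`, which is started in the graph `Z`,
for the pairing `m`: the switch on the 4-cycle `vpqt`. The graph `A` arises from `Z` by exchanging
the edges of `F`, and the chords that `code`, `x` and `y` describe. The edges of the circuits before
the `k`-th one are in `F`, those of later ones are not. -/
structure PathData (m : Fin n → Fin n → Fin n) (l : List (List (Fin n))) (Z A B : Edges n)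
    (v p q t : Fin n) (code : Option (Fin n × Fin n)) (x y : Fin n) (F : Sym2 (Fin n) → ZMod 2)
    (K : List (Fin n × Fin n)) (k : ℕ) : Prop where
  nodup : [v, p, q, t].Nodup
  eq_switch : B = symmDiff A {s(v, p), s(p, q), s(q, t), s(t, v)}
  chi_eq : chi A = chi Z + (F + starSum v t code + shortSum x y)
  star : StarOK A v t code
  cross : Cross m F K
  ends : (K.map Prod.fst).Subperm (List.replicate 5 v ++ (starEnds t code ++ [x, y]))
  supp : ∀ e, F e ≠ 0 → ∃ c ∈ l, e ∈ walkEdges c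
  before : ∀ i (h : i < l.length), i < k → ∀ e ∈ walkEdges l[i], F e = 1
  after : ∀ i (h : i < l.length), k < i → ∀ e ∈ walkEdges l[i], F e = 0
  next_mem : ∃ h : k < l.length,
    (if s(p, q) = s(x, y) then s(q, t) else s(p, q)) ∈ walkEdges l[k]
  next_eq : F (if s(p, q) = s(x, y) then s(q, t) else s(p, q)) = 0

/-- Some step of the processing of the circuits `l` leads from `A` to `B`. -/
def PathStep (m : Fin n → Fin n → Fin n) (l : List (List (Fin n))) (Z : Edges n) (two : Prop)
    (A B : Edges n) : Prop :=
  ∃ v p q t code x y F K k, PathData m l Z A B v p q t code x y F K k ∧ ((x = v ∧ y = v) ∨ two)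

lemma seq_assoc (f g h : Segment n) : seq (seq f g) h = seq f (seq g h) := by
  funext Z
  simp only [seq, List.append_assoc]
  congr 3
  simp only [List.getLastD_eq_getLast?, List.getLast?_append]
  cases (g ((f Z).getLast?.getD Z)).getLast? <;> simp

lemma seqAll_append (l l' : List (Segment n)) : seqAll (l ++ l') = seq (seqAll l) (seqAll l') := by
  induction l with
  | nil => funext Z; simp [seqAll, seq]
  | cons f l ih =>
    change seq f (seqAll (l ++ l')) = seq (seq f (seqAll l)) (seqAll l')
    rw [ih, seq_assoc]

lemma Paired.mem_iff (hm : ∀ v, Function.Involutive (m v)) {E : Edges n} (hE : Paired m E)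
    (v e : Fin n) : s(v, m v e) ∈ E ↔ s(v, e) ∈ E := by
  refine ⟨fun h => ?_, hE.mate_mem v e⟩
  have := hE.mate_mem v _ h
  rwa [hm v e] at this

lemma chi_sdiff_add {H E : Edges n} (h : E ⊆ H) : chi (H \ E) + chi E = chi H := by
  funext e
  by_cases h1 : e ∈ E
  · rw [Pi.add_apply, chi_eq_one.2 h1, chi_eq_one.2 (h h1),
      chi_eq_zero.2 (fun h2 => (Finset.mem_sdiff.1 h2).2 h1), zero_add]
  · by_cases h2 : e ∈ H
    · rw [Pi.add_apply, chi_eq_zero.2 h1, chi_eq_one.2 h2,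
        chi_eq_one.2 (Finset.mem_sdiff.2 ⟨h2, h1⟩), add_zero]
    · rw [Pi.add_apply, chi_eq_zero.2 h1, chi_eq_zero.2 h2,
        chi_eq_zero.2 (fun h3 => h2 (Finset.mem_sdiff.1 h3).1), add_zero]

/-- The processing of the circuits `l`, when the circuits `l₀` are done. -/
lemma CircuitList.spec (hm : ∀ v, Function.Involutive (m v)) {H : Edges n} (hH : Paired m H)
    {Z₀ : Edges n} {two : Prop}
    (hcol : ∀ v e, s(v, e) ∈ H → (s(v, m v e) ∈ Z₀ ↔ s(v, e) ∉ Z₀))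
    (htwo : ∀ v u u', u ≠ u' → s(v, u) ∈ H → s(v, u') ∈ H → (s(v, u) ∈ Z₀ ↔ s(v, u') ∈ Z₀) → two)
    {E : Edges n} {l : List (List (Fin n))} (hl : CircuitList m E l) :
    ∀ l₀ : List (List (Fin n)), Paired m E → E ⊆ H →
      (∀ e, e ∈ H \ E ↔ ∃ c ∈ l₀, e ∈ walkEdges c) →
      ∀ Z, chi Z = chi Z₀ + chi (H \ E) →
        Spec (seqAll ((l.flatMap circuitPieces).map Piece.process)) Z (chi E)
          (PathStep m (l₀ ++ l) Z₀ two) := by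
  induction hl with
  | nil =>
    intro l₀ _ _ _ Z _
    refine (Spec.nil Z _).congr ?_
    funext e
    exact (chi_eq_zero.2 (Finset.notMem_empty e)).symm
  | @cons E w L l hC hl ih =>
    intro l₀ hE hEH hl₀ Z hZ
    set c := (List.range L).map w with hc
    have hZE : ∀ e ∈ E, (e ∈ Z ↔ e ∈ Z₀) := fun e he => mem_iff_of_chi (by
      rw [hZ, Pi.add_apply, chi_eq_zero.2 (fun h => (Finset.mem_sdiff.1 h).2 he), add_zero])
    have hsub : walkEdges c ⊆ E := hC.subset
    have hspec := hC.spec (Z₀ := Z) (two := two) hm hE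
      (fun v e he => by
        rw [hZE _ he, hZE _ (hE.mate_mem v e he)]; exact hcol v e (hEH he))
      (fun v u u' hu h1 h2 h3 => by
        rw [hZE _ h1, hZE _ h2] at h3; exact htwo v u u' hu (hEH h1) (hEH h2) h3)
    have hspec' := hspec.mono (Q := PathStep m (l₀ ++ c :: l) Z₀ two) ?_
    · rw [List.flatMap_cons, List.map_append, seqAll_append]
      refine (hspec'.seq fun Z' h' => ?_).congr ((add_comm _ _).trans (chi_sdiff_add hsub))
      have := ih (l₀ ++ [c]) (hE.sdiff hm hC) (Finset.sdiff_subset.trans hEH) (fun e => ?_) Z' ?_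
      · rwa [List.append_assoc, List.singleton_append] at this
      · have := hl₀ e
        simp only [Finset.mem_sdiff, List.mem_append, List.mem_singleton, or_and_right, exists_or,
          exists_eq_left] at this ⊢
        rw [← this]
        constructor
        · rintro ⟨h1, h2⟩
          by_cases h3 : e ∈ walkEdges c
          · exact Or.inr h3
          · exact Or.inl ⟨h1, fun h4 => h2 ⟨h4, h3⟩⟩
        · rintro (⟨h1, h2⟩ | h3)
          · exact ⟨h1, fun h4 => h2 h4.1⟩
          · exact ⟨hEH (hsub h3), fun h4 => h4.2 h3⟩
      · rw [h', hZ, add_assoc]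
        congr 1
        have h1 := chi_sdiff_add hEH
        have h2 := chi_sdiff_add (Finset.sdiff_subset.trans hEH : E \ walkEdges c ⊆ H)
        have h3 := chi_sdiff_add hsub
        have h4 := fun_add_self (chi (E \ walkEdges c))
        rw [← h2, ← h3] at h1
        have := congrArg (· + chi (E \ walkEdges c)) h1
        simp only [add_assoc, h4, add_zero] at this
        rw [← this]
        rw [add_comm (chi (E \ walkEdges c)) (chi (walkEdges c) + _), add_assoc, h4, add_zero]
    · rintro A B ⟨K, hK, p, q, t, code, x, y, F, K', h, htw⟩
      have hF : ∀ e, F e ≠ 0 → e ∈ E := fun e he => hsub (h.supp e he)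
      have hF0 : ∀ e, e ∉ walkEdges c → F e = 0 := fun e he => by
        by_contra hcon; exact he (h.supp e hcon)
      have hD0 : ∀ e ∈ E, chi (H \ E) e = 0 := fun e he =>
        chi_eq_zero.2 fun h => (Finset.mem_sdiff.1 h).2 he
      refine ⟨w 0, p, q, t, code, x, y, chi (H \ E) + F, K ++ K', l₀.length,
        ⟨h.nodup, h.eq_switch, ?_, h.star, ?_, ?_, ?_, ?_, ?_, ⟨by simp, ?_⟩, ?_⟩, htw⟩
      · rw [h.chi_eq, hZ]; abel
      · refine Cross.add (fun v e hne => absurd ?_ hne) h.cross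
        have : s(v, e) ∈ H \ E ↔ s(v, m v e) ∈ H \ E := by
          rw [Finset.mem_sdiff, Finset.mem_sdiff, hH.mem_iff hm, hE.mem_iff hm]
        by_cases h1 : s(v, e) ∈ H \ E
        · rw [chi_eq_one.2 h1, chi_eq_one.2 (this.1 h1)]
        · rw [chi_eq_zero.2 h1, chi_eq_zero.2 (fun h2 => h1 (this.2 h2))]
      · rw [List.map_append, hK]
        exact (List.Subperm.refl _).append h.ends
      · intro e he
        by_cases h1 : e ∈ H \ E
        · obtain ⟨c', h2, h3⟩ := (hl₀ e).1 h1
          exact ⟨c', List.mem_append_left _ h2, h3⟩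
        · rw [Pi.add_apply, chi_eq_zero.2 h1, zero_add] at he
          exact ⟨c, by simp, h.supp e he⟩
      · intro i hi hk e he
        rw [List.getElem_append_left hk] at he
        have h1 : e ∈ H \ E := (hl₀ e).2 ⟨_, List.getElem_mem _, he⟩
        rw [Pi.add_apply, chi_eq_one.2 h1, hF0 e, add_zero]
        exact fun h2 => (Finset.mem_sdiff.1 h1).2 (hsub h2)
      · intro i hi hk e he
        obtain ⟨r, hr⟩ : ∃ r, i = l₀.length + (r + 1) := ⟨i - l₀.length - 1, by omega⟩
        have hr' : r < l.length := by
          rw [List.length_append, List.length_cons] at hi; omega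
        have hg : (l₀ ++ c :: l)[i] = l[r] := by
          subst hr
          rw [List.getElem_append_right (by omega)]
          simp
        rw [hg] at he
        have h1 := hl.subset _ (List.getElem_mem hr') he
        rw [Finset.mem_sdiff] at h1
        rw [Pi.add_apply, hD0 e h1.1, hF0 e h1.2, add_zero]
      · have hg : (l₀ ++ c :: l)[l₀.length]'(by simp) = c := by
          rw [List.getElem_append_right le_rfl]; simp
        rw [hg]
        exact h.next_mem
      · rw [Pi.add_apply, h.next_eq, add_zero]
        exact hD0 _ (hsub h.next_mem)

/-- The canonical path exchanges all edges of `H`, and all of its steps are described by `PathStep`. -/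
lemma spec_processAll (hm : ∀ v, Function.Involutive (m v)) {H : Edges n} (hH : Paired m H)
    {Z₀ : Edges n} {two : Prop}
    (hcol : ∀ v e, s(v, e) ∈ H → (s(v, m v e) ∈ Z₀ ↔ s(v, e) ∉ Z₀))
    (htwo : ∀ v u u', u ≠ u' → s(v, u) ∈ H → s(v, u') ∈ H →
      (s(v, u) ∈ Z₀ ↔ s(v, u') ∈ Z₀) → two) :
    Spec (processAll m H) Z₀ (chi H) (PathStep m (circuits m H.card H) Z₀ two) := by
  have h := (circuitList_circuits hm H.card H hH le_rfl).spec hm hH hcol htwo [] hH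
    (Finset.Subset.refl H) (by simp) Z₀ (by
      rw [Finset.sdiff_self]
      funext e
      rw [Pi.add_apply, chi_eq_zero.2 (Finset.notMem_empty e), add_zero])
  exact h

end

section

/-! ### Counting pairings with few monochromatic pairs -/

open Classical in
/-- The involutions that move exactly the elements of `S`, at most `2 * r` of them to an element of
the same colour. -/
noncomputable def involutions {α : Type*} [Fintype α] (κ : α → ZMod 2) (S : Finset α) (r : ℕ) :
    Finset (α → α) :=
  Finset.univ.filter fun f => Function.Involutive f ∧ (∀ a, f a ≠ a ↔ a ∈ S) ∧
    (S.filter fun a => κ a = κ (f a)).card ≤ 2 * r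

variable {α : Type*} [Fintype α]

lemma mem_involutions {κ : α → ZMod 2} {S : Finset α} {r : ℕ} {f : α → α} :
    f ∈ involutions κ S r ↔ Function.Involutive f ∧ (∀ a, f a ≠ a ↔ a ∈ S) ∧
      (S.filter fun a => κ a = κ (f a)).card ≤ 2 * r := by
  classical
  simp only [involutions, Finset.mem_filter, Finset.mem_univ, true_and]

open Classical in
/-- Removing the pair `e, b` from an involution. -/
noncomputable def removePair (e b : α) (f : α → α) : α → α :=
  fun a => if a = e ∨ a = b then a else f a

lemma removePair_injOn {α : Type*} (e b : α) :
    Set.InjOn (removePair e b) {f | Function.Involutive f ∧ f e = b} := by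
  rintro f ⟨hf, hfe⟩ g ⟨hg, hge⟩ h
  funext a
  by_cases h1 : a = e
  · rw [h1, hfe, hge]
  by_cases h2 : a = b
  · have hf' := hf e
    have hg' := hg e
    rw [hfe] at hf'
    rw [hge] at hg'
    rw [h2, hf', hg']
  · have := congrFun h a
    simpa [removePair, h1, h2] using this

open Classical in
lemma removePair_mem {κ : α → ZMod 2} {S : Finset α} {r r' : ℕ} {e b : α} (he : e ∈ S)
    {f : α → α} (hf : f ∈ involutions κ S r) (hfe : f e = b)
    (hr : κ e ≠ κ b ∧ r' = r ∨ κ e = κ b ∧ r' + 1 = r) :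
    removePair e b f ∈ involutions κ ((S.erase e).erase b) r' := by
  rw [mem_involutions] at hf ⊢
  obtain ⟨hi, hS, hc⟩ := hf
  have hfb : f b = e := by rw [← hfe]; exact hi e
  have hbe : b ≠ e := by rw [← hfe]; exact (hS e).2 he
  have hb : b ∈ S := (hS b).1 (by rw [hfb]; exact hbe.symm)
  have hoff : ∀ a, a ≠ e → a ≠ b → f a ≠ e ∧ f a ≠ b := fun a h1 h2 =>
    ⟨fun h => h2 (by rw [← hi a, h, hfe]), fun h => h1 (by rw [← hi a, h, hfb])⟩
  have hval : ∀ a, a ≠ e → a ≠ b → removePair e b f a = f a := fun a h1 h2 => by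
    simp [removePair, h1, h2]
  refine ⟨fun a => ?_, fun a => ?_, ?_⟩
  · by_cases h : a = e ∨ a = b
    · simp [removePair, h]
    · rw [not_or] at h
      rw [hval a h.1 h.2, hval _ (hoff a h.1 h.2).1 (hoff a h.1 h.2).2, hi]
  · rw [Finset.mem_erase, Finset.mem_erase, ← hS a]
    by_cases h : a = e ∨ a = b
    · simp only [removePair, if_pos h]; tauto
    · rw [not_or] at h
      rw [hval a h.1 h.2]; tauto
  · have hfil : (((S.erase e).erase b).filter fun a => κ a = κ (removePair e b f a)) =
        ((S.filter fun a => κ a = κ (f a)).erase e).erase b := by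
      ext a
      simp only [Finset.mem_filter, Finset.mem_erase]
      constructor
      · rintro ⟨⟨h1, h2, h3⟩, h4⟩
        rw [hval a h2 h1] at h4
        exact ⟨h1, h2, h3, h4⟩
      · rintro ⟨h1, h2, h3, h4⟩
        rw [hval a h2 h1]
        exact ⟨⟨h1, h2, h3⟩, h4⟩
    rw [hfil]
    rcases hr with ⟨_, rfl⟩ | ⟨h1, h2⟩
    · exact (Finset.card_le_card ((Finset.erase_subset _ _).trans (Finset.erase_subset _ _))).trans
        hc
    · rw [Finset.card_erase_of_mem, Finset.card_erase_of_mem]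
      · omega
      · rw [Finset.mem_filter, hfe]; exact ⟨he, h1⟩
      · rw [Finset.mem_erase, Finset.mem_filter, hfb]
        exact ⟨hbe, hb, h1.symm⟩

/-- The numerical core of the recursion: `g` elements have the colour of the chosen one, which is
the more frequent one, and `y` have the other colour. -/
lemma involutions_bound {θ r g y : ℕ} (hg : 1 ≤ g) (hy : y ≤ θ + 1) (hgy : g + y = 2 * (θ + 1)) :
    y * (max 1 θ ^ (r + 1) * θ.factorial) + (g - 1) * (max 1 θ ^ r * θ.factorial) ≤
      max 1 (θ + 1) ^ (r + 1) * (θ + 1).factorial := by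
  obtain ⟨g, rfl⟩ : ∃ g', g = g' + 1 := ⟨g - 1, by omega⟩
  rw [Nat.add_sub_cancel, Nat.factorial_succ, max_eq_right (by omega : 1 ≤ θ + 1)]
  rcases Nat.eq_zero_or_pos θ with rfl | hθ
  · simp only [Nat.factorial_zero, zero_le, max_eq_left, one_pow, zero_add]
    omega
  rw [max_eq_right hθ]
  have h1 : y * θ + g ≤ (θ + 1) * (θ + 1) := by
    obtain ⟨z, hz⟩ : ∃ z, θ + 1 = y + z := ⟨θ + 1 - y, by omega⟩
    have : g = 2 * θ + 1 - y := by omega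
    nlinarith [Nat.zero_le z, Nat.mul_le_mul (Nat.zero_le z) hθ, mul_nonneg (Nat.zero_le z) (Nat.zero_le θ)]
  calc y * (θ ^ (r + 1) * θ.factorial) + g * (θ ^ r * θ.factorial)
      = (y * θ + g) * θ ^ r * θ.factorial := by ring
    _ ≤ ((θ + 1) * (θ + 1)) * (θ + 1) ^ r * θ.factorial := by gcongr; omega
    _ = (θ + 1) ^ (r + 1) * ((θ + 1) * θ.factorial) := by ring

/-- There are `θ!` ways to match `θ` blue edges with `θ` red ones; each of the `r` monochromatic
pairs that are allowed costs a factor `θ`, at most. -/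
lemma card_involutions_le (κ : α → ZMod 2) (θ : ℕ) : ∀ (S : Finset α) (r : ℕ), S.card = 2 * θ →
    (involutions κ S r).card ≤ max 1 θ ^ r * θ.factorial := by
  classical
  induction θ with
  | zero =>
    intro S r hS
    obtain rfl := Finset.card_eq_zero.1 hS
    simp only [zero_le, max_eq_left, one_pow, Nat.factorial_zero, mul_one]
    refine Finset.card_le_one.2 fun f hf g hg => ?_
    rw [mem_involutions] at hf hg
    funext a
    have h1 := hf.2.1 a
    have h2 := hg.2.1 a
    simp only [Finset.notMem_empty, iff_false, not_not] at h1 h2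
    rw [h1, h2]
  | succ θ ih =>
    intro S r hS
    -- an element of the more frequent colour
    obtain ⟨e, he, hmaj⟩ : ∃ e ∈ S, θ + 1 ≤ (S.filter fun a => κ e = κ a).card := by
      by_contra! hcon
      have hsum := Finset.card_filter_add_card_filter_not (s := S) (fun a => κ a = 0)
      have h0 : (S.filter fun a => κ a = 0).card < θ + 1 := by
        rcases (S.filter fun a => κ a = 0).eq_empty_or_nonempty with h | ⟨e, he⟩
        · rw [h]; simp
        · rw [Finset.mem_filter] at he
          refine lt_of_le_of_lt (Finset.card_le_card ?_) (hcon e he.1)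
          intro a ha
          rw [Finset.mem_filter] at ha ⊢
          exact ⟨ha.1, by rw [he.2, ha.2]⟩
      have h1 : (S.filter fun a => ¬ κ a = 0).card < θ + 1 := by
        rcases (S.filter fun a => ¬ κ a = 0).eq_empty_or_nonempty with h | ⟨e, he⟩
        · rw [h]; simp
        · rw [Finset.mem_filter] at he
          refine lt_of_le_of_lt (Finset.card_le_card ?_) (hcon e he.1)
          intro a ha
          rw [Finset.mem_filter] at ha ⊢
          exact ⟨ha.1, by
            rw [(zmod_two_eq _).resolve_left he.2, (zmod_two_eq _).resolve_left ha.2]⟩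
      omega
    have hpart := Finset.card_filter_add_card_filter_not (s := S) (fun a => κ e = κ a)
    set g := (S.filter fun a => κ e = κ a).card with hg
    set y := (S.filter fun a => ¬ κ e = κ a).card with hy
    have hcard : ∀ b ∈ S.erase e, ((S.erase e).erase b).card = 2 * θ := fun b hb => by
      rw [Finset.card_erase_of_mem hb, Finset.card_erase_of_mem he]; omega
    have hfib : ∀ b ∈ S.erase e, ((involutions κ S r).filter fun f => f e = b).card ≤
        if κ e = κ b then (if r = 0 then 0 else max 1 θ ^ (r - 1) * θ.factorial)
        else max 1 θ ^ r * θ.factorial := by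
      intro b hb
      have hinj : ∀ T : Finset (α → α), (∀ f ∈ involutions κ S r, f e = b → removePair e b f ∈ T) →
          ((involutions κ S r).filter fun f => f e = b).card ≤ T.card := by
        intro T hT
        refine Finset.card_le_card_of_injOn (removePair e b) (fun f hf => ?_) ?_
        · rw [Finset.mem_coe, Finset.mem_filter] at hf
          exact hT f hf.1 hf.2
        · refine (removePair_injOn e b).mono fun f hf => ?_
          rw [Finset.mem_coe, Finset.mem_filter, mem_involutions] at hf
          exact ⟨hf.1.1, hf.2⟩
      split_ifs with h1 h2
      · subst h2
        have := hinj ∅ (fun f hf hfe => by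
          exfalso
          rw [mem_involutions] at hf
          have h3 : e ∈ S.filter fun a => κ a = κ (f a) := by
            rw [Finset.mem_filter, hfe]; exact ⟨he, h1⟩
          have := Finset.card_pos.2 ⟨e, h3⟩
          omega)
        simpa using this
      · exact (hinj _ fun f hf hfe => removePair_mem he hf hfe
          (Or.inr ⟨h1, Nat.sub_add_cancel (Nat.pos_of_ne_zero h2)⟩)).trans (ih _ _ (hcard b hb))
      · exact (hinj _ fun f hf hfe => removePair_mem he hf hfe
          (Or.inl ⟨h1, rfl⟩)).trans (ih _ _ (hcard b hb))
    have hmaps : ∀ f ∈ involutions κ S r, f e ∈ S.erase e := fun f hf => by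
      rw [mem_involutions] at hf
      have h1 := (hf.2.1 e).2 he
      refine Finset.mem_erase.2 ⟨h1, (hf.2.1 _).1 ?_⟩
      rw [hf.1 e]; exact h1.symm
    rw [Finset.card_eq_sum_card_fiberwise hmaps]
    refine (Finset.sum_le_sum hfib).trans ?_
    rw [Finset.sum_ite, Finset.sum_const, Finset.sum_const, smul_eq_mul, smul_eq_mul]
    have c1 : ((S.erase e).filter fun b => κ e = κ b).card = g - 1 := by
      rw [Finset.filter_erase, Finset.card_erase_of_mem (by simp [he])]
    have c2 : ((S.erase e).filter fun b => ¬ κ e = κ b).card = y := by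
      rw [Finset.filter_erase, Finset.erase_eq_of_notMem (by simp)]
    rw [c1, c2]
    rcases r with _ | r
    · simp only [if_true, mul_zero, pow_zero, one_mul, zero_add, Nat.factorial_succ]
      gcongr
      omega
    · simp only [Nat.succ_ne_zero, if_false, Nat.add_sub_cancel]
      rw [add_comm]
      exact involutions_bound (by omega) (by omega) (by omega)

end

section
variable {n : ℕ}

/-! ### Counting the matrices `G + G' - Z` -/

/-- Symmetric integer matrices with zero diagonal, row sums `d` and entries between `-1` and `2`. -/
structure IsMat (d : ℕ) (L : Fin n → Fin n → ℤ) : Prop where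
  symm : ∀ a b, L a b = L b a
  diag : ∀ a, L a a = 0
  sum : ∀ a, ∑ b, L a b = d
  lower : ∀ a b, -1 ≤ L a b
  upper : ∀ a b, L a b ≤ 2

open Classical in
/-- The matrices with entries `0` and `1`, except that entries `-1` may occur in the positions `P`,
and entries `2` in the positions `Q`. -/
noncomputable def mats (n d : ℕ) (P Q : Finset (Sym2 (Fin n))) : Finset (Fin n → Fin n → ℤ) :=
  (Fintype.piFinset fun _ => Fintype.piFinset fun _ => Finset.Icc (-1) 2).filter fun L =>
    IsMat d L ∧ (∀ a b, L a b = -1 → s(a, b) ∈ P) ∧ (∀ a b, L a b = 2 → s(a, b) ∈ Q)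

variable {d : ℕ} {P Q : Finset (Sym2 (Fin n))} {L : Fin n → Fin n → ℤ}

lemma mem_mats : L ∈ mats n d P Q ↔
    IsMat d L ∧ (∀ a b, L a b = -1 → s(a, b) ∈ P) ∧ (∀ a b, L a b = 2 → s(a, b) ∈ Q) := by
  classical
  unfold mats
  rw [Finset.mem_filter, and_iff_right_iff_imp]
  rintro ⟨h, _⟩
  simp only [Fintype.mem_piFinset, Finset.mem_Icc]
  exact fun a b => ⟨h.lower a b, h.upper a b⟩

lemma mats_mono {P' Q' : Finset (Sym2 (Fin n))} (hP : P ⊆ P') (hQ : Q ⊆ Q') :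
    mats n d P Q ⊆ mats n d P' Q' := fun L hL => by
  rw [mem_mats] at hL ⊢
  exact ⟨hL.1, fun a b h => hP (hL.2.1 a b h), fun a b h => hQ (hL.2.2 a b h)⟩

/-- The matrix with entries `1` at `xu`, `qt` and `-1` at `uq`, `tx`, on a 4-cycle `xuqt`. -/
def cycMat (x u q t a b : Fin n) : ℤ :=
  (if s(a, b) = s(x, u) then 1 else 0) - (if s(a, b) = s(u, q) then 1 else 0) +
    (if s(a, b) = s(q, t) then 1 else 0) - (if s(a, b) = s(t, x) then 1 else 0)

lemma sum_ite_edge {x u : Fin n} (h : x ≠ u) (a : Fin n) :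
    ∑ b, (if s(a, b) = s(x, u) then (1 : ℤ) else 0) =
      (if a = x then 1 else 0) + (if a = u then 1 else 0) := by
  have : ∀ b, (if s(a, b) = s(x, u) then (1 : ℤ) else 0) =
      (if b = u then (if a = x then 1 else 0) else 0) +
        (if b = x then (if a = u then 1 else 0) else 0) := by
    intro b
    simp only [Sym2.eq_iff]
    split_ifs <;> grind
  simp only [this]
  rw [Finset.sum_add_distrib, Finset.sum_ite_eq', Finset.sum_ite_eq']
  simp

lemma sum_cycMat {x u q t : Fin n} (hxu : x ≠ u) (huq : u ≠ q) (hqt : q ≠ t) (htx : t ≠ x)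
    (a : Fin n) : ∑ b, cycMat x u q t a b = 0 := by
  unfold cycMat
  rw [Finset.sum_sub_distrib, Finset.sum_add_distrib, Finset.sum_sub_distrib, sum_ite_edge hxu,
    sum_ite_edge huq, sum_ite_edge hqt, sum_ite_edge htx]
  ring

lemma add_cycMat_cases (hL : IsMat d L) {x u q t : Fin n} (h : [x, u, q, t].Nodup) (a b : Fin n) :
    (s(a, b) = s(x, u) ∧ L a b + cycMat x u q t a b = L x u + 1) ∨
    (s(a, b) = s(u, q) ∧ L a b + cycMat x u q t a b = L u q - 1) ∨
    (s(a, b) = s(q, t) ∧ L a b + cycMat x u q t a b = L t q + 1) ∨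
    (s(a, b) = s(t, x) ∧ L a b + cycMat x u q t a b = L x t - 1) ∨
    (s(a, b) ≠ s(x, u) ∧ s(a, b) ≠ s(t, x) ∧ L a b + cycMat x u q t a b = L a b) := by
  simp only [List.nodup_cons, List.mem_cons, List.not_mem_nil, or_false, not_or,
    List.nodup_nil, not_false_eq_true, and_true] at h
  obtain ⟨⟨h1, h2, h3⟩, ⟨h4, h5⟩, h6⟩ := h
  have e12 : s(x, u) ≠ s(u, q) := by rw [Ne, Sym2.eq_iff]; tauto
  have e13 : s(x, u) ≠ s(q, t) := by rw [Ne, Sym2.eq_iff]; tauto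
  have e14 : s(x, u) ≠ s(t, x) := by
    rw [Ne, Sym2.eq_iff]; rintro (⟨h, _⟩ | ⟨_, h⟩) <;> tauto
  have e23 : s(u, q) ≠ s(q, t) := by rw [Ne, Sym2.eq_iff]; tauto
  have e24 : s(u, q) ≠ s(t, x) := by
    rw [Ne, Sym2.eq_iff]; rintro (⟨h, _⟩ | ⟨h, _⟩) <;> tauto
  have e34 : s(q, t) ≠ s(t, x) := by
    rw [Ne, Sym2.eq_iff]; rintro (⟨h, _⟩ | ⟨h, _⟩) <;> [exact h6 h; exact h2 h.symm]
  have hval : ∀ c e, s(a, b) = s(c, e) → L a b = L c e := by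
    intro c e he
    rcases Sym2.eq_iff.1 he with ⟨rfl, rfl⟩ | ⟨rfl, rfl⟩
    · rfl
    · exact hL.symm _ _
  unfold cycMat
  by_cases g1 : s(a, b) = s(x, u)
  · left
    refine ⟨g1, ?_⟩
    rw [hval _ _ g1, g1, if_pos rfl, if_neg e12, if_neg e13, if_neg e14]; ring
  by_cases g2 : s(a, b) = s(u, q)
  · right; left
    refine ⟨g2, ?_⟩
    rw [hval _ _ g2, g2, if_neg e12.symm, if_pos rfl, if_neg e23, if_neg e24]; ring
  by_cases g3 : s(a, b) = s(q, t)
  · right; right; left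
    refine ⟨g3, ?_⟩
    rw [hval _ _ g3, hL.symm q t, g3, if_neg e13.symm, if_neg e23.symm, if_pos rfl, if_neg e34]
    ring
  by_cases g4 : s(a, b) = s(t, x)
  · right; right; right; left
    refine ⟨g4, ?_⟩
    rw [hval _ _ g4, hL.symm t x, g4, if_neg e14.symm, if_neg e24.symm, if_neg e34.symm, if_pos rfl]
    ring
  · right; right; right; right
    refine ⟨g1, g4, ?_⟩
    rw [if_neg g1, if_neg g2, if_neg g3, if_neg g4]; ring

/-- Two rows that differ by at least `2` in column `x` differ in the other direction in some column
`q`; the exceptional position `e₀` cannot make up for the whole difference. -/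
lemma exists_column (hL : IsMat d L) {x u t : Fin n} (hxu : x ≠ u) (hut : u ≠ t) (htx : t ≠ x)
    {e₀ : Sym2 (Fin n)}
    (h01 : ∀ a b, a ≠ x → b ≠ x → s(a, b) ≠ e₀ → 0 ≤ L a b ∧ L a b ≤ 1)
    (hd : L x u + 2 ≤ L x t) :
    ∃ q, [x, u, q, t].Nodup ∧ 1 ≤ L u q ∧ L t q ≤ 0 := by
  by_contra! hcon
  have hle : ∀ q ∈ ((Finset.univ.erase x).erase u).erase t,
      L u q - L t q ≤ if s(u, q) = e₀ ∨ s(t, q) = e₀ then 1 else 0 := by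
    intro q hq
    simp only [Finset.mem_erase, Finset.mem_univ, and_true] at hq
    obtain ⟨h1, h2, h3⟩ := hq
    have hcon := hcon q (by
      simp only [List.nodup_cons, List.mem_cons, List.not_mem_nil, or_false, not_or,
        List.nodup_nil, not_false_eq_true, and_true]
      exact ⟨⟨hxu, h3.symm, htx.symm⟩, ⟨h2.symm, hut⟩, h1⟩)
    have a1 := h01 u q hxu.symm h3
    have a2 := h01 t q htx h3
    have b1 := hL.lower t q
    have b2 := hL.upper u q
    split_ifs with h
    · rcases le_or_gt 1 (L u q) with h4 | h4
      · have := hcon h4; omega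
      · omega
    · rw [not_or] at h
      have a1 := a1 h.1
      have a2 := a2 h.2
      rcases le_or_gt 1 (L u q) with h4 | h4
      · have := hcon h4; omega
      · omega
  have hone : ∑ q ∈ ((Finset.univ.erase x).erase u).erase t,
      (if s(u, q) = e₀ ∨ s(t, q) = e₀ then (1 : ℤ) else 0) ≤ 1 := by
    rw [Finset.sum_ite, Finset.sum_const_zero, add_zero, Finset.sum_const, nsmul_eq_mul, mul_one]
    have : (Finset.filter (fun q => s(u, q) = e₀ ∨ s(t, q) = e₀)
        (((Finset.univ.erase x).erase u).erase t)).card ≤ 1 := by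
      refine Finset.card_le_one.2 fun q hq q' hq' => ?_
      simp only [Finset.mem_filter, Finset.mem_erase, Finset.mem_univ, and_true] at hq hq'
      obtain ⟨⟨h1, h2, h3⟩, h4⟩ := hq
      obtain ⟨⟨h1', h2', h3'⟩, h4'⟩ := hq'
      rcases h4 with rfl | rfl <;> rcases h4' with h | h <;> rw [Sym2.eq_iff] at h <;> grind
    exact_mod_cast this
  have hsum : ∑ q, (L u q - L t q) = 0 := by
    rw [Finset.sum_sub_distrib, hL.sum, hL.sum, sub_self]
  rw [← Finset.add_sum_erase _ _ (Finset.mem_univ x),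
    ← Finset.add_sum_erase _ _ (Finset.mem_erase.2 ⟨hxu.symm, Finset.mem_univ u⟩),
    ← Finset.add_sum_erase _ _
      (Finset.mem_erase.2 ⟨hut.symm, Finset.mem_erase.2 ⟨htx, Finset.mem_univ t⟩⟩)] at hsum
  have h1 := (Finset.sum_le_sum hle).trans hone
  have h2 := hL.symm u t
  rw [hL.diag u, hL.diag t, hL.symm u x, hL.symm t x] at hsum
  omega

/-- The shift along a 4-cycle that repairs the entries `xu` and `xt`. -/
lemma exists_repair (hM : IsMat d L) {x u t : Fin n} (hxu : x ≠ u) (hut : u ≠ t)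
    (htx : t ≠ x) {e₀ : Sym2 (Fin n)}
    (h01 : ∀ a b, a ≠ x → b ≠ x → s(a, b) ≠ e₀ → 0 ≤ L a b ∧ L a b ≤ 1)
    (hu : L x u ≤ 0) (ht : 1 ≤ L x t) (hd : L x u + 2 ≤ L x t) :
    ∃ q, IsMat d (fun a b => L a b + cycMat x u q t a b) ∧
      (∀ a b, L a b + cycMat x u q t a b = -1 → L a b = -1 ∧ s(a, b) ≠ s(x, u)) ∧
      (∀ a b, L a b + cycMat x u q t a b = 2 → L a b = 2 ∧ s(a, b) ≠ s(x, t)) ∧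
      (1 ≤ L t q + cycMat x u q t t q ∨ s(t, q) = e₀) ∧
      1 ≤ L u q ∧ L x u + cycMat x u q t x u = L x u + 1 := by
  obtain ⟨q, hnd, h1, h2⟩ := exists_column hM hxu hut htx h01 hd
  have hc := add_cycMat_cases hM hnd
  have hnd' := hnd
  simp only [List.nodup_cons, List.mem_cons, List.not_mem_nil, or_false, not_or,
    List.nodup_nil, not_false_eq_true, and_true] at hnd'
  obtain ⟨⟨_, n2, _⟩, ⟨n4, _⟩, n6⟩ := hnd'
  have l1 := hM.lower x u
  have l2 := hM.lower t q
  have u1 := hM.upper u q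
  have u2 := hM.upper x t
  refine ⟨q, ⟨?_, ?_, ?_, ?_, ?_⟩, ?_, ?_, ?_, h1, ?_⟩
  · intro a b
    simp only [cycMat, Sym2.eq_swap (a := a) (b := b), hM.symm a b]
  · intro a
    have hne : ∀ c e : Fin n, c ≠ e → s(a, a) ≠ s(c, e) := fun c e h he => by
      rcases Sym2.eq_iff.1 he with ⟨rfl, rfl⟩ | ⟨rfl, rfl⟩ <;> exact h rfl
    simp only [cycMat, if_neg (hne _ _ hxu), if_neg (hne _ _ n4), if_neg (hne _ _ n6),
      if_neg (hne _ _ htx), hM.diag]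
    ring
  · intro a
    rw [Finset.sum_add_distrib, hM.sum, sum_cycMat hxu n4 n6 htx, add_zero]
  · intro a b
    have := hM.lower a b
    rcases hc a b with h | h | h | h | h <;> simp only [h] <;> omega
  · intro a b
    have := hM.upper a b
    rcases hc a b with h | h | h | h | h <;> simp only [h] <;> omega
  · intro a b hab
    rcases hc a b with h | h | h | h | h <;> simp only [h] at hab <;> try omega
    exact ⟨hab, h.1⟩
  · intro a b hab
    rcases hc a b with h | h | h | h | h <;> simp only [h] at hab <;> try omega
    exact ⟨hab, by rw [Sym2.eq_swap (a := x)]; exact h.2.1⟩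
  · by_cases he : s(t, q) = e₀
    · exact Or.inr he
    · left
      have := (h01 t q htx (Ne.symm n2) he).1
      have e1 : s(t, q) ≠ s(x, u) := by rw [Ne, Sym2.eq_iff]; grind
      have e2 : s(t, q) ≠ s(u, q) := by rw [Ne, Sym2.eq_iff]; grind
      have e3 : s(t, q) ≠ s(t, x) := by rw [Ne, Sym2.eq_iff]; grind
      simp only [cycMat, if_neg e1, if_neg e2, if_neg e3, if_pos (Sym2.eq_swap (a := t) (b := q))]
      omega
  · have e1 : s(x, u) ≠ s(u, q) := by rw [Ne, Sym2.eq_iff]; grind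
    have e2 : s(x, u) ≠ s(q, t) := by rw [Ne, Sym2.eq_iff]; grind
    have e3 : s(x, u) ≠ s(t, x) := by rw [Ne, Sym2.eq_iff]; grind
    simp only [cycMat, if_neg e1, if_neg e2, if_neg e3, if_true]
    ring

lemma card_le_of_decode {α β γ : Type*} {A : Finset α} {B : Finset β} {R : β → Finset γ} {r : ℕ}
    (hR : ∀ b ∈ B, (R b).card ≤ r) (dec : β → γ → α)
    (h : ∀ a ∈ A, ∃ b ∈ B, ∃ c ∈ R b, dec b c = a) : A.card ≤ r * B.card := by
  classical
  have hsub : A ⊆ (B.sigma R).image fun p => dec p.1 p.2 := by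
    intro a ha
    obtain ⟨b, hb, c, hc, rfl⟩ := h a ha
    exact Finset.mem_image.2 ⟨⟨b, c⟩, Finset.mem_sigma.2 ⟨hb, hc⟩, rfl⟩
  refine (Finset.card_le_card hsub).trans (Finset.card_image_le.trans ?_)
  rw [Finset.card_sigma, mul_comm]
  exact Finset.sum_le_card_nsmul _ _ _ hR

lemma card_pairs_le (e : Sym2 (Fin n)) :
    (Finset.univ.filter fun p : Fin n × Fin n => s(p.1, p.2) = e).card ≤ 2 := by
  induction e with
  | _ a b =>
    refine (Finset.card_le_card (t := {(a, b), (b, a)}) fun p hp => ?_).trans Finset.card_le_two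
    rw [Finset.mem_filter] at hp
    rcases Sym2.eq_iff.1 hp.2 with ⟨h1, h2⟩ | ⟨h1, h2⟩ <;> simp [Prod.ext_iff, h1, h2]

lemma card_pairs_mem_le (P : Finset (Sym2 (Fin n))) :
    (Finset.univ.filter fun p : Fin n × Fin n => s(p.1, p.2) ∈ P).card ≤ 2 * P.card := by
  have : (Finset.univ.filter fun p : Fin n × Fin n => s(p.1, p.2) ∈ P) =
      P.biUnion fun e => Finset.univ.filter fun p : Fin n × Fin n => s(p.1, p.2) = e := by
    ext p; simp
  rw [this, mul_comm]
  exact Finset.card_biUnion_le_card_mul _ _ _ fun e _ => card_pairs_le e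

lemma card_pos_le (hL : L ∈ mats n d P Q) :
    (Finset.univ.filter fun p : Fin n × Fin n => 1 ≤ L p.1 p.2).card ≤ n * d + 2 * P.card := by
  rw [mem_mats] at hL
  obtain ⟨hM, hP, -⟩ := hL
  have h1 : ((Finset.univ.filter fun p : Fin n × Fin n => 1 ≤ L p.1 p.2).card : ℤ) ≤
      n * d + ((Finset.univ.filter fun p : Fin n × Fin n => s(p.1, p.2) ∈ P).card : ℤ) := by
    have hs : ∑ p : Fin n × Fin n, L p.1 p.2 = n * d := by
      rw [Fintype.sum_prod_type]
      simp [hM.sum]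
    rw [← hs, Finset.card_filter, Finset.card_filter]
    push_cast
    rw [← Finset.sum_add_distrib]
    refine Finset.sum_le_sum fun p _ => ?_
    have := hM.lower p.1 p.2
    have := hP p.1 p.2
    split_ifs <;> grind
  have h2 := card_pairs_mem_le P
  zify at h2 ⊢
  omega

lemma exists_pos (hM : IsMat d L) {x u : Fin n} (h : L x u < 0) : ∃ t, 1 ≤ L x t := by
  by_contra! hcon
  have h1 : ∑ b, L x b < 0 := by
    refine Finset.sum_neg' (fun b _ => ?_) ⟨u, Finset.mem_univ _, h⟩
    have := hcon b; omega
  rw [hM.sum] at h1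
  omega

lemma exists_nonpos (hM : IsMat d L) (hd : d < n) {x t : Fin n} (hxt : x ≠ t) (h : L x t = 2) :
    ∃ u, u ≠ x ∧ u ≠ t ∧ L x u ≤ 0 := by
  by_contra! hcon
  have h1 : ∑ b : Fin n, (1 : ℤ) ≤ ∑ b, L x b := by
    rw [← Finset.add_sum_erase _ _ (Finset.mem_univ x),
      ← Finset.add_sum_erase _ _ (Finset.mem_erase.2 ⟨hxt.symm, Finset.mem_univ t⟩),
      ← Finset.add_sum_erase _ (L x) (Finset.mem_univ x),
      ← Finset.add_sum_erase _ (L x) (Finset.mem_erase.2 ⟨hxt.symm, Finset.mem_univ t⟩),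
      hM.diag, h]
    have : ∑ b ∈ (Finset.univ.erase x).erase t, (1 : ℤ) ≤
        ∑ b ∈ (Finset.univ.erase x).erase t, L x b := by
      refine Finset.sum_le_sum fun b hb => ?_
      simp only [Finset.mem_erase, Finset.mem_univ, and_true] at hb
      exact hcon b hb.2 hb.1
    omega
  rw [hM.sum, Finset.sum_const, Finset.card_univ, Fintype.card_fin, nsmul_eq_mul, mul_one] at h1
  omega

/-- The repair of an entry `-1` at `xu`, which also removes an entry `2` at `xt`. -/
lemma card_neg_le {x u t : Fin n} {e₀ : Sym2 (Fin n)} {P' : Finset (Sym2 (Fin n))}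
    (hP' : ∀ a b, s(a, b) ∈ P' → a ≠ x → b ≠ x → s(a, b) = e₀) (hPP' : P.erase s(x, u) ⊆ P') :
    ((mats n d P {s(x, t), e₀}).filter fun L => L x u = -1).card ≤
      (n * d + 2 * P'.card + 2) * (mats n d P' {e₀}).card := by
  refine card_le_of_decode
    (R := fun L => Finset.univ.filter fun p : Fin n × Fin n => 1 ≤ L p.1 p.2 ∨ s(p.1, p.2) = e₀)
    (fun L hL => ?_) (fun L p a b => L a b - cycMat x u p.2 p.1 a b) fun L hL => ?_
  · rw [Finset.filter_or]
    exact (Finset.card_union_le _ _).trans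
      (add_le_add (card_pos_le hL) (card_pairs_le e₀))
  · rw [Finset.mem_filter] at hL
    obtain ⟨hL, hu⟩ := hL
    have hL' := hL
    rw [mem_mats] at hL'
    obtain ⟨hM, hP, hQ⟩ := hL'
    have hxu : x ≠ u := by rintro rfl; rw [hM.diag] at hu; omega
    have h01 : ∀ a b, a ≠ x → b ≠ x → s(a, b) ≠ e₀ → 0 ≤ L a b ∧ L a b ≤ 1 := by
      intro a b ha hb hab
      have := hM.lower a b
      have := hM.upper a b
      have h1 : L a b ≠ -1 := fun h => hab (hP' a b (hPP' (Finset.mem_erase.2 ⟨fun he => by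
        rcases Sym2.eq_iff.1 he with ⟨h1, -⟩ | ⟨-, h1⟩
        · exact ha h1
        · exact hb h1, hP a b h⟩)) ha hb)
      have h2 : L a b ≠ 2 := fun h => by
        have := hQ a b h
        rw [Finset.mem_insert, Finset.mem_singleton] at this
        rcases this with he | he
        · rcases Sym2.eq_iff.1 he with ⟨h1, -⟩ | ⟨-, h1⟩
          · exact ha h1
          · exact hb h1
        · exact hab he
      omega
    obtain ⟨w, hw, hw2⟩ : ∃ w, 1 ≤ L x w ∧ (L x t = 2 → w = t) := by
      by_cases h2 : L x t = 2
      · exact ⟨t, by omega, fun _ => rfl⟩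
      · obtain ⟨w, hw⟩ := exists_pos hM (show L x u < 0 by omega)
        exact ⟨w, hw, fun h => absurd h h2⟩
    have hwx : w ≠ x := by rintro rfl; rw [hM.diag] at hw; omega
    have huw : u ≠ w := by rintro rfl; omega
    obtain ⟨q, h1, h2, h3, h4, -, -⟩ := exists_repair hM hxu huw hwx h01 (by omega) hw (by omega)
    refine ⟨fun a b => L a b + cycMat x u q w a b, mem_mats.2 ⟨h1, fun a b h => ?_, fun a b h => ?_⟩,
      (w, q), ?_, ?_⟩
    · exact hPP' (Finset.mem_erase.2 ⟨(h2 a b h).2, hP a b (h2 a b h).1⟩)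
    · obtain ⟨h5, h6⟩ := h3 a b h
      have h7 := hQ a b h5
      rw [Finset.mem_insert, Finset.mem_singleton] at h7
      rcases h7 with h7 | h7
      · exfalso
        have hxt : L x t = 2 := by
          rcases Sym2.eq_iff.1 h7 with ⟨rfl, rfl⟩ | ⟨rfl, rfl⟩
          · exact h5
          · rw [hM.symm]; exact h5
        exact h6 (by rw [h7, hw2 hxt])
      · rw [h7]; exact Finset.mem_singleton_self _
    · simpa using h4
    · funext a b
      ring

/-- The repair of an entry `2` at `xt`. -/
lemma card_two_le (hd : d < n) {x t : Fin n} {e₀ : Sym2 (Fin n)} :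
    ((mats n d {e₀} {s(x, t), e₀}).filter fun L => L x t = 2).card ≤
      n ^ 2 * (mats n d {e₀} {e₀}).card := by
  refine card_le_of_decode (R := fun _ => (Finset.univ : Finset (Fin n × Fin n)))
    (fun L hL => by simp [sq]) (fun L p a b => L a b - cycMat x p.1 p.2 t a b) fun L hL => ?_
  rw [Finset.mem_filter, mem_mats] at hL
  obtain ⟨⟨hM, hP, hQ⟩, ht⟩ := hL
  have hxt : x ≠ t := by rintro rfl; rw [hM.diag] at ht; omega
  obtain ⟨u, hux, hut, hu⟩ := exists_nonpos hM hd hxt ht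
  have h01 : ∀ a b, a ≠ x → b ≠ x → s(a, b) ≠ e₀ → 0 ≤ L a b ∧ L a b ≤ 1 := by
    intro a b ha hb hab
    have := hM.lower a b
    have := hM.upper a b
    have h1 : L a b ≠ -1 := fun h => hab (Finset.mem_singleton.1 (hP a b h))
    have h2 : L a b ≠ 2 := fun h => by
      have := hQ a b h
      rw [Finset.mem_insert, Finset.mem_singleton] at this
      rcases this with he | he
      · rcases Sym2.eq_iff.1 he with ⟨h1, -⟩ | ⟨-, h1⟩
        · exact ha h1
        · exact hb h1
      · exact hab he
    omega
  obtain ⟨q, h1, h2, h3, -⟩ := exists_repair hM hux.symm hut hxt.symm h01 hu (by omega) (by omega)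
  refine ⟨fun a b => L a b + cycMat x u q t a b, mem_mats.2 ⟨h1, fun a b h => hP a b (h2 a b h).1,
    fun a b h => ?_⟩, (u, q), Finset.mem_univ _, ?_⟩
  · obtain ⟨h5, h6⟩ := h3 a b h
    have h7 := hQ a b h5
    rw [Finset.mem_insert] at h7
    exact h7.resolve_left h6
  · funext a b
    ring

/-- The matrices that the chords `vu`, `vt`, `vu'` of a star allow. -/
lemma card_star_le (hd : d < n) (v u u' t : Fin n) (e₀ : Sym2 (Fin n)) :
    (mats n d {s(v, u), s(v, u'), e₀} {s(v, t), e₀}).card ≤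
      ((n * d + 6) * (n * d + 5) + (n * d + 4) + n ^ 2 + 1) * (mats n d {e₀} {e₀}).card := by
  classical
  have one : ∀ w, ((mats n d {s(v, w), e₀} {s(v, t), e₀}).filter fun L => L v w = -1).card ≤
      (n * d + 4) * (mats n d {e₀} {e₀}).card := by
    intro w
    have := card_neg_le (n := n) (d := d) (P := {s(v, w), e₀}) (x := v) (u := w) (t := t) (e₀ := e₀)
      (P' := {e₀}) (fun a b h _ _ => Finset.mem_singleton.1 h) (fun e he => by
        rw [Finset.mem_erase, Finset.mem_insert] at he
        exact he.2.resolve_left he.1)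
    rwa [Finset.card_singleton] at this
  have cover : ∀ w, mats n d {s(v, w), e₀} {e₀} ⊆
      ((mats n d {s(v, w), e₀} {s(v, t), e₀}).filter fun L => L v w = -1) ∪ mats n d {e₀} {e₀} := by
    intro w L hL
    by_cases h : L v w = -1
    · exact Finset.mem_union_left _ (Finset.mem_filter.2
        ⟨mats_mono (Finset.Subset.refl _) (Finset.subset_insert _ _) hL, h⟩)
    · refine Finset.mem_union_right _ ?_
      rw [mem_mats] at hL ⊢
      refine ⟨hL.1, fun a b hab => ?_, hL.2.2⟩
      have h1 := hL.2.1 a b hab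
      rw [Finset.mem_insert] at h1
      refine h1.resolve_left fun h2 => h ?_
      rcases Sym2.eq_iff.1 h2 with ⟨rfl, rfl⟩ | ⟨rfl, rfl⟩
      · exact hab
      · rw [hL.1.symm]; exact hab
  have two : ((mats n d {s(v, u), s(v, u'), e₀} {s(v, t), e₀}).filter fun L => L v u = -1).card ≤
      (n * d + 6) * (mats n d {s(v, u'), e₀} {e₀}).card := by
    have := card_neg_le (n := n) (d := d) (P := {s(v, u), s(v, u'), e₀}) (x := v) (u := u) (t := t)
      (e₀ := e₀) (P' := {s(v, u'), e₀}) (fun a b h ha hb => by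
        rw [Finset.mem_insert, Finset.mem_singleton] at h
        refine h.resolve_left fun he => ?_
        rcases Sym2.eq_iff.1 he with ⟨h1, -⟩ | ⟨-, h1⟩
        · exact ha h1
        · exact hb h1) (fun e he => by
        rw [Finset.mem_erase, Finset.mem_insert] at he
        exact he.2.resolve_left he.1)
    refine this.trans (Nat.mul_le_mul_right _ ?_)
    have := Finset.card_le_two (a := s(v, u')) (b := e₀)
    omega
  have hsub : mats n d {s(v, u), s(v, u'), e₀} {s(v, t), e₀} ⊆
      ((mats n d {s(v, u), s(v, u'), e₀} {s(v, t), e₀}).filter fun L => L v u = -1) ∪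
      ((mats n d {s(v, u'), e₀} {s(v, t), e₀}).filter fun L => L v u' = -1) ∪
      ((mats n d {e₀} {s(v, t), e₀}).filter fun L => L v t = 2) ∪ mats n d {e₀} {e₀} := by
    intro L hL
    have hval : ∀ a b w (c : ℤ), s(a, b) = s(v, w) → L a b = c → L v w = c := by
      intro a b w c h hab
      rcases Sym2.eq_iff.1 h with ⟨rfl, rfl⟩ | ⟨rfl, rfl⟩
      · exact hab
      · rw [(mem_mats.1 hL).1.symm]; exact hab
    simp only [Finset.mem_union, Finset.mem_filter]
    by_cases h1 : L v u = -1
    · exact Or.inl (Or.inl (Or.inl ⟨hL, h1⟩))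
    rw [mem_mats] at hL
    have p1 : ∀ a b, L a b = -1 → s(a, b) ∈ ({s(v, u'), e₀} : Finset (Sym2 (Fin n))) :=
      fun a b hab => (Finset.mem_insert.1 (hL.2.1 a b hab)).resolve_left
        fun h => h1 (hval _ _ _ _ h hab)
    by_cases h2 : L v u' = -1
    · exact Or.inl (Or.inl (Or.inr ⟨mem_mats.2 ⟨hL.1, p1, hL.2.2⟩, h2⟩))
    have p2 : ∀ a b, L a b = -1 → s(a, b) ∈ ({e₀} : Finset (Sym2 (Fin n))) :=
      fun a b hab => (Finset.mem_insert.1 (p1 a b hab)).resolve_left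
        fun h => h2 (hval _ _ _ _ h hab)
    by_cases h3 : L v t = 2
    · exact Or.inl (Or.inr ⟨mem_mats.2 ⟨hL.1, p2, hL.2.2⟩, h3⟩)
    · exact Or.inr (mem_mats.2 ⟨hL.1, p2, fun a b hab =>
        (Finset.mem_insert.1 (hL.2.2 a b hab)).resolve_left fun h => h3 (hval _ _ _ _ h hab)⟩)
  have h1 := (Finset.card_le_card hsub).trans (Finset.card_union_le _ _)
  have h2 := h1.trans (Nat.add_le_add_right (Finset.card_union_le _ _) _)
  have h3 := h2.trans (Nat.add_le_add_right (Nat.add_le_add_right (Finset.card_union_le _ _) _) _)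
  have h4 := (Finset.card_le_card (cover u')).trans (Finset.card_union_le _ _)
  have h5 := h4.trans (Nat.add_le_add_right (one u') _)
  refine h3.trans ((Nat.add_le_add_right (Nat.add_le_add (Nat.add_le_add
    (two.trans (Nat.mul_le_mul_left _ h5)) (one u')) (card_two_le hd)) _).trans (le_of_eq ?_))
  ring

/-- The matrices that a shortcut edge `xy` allows. -/
lemma card_shortcut_le (hd : d < n) (x y : Fin n) :
    (mats n d {s(x, y)} {s(x, y)}).card ≤ (1 + n * d + d * d) * (mats n d ∅ ∅).card := by
  classical
  have hneg : ((mats n d {s(x, y)} {s(x, y)}).filter fun L => L x y = -1).card ≤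
      (n * d) * (mats n d ∅ ∅).card := by
    refine card_le_of_decode
      (R := fun L => Finset.univ.filter fun p : Fin n × Fin n => 1 ≤ L p.1 p.2)
      (fun L hL => by simpa using card_pos_le hL)
      (fun L p a b => L a b - cycMat x y p.2 p.1 a b) fun L hL => ?_
    rw [Finset.mem_filter, mem_mats] at hL
    obtain ⟨⟨hM, hP, hQ⟩, hy⟩ := hL
    have hxy : x ≠ y := by rintro rfl; rw [hM.diag] at hy; omega
    obtain ⟨t, ht⟩ := exists_pos hM (show L x y < 0 by omega)
    have htx : t ≠ x := by rintro rfl; rw [hM.diag] at ht; omega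
    have hyt : y ≠ t := by rintro rfl; omega
    have hoff : ∀ a b, s(a, b) ≠ s(x, y) → 0 ≤ L a b ∧ L a b ≤ 1 := by
      intro a b hab
      have := hM.lower a b
      have := hM.upper a b
      have h1 : L a b ≠ -1 := fun h => hab (Finset.mem_singleton.1 (hP a b h))
      have h2 : L a b ≠ 2 := fun h => hab (Finset.mem_singleton.1 (hQ a b h))
      omega
    obtain ⟨q, h1, h2, h3, h4, -⟩ := exists_repair (e₀ := s(x, x)) hM hxy hyt htx
      (fun a b ha hb _ => hoff a b fun h => by
        rcases Sym2.eq_iff.1 h with ⟨h1, -⟩ | ⟨-, h1⟩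
        · exact ha h1
        · exact hb h1) (by omega) ht (by omega)
    refine ⟨fun a b => L a b + cycMat x y q t a b, mem_mats.2 ⟨h1, fun a b h => ?_, fun a b h => ?_⟩,
      (t, q), ?_, ?_⟩
    · exact absurd (Finset.mem_singleton.1 (hP a b (h2 a b h).1)) (h2 a b h).2
    · exfalso
      have h5 := Finset.mem_singleton.1 (hQ a b (h3 a b h).1)
      have h6 := (h3 a b h).1
      rcases Sym2.eq_iff.1 h5 with ⟨rfl, rfl⟩ | ⟨rfl, rfl⟩
      · omega
      · rw [hM.symm] at h6; omega
    · have h5 := h4.resolve_right fun h => by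
        rcases Sym2.eq_iff.1 h with ⟨h1, -⟩ | ⟨h1, -⟩ <;> exact htx h1
      simpa using h5
    · funext a b
      ring
  have htwo : ((mats n d {s(x, y)} {s(x, y)}).filter fun L => L x y = 2).card ≤
      (d * d) * (mats n d ∅ ∅).card := by
    refine card_le_of_decode
      (R := fun L => (Finset.univ.filter fun u : Fin n => 1 ≤ L x u) ×ˢ
        (Finset.univ.filter fun q : Fin n => 1 ≤ L y q))
      (fun L hL => ?_)
      (fun L p a b => L a b - cycMat x p.1 p.2 y a b) fun L hL => ?_
    · rw [mem_mats] at hL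
      obtain ⟨hM, hP, -⟩ := hL
      have hrow : ∀ a, (Finset.univ.filter fun u : Fin n => 1 ≤ L a u).card ≤ d := by
        intro a
        have : ((Finset.univ.filter fun u : Fin n => 1 ≤ L a u).card : ℤ) ≤ d := by
          rw [← hM.sum a, Finset.card_filter]
          push_cast
          refine Finset.sum_le_sum fun b _ => ?_
          have := hM.lower a b
          have := hP a b
          simp only [Finset.notMem_empty, imp_false] at this
          split_ifs <;> omega
        exact_mod_cast this
      rw [Finset.card_product]
      exact Nat.mul_le_mul (hrow x) (hrow y)
    rw [Finset.mem_filter, mem_mats] at hL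
    obtain ⟨⟨hM, hP, hQ⟩, hy⟩ := hL
    have hxy : x ≠ y := by rintro rfl; rw [hM.diag] at hy; omega
    obtain ⟨u, hux, huy, hu⟩ := exists_nonpos hM hd hxy hy
    have hoff : ∀ a b, s(a, b) ≠ s(x, y) → 0 ≤ L a b ∧ L a b ≤ 1 := by
      intro a b hab
      have := hM.lower a b
      have := hM.upper a b
      have h1 : L a b ≠ -1 := fun h => hab (Finset.mem_singleton.1 (hP a b h))
      have h2 : L a b ≠ 2 := fun h => hab (Finset.mem_singleton.1 (hQ a b h))
      omega
    obtain ⟨q, h1, h2, h3, h4, -, h5⟩ := exists_repair (e₀ := s(x, x)) hM hux.symm huy hxy.symm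
      (fun a b ha hb _ => hoff a b fun h => by
        rcases Sym2.eq_iff.1 h with ⟨h1, -⟩ | ⟨-, h1⟩
        · exact ha h1
        · exact hb h1) hu (by omega) (by omega)
    refine ⟨fun a b => L a b + cycMat x u q y a b, mem_mats.2 ⟨h1, fun a b h => ?_, fun a b h => ?_⟩,
      (u, q), ?_, ?_⟩
    · exfalso
      have h5 := Finset.mem_singleton.1 (hP a b (h2 a b h).1)
      have h6 := (h2 a b h).1
      rcases Sym2.eq_iff.1 h5 with ⟨rfl, rfl⟩ | ⟨rfl, rfl⟩
      · omega
      · rw [hM.symm] at h6; omega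
    · exact absurd (Finset.mem_singleton.1 (hQ a b (h3 a b h).1)) (h3 a b h).2
    · have h6 := h4.resolve_right fun h => by
        rcases Sym2.eq_iff.1 h with ⟨h1, -⟩ | ⟨h1, -⟩ <;> exact hxy h1.symm
      have h7 := (hoff x u fun h => by
        rcases Sym2.eq_iff.1 h with ⟨-, h1⟩ | ⟨h1, -⟩
        · exact huy h1
        · exact hxy h1).1
      rw [Finset.mem_product, Finset.mem_filter, Finset.mem_filter]
      exact ⟨⟨Finset.mem_univ _, by simp only; omega⟩, Finset.mem_univ _, h6⟩
    · funext a b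
      ring
  have hsub : mats n d {s(x, y)} {s(x, y)} ⊆
      mats n d ∅ ∅ ∪ ((mats n d {s(x, y)} {s(x, y)}).filter fun L => L x y = -1) ∪
        ((mats n d {s(x, y)} {s(x, y)}).filter fun L => L x y = 2) := by
    intro L hL
    simp only [Finset.mem_union, Finset.mem_filter]
    by_cases h1 : L x y = -1
    · exact Or.inl (Or.inr ⟨hL, h1⟩)
    by_cases h2 : L x y = 2
    · exact Or.inr ⟨hL, h2⟩
    left; left
    rw [mem_mats] at hL ⊢
    have hval : ∀ a b (c : ℤ), s(a, b) = s(x, y) → L a b = c → L x y = c := by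
      intro a b c h hab
      rcases Sym2.eq_iff.1 h with ⟨rfl, rfl⟩ | ⟨rfl, rfl⟩
      · exact hab
      · rw [hL.1.symm]; exact hab
    exact ⟨hL.1, fun a b h => absurd (hval a b _ (Finset.mem_singleton.1 (hL.2.1 a b h)) h) h1,
      fun a b h => absurd (hval a b _ (Finset.mem_singleton.1 (hL.2.2 a b h)) h) h2⟩
  have h1 := (Finset.card_le_card hsub).trans (Finset.card_union_le _ _)
  have h2 := h1.trans (Nat.add_le_add_right (Finset.card_union_le _ _) _)
  refine h2.trans ((Nat.add_le_add (Nat.add_le_add_left hneg _) htwo).trans (le_of_eq ?_))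
  ring

lemma mats_diag (v : Fin n) : mats n d {s(v, v)} {s(v, v)} = mats n d ∅ ∅ := by
  refine Finset.Subset.antisymm (fun L hL => ?_) (mats_mono (by simp) (by simp))
  rw [mem_mats] at hL ⊢
  have key : ∀ a b, s(a, b) = s(v, v) → L a b = 0 := fun a b h => by
    rcases Sym2.eq_iff.1 h with ⟨rfl, rfl⟩ | ⟨rfl, rfl⟩ <;> exact hL.1.diag _
  refine ⟨hL.1, fun a b h => ?_, fun a b h => ?_⟩
  · have := key a b (Finset.mem_singleton.1 (hL.2.1 a b h)); omega
  · have := key a b (Finset.mem_singleton.1 (hL.2.2 a b h)); omega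

open Classical in
/-- Matrices with entries `0` and `1` only are adjacency matrices. -/
lemma card_mats_empty_le : (mats n d ∅ ∅).card ≤ Fintype.card (Ω n d) := by
  have h01 : ∀ L ∈ mats n d ∅ ∅, ∀ a b, L a b = 0 ∨ L a b = 1 := by
    intro L hL a b
    rw [mem_mats] at hL
    have h1 := hL.1.lower a b
    have h2 := hL.1.upper a b
    have h3 := hL.2.1 a b
    have h4 := hL.2.2 a b
    simp only [Finset.notMem_empty, imp_false] at h3 h4
    omega
  have hreg : ∀ L ∈ mats n d ∅ ∅, ∃ G : Ω n d, ∀ a b, G.1.Adj a b ↔ L a b = 1 := by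
    intro L hL
    have hM := (mem_mats.1 hL).1
    refine ⟨⟨⟨fun a b => L a b = 1, ⟨fun a b h => (hM.symm b a).trans h⟩,
      ⟨fun a h => by rw [hM.diag] at h; omega⟩⟩, fun a => ?_⟩, fun a b => Iff.rfl⟩
    have h1 : ((Finset.univ.filter fun b => L a b = 1).card : ℤ) = d := by
      rw [← hM.sum a, Finset.card_filter]
      push_cast
      refine Finset.sum_congr rfl fun b _ => ?_
      rcases h01 L hL a b with h | h <;> simp [h]
    rw [← SimpleGraph.card_neighborFinset_eq_degree]
    refine Eq.trans (congrArg Finset.card ?_) (by exact_mod_cast h1)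
    ext b
    simp [SimpleGraph.mem_neighborFinset]
  have hsub : mats n d ∅ ∅ ⊆ Finset.univ.image
      fun (G : Ω n d) a b => if G.1.Adj a b then (1 : ℤ) else 0 := by
    intro L hL
    obtain ⟨G, hG⟩ := hreg L hL
    refine Finset.mem_image.2 ⟨G, Finset.mem_univ _, ?_⟩
    funext a b
    have e1 := hG a b
    rcases h01 L hL a b with h | h <;> rw [h] at e1 ⊢ <;> simp [e1]
  exact (Finset.card_le_card hsub).trans Finset.card_image_le

end

section
variable {n : ℕ} {G G' : SimpleGraph (Fin n)}

/-! ### Canonical paths -/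

lemma mem_edges {v u : Fin n} : s(v, u) ∈ edges G ↔ G.Adj v u := by
  classical
  simp [edges]

lemma edges_injective : Function.Injective (edges (n := n)) := by
  intro G G' h
  ext v u
  rw [← mem_edges, ← mem_edges, h]

lemma mem_symmDiff {v u : Fin n} : s(v, u) ∈ edges (symmDiff G G') ↔
    (G \ G').Adj v u ∨ (G' \ G).Adj v u := by
  rw [mem_edges]
  rfl

lemma mate_blue (ψ : Pairing G G') {v u : Fin n} (h : (G \ G').Adj v u) :
    mate ψ v u = ψ v ⟨u, h⟩ := by
  unfold mate
  rw [dif_pos (show u ∈ (G \ G').neighborSet v from h)]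

lemma not_blue_of_red {v u : Fin n} (h : (G' \ G).Adj v u) : ¬ (G \ G').Adj v u := fun h' => by
  rw [SimpleGraph.sdiff_adj] at h h'
  exact h'.2 h.1

lemma mate_red (ψ : Pairing G G') {v u : Fin n} (h : (G' \ G).Adj v u) :
    mate ψ v u = (ψ v).symm ⟨u, h⟩ := by
  unfold mate
  rw [dif_neg (show u ∉ (G \ G').neighborSet v from not_blue_of_red h),
    dif_pos (show u ∈ (G' \ G).neighborSet v from h)]

lemma mate_of_notMem (ψ : Pairing G G') {v u : Fin n} (h : s(v, u) ∉ edges (symmDiff G G')) :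
    mate ψ v u = u := by
  rw [mem_symmDiff, not_or] at h
  unfold mate
  rw [dif_neg (show u ∉ (G \ G').neighborSet v from h.1),
    dif_neg (show u ∉ (G' \ G).neighborSet v from h.2)]

lemma red_mate (ψ : Pairing G G') {v u : Fin n} (h : (G \ G').Adj v u) :
    (G' \ G).Adj v (mate ψ v u) := by
  rw [mate_blue ψ h]
  exact (ψ v ⟨u, h⟩).2

lemma blue_mate (ψ : Pairing G G') {v u : Fin n} (h : (G' \ G).Adj v u) :
    (G \ G').Adj v (mate ψ v u) := by
  rw [mate_red ψ h]
  exact ((ψ v).symm ⟨u, h⟩).2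

lemma mate_involutive (ψ : Pairing G G') (v : Fin n) : Function.Involutive (mate ψ v) := by
  intro u
  by_cases hu : s(v, u) ∈ edges (symmDiff G G')
  · rcases mem_symmDiff.1 hu with h | h
    · rw [mate_red ψ (red_mate ψ h)]
      have : (⟨mate ψ v u, red_mate ψ h⟩ : (G' \ G).neighborSet v) = ψ v ⟨u, h⟩ :=
        Subtype.ext (mate_blue ψ h)
      rw [this, Equiv.symm_apply_apply]
    · rw [mate_blue ψ (blue_mate ψ h)]
      have : (⟨mate ψ v u, blue_mate ψ h⟩ : (G \ G').neighborSet v) = (ψ v).symm ⟨u, h⟩ :=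
        Subtype.ext (mate_red ψ h)
      rw [this, Equiv.apply_symm_apply]
  · rw [mate_of_notMem ψ hu, mate_of_notMem ψ hu]

lemma mate_injective : Function.Injective (mate (G := G) (G' := G')) := by
  intro ψ ψ' h
  funext v
  ext ⟨u, hu⟩
  rw [← mate_blue ψ hu, ← mate_blue ψ' hu, h]

lemma mate_ne (ψ : Pairing G G') {v u : Fin n} (h : s(v, u) ∈ edges (symmDiff G G')) :
    mate ψ v u ≠ u := by
  intro he
  rcases mem_symmDiff.1 h with h | h
  · have := red_mate ψ h
    rw [he] at this
    exact not_blue_of_red this h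
  · have := blue_mate ψ h
    rw [he] at this
    exact not_blue_of_red h this

lemma paired_mate (ψ : Pairing G G') : Paired (mate ψ) (edges (symmDiff G G')) where
  mate_mem v e h := by
    rw [mem_symmDiff] at h ⊢
    exact h.elim (fun h => Or.inr (red_mate ψ h)) (fun h => Or.inl (blue_mate ψ h))
  mate_ne v e h := mate_ne ψ h
  loopless v h := by
    rw [mem_symmDiff] at h
    exact h.elim (fun h => h.ne rfl) (fun h => h.ne rfl)

lemma mate_mem_edges_iff (ψ : Pairing G G') (v u : Fin n)
    (h : s(v, u) ∈ edges (symmDiff G G')) :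
    s(v, mate ψ v u) ∈ edges G ↔ s(v, u) ∉ edges G := by
  rw [mem_edges, mem_edges]
  rcases mem_symmDiff.1 h with h | h
  · have h' := red_mate ψ h
    rw [SimpleGraph.sdiff_adj] at h h'
    exact iff_of_false h'.2 (fun h1 => h1 h.1)
  · have h' := blue_mate ψ h
    rw [SimpleGraph.sdiff_adj] at h h'
    exact iff_of_true h'.1 h.2

open Classical in
lemma two_le_of_adj {d : ℕ} (G : Ω n d) {v u u' : Fin n} (hu : u ≠ u') (h : G.1.Adj v u)
    (h' : G.1.Adj v u') : 2 ≤ d := by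
  rw [← G.2 v, ← SimpleGraph.card_neighborFinset_eq_degree, ← Nat.succ_le_iff.symm]
  refine Finset.one_lt_card.2 ⟨u, ?_, u', ?_, hu⟩
  · rwa [SimpleGraph.mem_neighborFinset]
  · rwa [SimpleGraph.mem_neighborFinset]

/-- Every transition of a canonical path is described by `PathStep`. A 2-circuit has two edges of the
same colour at its start vertex, and hence occurs only if `2 ≤ d`. -/
lemma pathStep_of_infix {d : ℕ} {G G' : Ω n d} (ψ : Pairing G.1 G'.1) {A B : Edges n}
    (h : [A, B] <:+: canonicalPath ψ) :
    PathStep (mate ψ) (circuits (mate ψ) (edges (symmDiff G.1 G'.1)).card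
      (edges (symmDiff G.1 G'.1))) (edges G.1) (2 ≤ d) A B := by
  refine (spec_processAll (mate_involutive ψ) (paired_mate ψ) (mate_mem_edges_iff ψ) ?_).2 A B h
  intro v u u' hu h1 h2 h3
  rw [mem_edges, mem_edges] at h3
  rw [mem_symmDiff, SimpleGraph.sdiff_adj, SimpleGraph.sdiff_adj] at h1 h2
  by_cases hG : G.1.Adj v u
  · exact two_le_of_adj G hu hG (h3.1 hG)
  · exact two_le_of_adj G' hu (by tauto) (by tauto)

/-! ### Reconstruction -/

lemma Circuit.mono {m : Fin n → Fin n → Fin n} {E E' : Edges n} {w : ℕ → Fin n} {L : ℕ}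
    (h : Circuit m E w L) (hE : E ⊆ E') : Circuit m E' w L :=
  ⟨h.pos, fun i => hE (h.mem i), h.follow, h.period, h.inj⟩

lemma CircuitList.exists_circuit {m : Fin n → Fin n → Fin n} {E : Edges n}
    {l : List (List (Fin n))} (h : CircuitList m E l) :
    ∀ c ∈ l, ∃ w L, Circuit m E w L ∧ c = (List.range L).map w := by
  induction h with
  | nil => simp
  | cons h hl ih =>
    intro c hc
    rcases List.mem_cons.1 hc with rfl | hc
    · exact ⟨_, _, h, rfl⟩
    · obtain ⟨w, L, h1, h2⟩ := ih c hc
      exact ⟨w, L, h1.mono Finset.sdiff_subset, h2⟩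

/-- Up to exchanging the colours, the edges of a circuit are coloured in only one way. -/
lemma Circuit.chi_eq {m : Fin n → Fin n → Fin n} {E : Edges n} {w : ℕ → Fin n} {L : ℕ}
    (hC : Circuit m E w L) {Z₁ Z₂ : Edges n}
    (h₁ : ∀ v e, s(v, e) ∈ E → (s(v, m v e) ∈ Z₁ ↔ s(v, e) ∉ Z₁))
    (h₂ : ∀ v e, s(v, e) ∈ E → (s(v, m v e) ∈ Z₂ ↔ s(v, e) ∉ Z₂)) {i j : ℕ}
    (h : edgeAt w i ∈ Z₁ ↔ edgeAt w i ∈ Z₂) : edgeAt w j ∈ Z₁ ↔ edgeAt w j ∈ Z₂ := by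
  rw [hC.alternating h₁ i, hC.alternating h₂ i] at h
  rw [hC.alternating h₁ j, hC.alternating h₂ j]
  tauto

/-- The graph in which the processing starts is determined by the circuits and by the data of one of
its steps. -/
lemma PathData.unique {m : Fin n → Fin n → Fin n} {H : Edges n} {l : List (List (Fin n))}
    (hl : CircuitList m H l) {Z₁ Z₂ A B : Edges n} {v p q t : Fin n} {code : Option (Fin n × Fin n)}
    {x y : Fin n} {F₁ F₂ : Sym2 (Fin n) → ZMod 2} {K₁ K₂ : List (Fin n × Fin n)} {k₁ k₂ : ℕ}
    (h₁ : PathData m l Z₁ A B v p q t code x y F₁ K₁ k₁)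
    (h₂ : PathData m l Z₂ A B v p q t code x y F₂ K₂ k₂)
    (c₁ : ∀ v e, s(v, e) ∈ H → (s(v, m v e) ∈ Z₁ ↔ s(v, e) ∉ Z₁))
    (c₂ : ∀ v e, s(v, e) ∈ H → (s(v, m v e) ∈ Z₂ ↔ s(v, e) ∉ Z₂)) : Z₁ = Z₂ := by
  obtain ⟨hk₁, he₁⟩ := h₁.next_mem
  obtain ⟨hk₂, he₂⟩ := h₂.next_mem
  have hdisj : ∀ i j (hi : i < l.length) (hj : j < l.length), i < j →
      Disjoint (walkEdges l[i]) (walkEdges l[j]) := fun i j hi hj hij =>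
    List.pairwise_iff_getElem.1 hl.pairwise i j hi hj hij
  have hk : k₁ = k₂ := by
    rcases lt_trichotomy k₁ k₂ with h | h | h
    · exact absurd he₂ (Finset.disjoint_left.1 (hdisj _ _ hk₁ hk₂ h) he₁)
    · exact h
    · exact absurd he₁ (Finset.disjoint_left.1 (hdisj _ _ hk₂ hk₁ h) he₂)
  subst hk
  have hval : ∀ e, F₁ e = F₂ e → (e ∈ Z₁ ↔ e ∈ Z₂) := fun e he => by
    refine mem_iff_of_chi ?_
    have e1 := congrFun h₁.chi_eq e
    have e2 := congrFun h₂.chi_eq e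
    rw [e1] at e2
    simp only [Pi.add_apply, he] at e2
    exact add_right_cancel e2
  ext e
  by_cases heH : e ∈ H
  · obtain ⟨c, hc, hec⟩ := hl.exists_mem e heH
    obtain ⟨i, hi, rfl⟩ := List.mem_iff_getElem.1 hc
    rcases lt_trichotomy i k₁ with h | rfl | h
    · exact hval e ((h₁.before i hi h e hec).trans (h₂.before i hi h e hec).symm)
    · obtain ⟨w, L, hC, hw⟩ := hl.exists_circuit _ hc
      rw [hw, hC.mem_walkEdges] at hec he₁
      obtain ⟨j, _, rfl⟩ := hec
      obtain ⟨r, _, hr⟩ := he₁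
      refine hC.chi_eq c₁ c₂ (i := r) ?_
      rw [hr]
      exact hval _ (h₁.next_eq.trans h₂.next_eq.symm)
    · exact hval e ((h₁.after i hi h e hec).trans (h₂.after i hi h e hec).symm)
  · have hz : ∀ {Z K k} {F : Sym2 (Fin n) → ZMod 2},
        PathData m l Z A B v p q t code x y F K k → F e = 0 := fun h => by
      by_contra hcon
      obtain ⟨c, hc, hec⟩ := h.supp e hcon
      exact heH (hl.subset c hc hec)
    exact hval e ((hz h₁).trans (hz h₂).symm)

end

section
variable {n d : ℕ}

/-! ### Encoding canonical paths through a transition -/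

/-- The adjacency matrix of a graph, given by its edge set. -/
def adjMat (E : Edges n) (a b : Fin n) : ℤ := if s(a, b) ∈ E then 1 else 0

/-- The matrix `G + G' - Z`. -/
def diffMat (E E' Z : Edges n) (a b : Fin n) : ℤ := adjMat E a b + adjMat E' a b - adjMat Z a b

lemma adjMat_symm (E : Edges n) (a b : Fin n) : adjMat E a b = adjMat E b a := by
  unfold adjMat; rw [Sym2.eq_swap]

lemma adjMat_cases (E : Edges n) (a b : Fin n) :
    (s(a, b) ∈ E ∧ adjMat E a b = 1) ∨ (s(a, b) ∉ E ∧ adjMat E a b = 0) := by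
  unfold adjMat
  by_cases h : s(a, b) ∈ E <;> simp [h]

lemma adjMat_diag (G : SimpleGraph (Fin n)) (a : Fin n) : adjMat (edges G) a a = 0 := by
  unfold adjMat
  rw [if_neg]
  rw [mem_edges]
  exact fun h => h.ne rfl

lemma sum_adjMat (G : Ω n d) (a : Fin n) : ∑ b, adjMat (edges G.1) a b = d := by
  classical
  have h := G.2 a
  rw [← SimpleGraph.card_neighborFinset_eq_degree] at h
  have h' : ((G.1.neighborFinset a).card : ℤ) = d := by exact_mod_cast h
  refine Eq.trans ?_ h'
  unfold adjMat
  rw [SimpleGraph.neighborFinset_eq_filter, Finset.card_filter]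
  push_cast
  simp only [mem_edges]

lemma mem_symmDiff_iff (G G' : SimpleGraph (Fin n)) (Z : Edges n) (a b : Fin n) :
    s(a, b) ∈ edges (symmDiff G G') ↔
      diffMat (edges G) (edges G') Z a b + adjMat Z a b = 1 := by
  rw [mem_symmDiff, SimpleGraph.sdiff_adj, SimpleGraph.sdiff_adj, ← mem_edges, ← mem_edges]
  unfold diffMat
  rcases adjMat_cases (edges G) a b with ⟨h1, h2⟩ | ⟨h1, h2⟩ <;>
    rcases adjMat_cases (edges G') a b with ⟨h3, h4⟩ | ⟨h3, h4⟩ <;> simp [h1, h2, h3, h4]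

/-- A step of a canonical path: its 4-cycle `vpqt`, the chords of the star at `v`, and the shortcut
edge `xy`. -/
abbrev StepCode (n : ℕ) : Type :=
  (_ : Fin n × Fin n × Fin n × Fin n) × (Option (Fin n × Fin n) × (Fin n × Fin n))

/-- The 4-cycles `vpqt` the switch on which leads from `Z` to `Z'`. -/
def cycles (Z Z' : Edges n) : Finset (Fin n × Fin n × Fin n × Fin n) :=
  Finset.univ.filter fun c => [c.1, c.2.1, c.2.2.1, c.2.2.2].Nodup ∧
    Z' = symmDiff Z {s(c.1, c.2.1), s(c.2.1, c.2.2.1), s(c.2.2.1, c.2.2.2), s(c.2.2.2, c.1)}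

/-- The neighbours of a vertex. -/
def nbrs (Z : Edges n) (v : Fin n) : Finset (Fin n) := Finset.univ.filter fun u => s(v, u) ∈ Z

/-- The codes of the steps that lead from `Z` to `Z'`. There is a shortcut edge only if `2 ≤ d`. -/
def stepCodes (d : ℕ) (Z Z' : Edges n) : Finset (StepCode n) :=
  (cycles Z Z').sigma fun c => Finset.insertNone (nbrs Z c.1 ×ˢ nbrs Z c.1) ×ˢ
    (if 2 ≤ d then Finset.univ else {(c.1, c.1)})

/-- The matrices `G + G' - Z` that are possible for a step. -/
noncomputable def stepMats (d : ℕ) (Z : Edges n) (c : StepCode n) :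
    Finset (Fin n → Fin n → ℤ) :=
  (mats n d {s(c.1.1, (c.2.1.getD (c.1.1, c.1.1)).1), s(c.1.1, (c.2.1.getD (c.1.1, c.1.1)).2),
      s(c.2.2.1, c.2.2.2)} {s(c.1.1, c.1.2.2.2), s(c.2.2.1, c.2.2.2)}).filter
    fun L => ∀ a b, 0 ≤ L a b + adjMat Z a b ∧ L a b + adjMat Z a b ≤ 2

/-- The vertices at which paired edges may have the same colour in the current graph, with
multiplicity. -/
def cornerList (c : StepCode n) : List (Fin n) :=
  List.replicate 5 c.1.1 ++ (starEnds c.1.2.2.2 c.2.1 ++ [c.2.2.1, c.2.2.2])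

/-- The colours of the edges in the current graph, without the chords. -/
def stepColour (Z : Edges n) (c : StepCode n) (v u : Fin n) : ZMod 2 :=
  (chi Z + starSum c.1.1 c.1.2.2.2 c.2.1 + shortSum c.2.2.1 c.2.2.2) s(v, u)

/-- The neighbours of `v` in the symmetric difference of `G` and `G'`, where `L = G + G' - Z`. -/
def moved (Z : Edges n) (L : Fin n → Fin n → ℤ) (v : Fin n) : Finset (Fin n) :=
  Finset.univ.filter fun u => L v u + adjMat Z v u = 1

/-- The pairings that are possible for a step and a matrix. -/
noncomputable def stepPairings (Z : Edges n) (c : StepCode n) (L : Fin n → Fin n → ℤ) :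
    Finset (Fin n → Fin n → Fin n) :=
  Fintype.piFinset fun v => involutions (stepColour Z c v) (moved Z L v) ((cornerList c).count v)

/-- The number of pairings of `G` and `G'`, where `L = G + G' - Z`. -/
def pairingCount (Z : Edges n) (L : Fin n → Fin n → ℤ) : ℕ :=
  ∏ v, ((moved Z L v).card / 2).factorial

lemma card_pairing (Z : Edges n) (G G' : SimpleGraph (Fin n)) (ψ : Pairing G G') :
    Fintype.card (Pairing G G') = pairingCount Z (diffMat (edges G) (edges G') Z) := by
  classical
  have hcard : ∀ v, Fintype.card ((G \ G').neighborSet v ≃ (G' \ G).neighborSet v) =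
      ((moved Z (diffMat (edges G) (edges G') Z) v).card / 2).factorial := by
    intro v
    rw [Fintype.card_equiv (ψ v)]
    congr 1
    have h1 : moved Z (diffMat (edges G) (edges G') Z) v =
        ((G \ G').neighborSet v).toFinset ∪ ((G' \ G).neighborSet v).toFinset := by
      ext u
      simp only [moved, Finset.mem_filter, Finset.mem_univ, true_and, ← mem_symmDiff_iff,
        mem_symmDiff, Finset.mem_union, Set.mem_toFinset, SimpleGraph.mem_neighborSet]
    have h2 : Disjoint ((G \ G').neighborSet v).toFinset ((G' \ G).neighborSet v).toFinset := by
      rw [Finset.disjoint_left]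
      intro u hu hu'
      rw [Set.mem_toFinset] at hu hu'
      exact not_blue_of_red hu' hu
    rw [h1, Finset.card_union_of_disjoint h2, Set.toFinset_card, Set.toFinset_card,
      ← Fintype.card_congr (ψ v)]
    omega
  unfold pairingCount
  rw [← Nat.card_eq_fintype_card, Nat.card_pi]
  exact Finset.prod_congr rfl fun v _ => by rw [Nat.card_eq_fintype_card, hcard v]

lemma starSum_ne_zero {v t : Fin n} {code : Option (Fin n × Fin n)} {e : Sym2 (Fin n)}
    (h : starSum v t code e ≠ 0) :
    (e = s(v, (code.getD (v, v)).1) ∨ e = s(v, (code.getD (v, v)).2)) ∧ code.isSome ∨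
      (e = s(v, t) ∧ (code.getD (v, v)).1 ≠ (code.getD (v, v)).2 ∧ code.isSome) := by
  rcases code with _ | ⟨u, u'⟩
  · exact absurd rfl h
  · simp only [Option.getD_some, Option.isSome_some, and_true]
    by_contra! hcon
    obtain ⟨⟨h1, h2⟩, h3⟩ := hcon
    apply h
    unfold starSum
    by_cases hu : u = u'
    · simp only [if_pos hu, ed_apply]
      rw [if_neg h1]
    · simp only [if_neg hu, Pi.add_apply, ed_apply]
      rw [if_neg h1, if_neg h2, if_neg (fun h => hu (h3 h))]
      rfl

lemma shortSum_ne_zero {x y : Fin n} {e : Sym2 (Fin n)} (h : shortSum x y e ≠ 0) :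
    e = s(x, y) := by
  by_contra hcon
  apply h
  unfold shortSum
  split_ifs
  · rw [ed_apply, if_neg hcon]
  · rfl

/-- The code `c` describes a step from `Z` to `Z'` of the canonical path for `ψ`. -/
def Encodes {G G' : Ω n d} (ψ : Pairing G.1 G'.1) (Z Z' : Edges n) (c : StepCode n) : Prop :=
  ∃ F K k, PathData (mate ψ) (circuits (mate ψ) (edges (symmDiff G.1 G'.1)).card
    (edges (symmDiff G.1 G'.1))) (edges G.1) Z Z' c.1.1 c.1.2.1 c.1.2.2.1 c.1.2.2.2 c.2.1 c.2.2.1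
      c.2.2.2 F K k

lemma exists_encodes {G G' : Ω n d} (ψ : Pairing G.1 G'.1) {Z Z' : Edges n}
    (h : [Z, Z'] <:+: canonicalPath ψ) : ∃ c ∈ stepCodes d Z Z', Encodes ψ Z Z' c := by
  obtain ⟨v, p, q, t, code, x, y, F, K, k, hD, h2⟩ := pathStep_of_infix ψ h
  refine ⟨⟨(v, p, q, t), (code, (x, y))⟩, ?_, F, K, k, hD⟩
  simp only [stepCodes, Finset.mem_sigma, cycles, Finset.mem_filter, Finset.mem_univ, true_and,
    Finset.mem_product]
  refine ⟨⟨hD.nodup, hD.eq_switch⟩, ?_, ?_⟩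
  · rcases code with _ | ⟨u, u'⟩
    · exact Finset.none_mem_insertNone
    · have := hD.star
      simp only [StarOK] at this
      rw [Finset.some_mem_insertNone, Finset.mem_product]
      simp only [nbrs, Finset.mem_filter, Finset.mem_univ, true_and]
      exact ⟨this.1, this.2.1⟩
  · split_ifs with hd
    · exact Finset.mem_univ _
    · obtain ⟨rfl, rfl⟩ := h2.resolve_right hd
      exact Finset.mem_singleton_self _

section
variable {G G' : Ω n d} {ψ : Pairing G.1 G'.1} {Z : Ω n d} {Z' : Edges n} {c : StepCode n}

/-- Outside of the symmetric difference of `G` and `G'`, the current graph differs from `G` in chords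
only; hence the entries of `G + G' - Z` other than `0` and `1` are at chords. -/
lemma Encodes.diffMat_mem (h : Encodes ψ (edges Z.1) Z' c) :
    diffMat (edges G.1) (edges G'.1) (edges Z.1) ∈ stepMats d (edges Z.1) c := by
  classical
  obtain ⟨F, K, k, h⟩ := h
  have hcl := circuitList_circuits (mate_involutive ψ) _ _ (paired_mate ψ) le_rfl
  have hF : ∀ e ∉ edges (symmDiff G.1 G'.1), F e = 0 := fun e he => by
    by_contra hcon
    obtain ⟨c, hc, hec⟩ := h.supp e hcon
    exact he (hcl.subset c hc hec)
  -- outside of `H`, the current graph differs from `G` in chords only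
  have hchord : ∀ e ∉ edges (symmDiff G.1 G'.1), ¬ (e ∈ edges Z.1 ↔ e ∈ edges G.1) →
      e = s(c.1.1, (c.2.1.getD (c.1.1, c.1.1)).1) ∧ e ∈ edges Z.1 ∨
      e = s(c.1.1, (c.2.1.getD (c.1.1, c.1.1)).2) ∧ e ∈ edges Z.1 ∨
      e = s(c.1.1, c.1.2.2.2) ∧ e ∉ edges Z.1 ∨ e = s(c.2.2.1, c.2.2.2) := by
    intro e he hne
    have h1 := congrFun h.chi_eq e
    simp only [Pi.add_apply, hF e he, zero_add] at h1
    by_cases hs : shortSum c.2.2.1 c.2.2.2 e = 0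
    · have h2 : starSum c.1.1 c.1.2.2.2 c.2.1 e ≠ 0 := fun h2 => by
        rw [hs, h2, add_zero, add_zero] at h1
        exact hne (mem_iff_of_chi h1)
      have hst := h.star
      rcases starSum_ne_zero h2 with ⟨h3, h4⟩ | ⟨h3, h4, h5⟩
      · obtain ⟨⟨u, u'⟩, hu⟩ := Option.isSome_iff_exists.1 h4
        simp only [hu, Option.getD_some, StarOK] at h3 hst ⊢
        rcases h3 with h3 | h3
        · exact Or.inl ⟨h3, h3 ▸ hst.1⟩
        · exact Or.inr (Or.inl ⟨h3, h3 ▸ hst.2.1⟩)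
      · obtain ⟨⟨u, u'⟩, hu⟩ := Option.isSome_iff_exists.1 h5
        simp only [hu, Option.getD_some, StarOK] at h4 hst ⊢
        exact Or.inr (Or.inr (Or.inl ⟨h3, h3 ▸ hst.2.2 h4⟩))
    · exact Or.inr (Or.inr (Or.inr (shortSum_ne_zero hs)))
  have hH := mem_symmDiff_iff G.1 G'.1 (edges Z.1)
  unfold stepMats
  rw [Finset.mem_filter, mem_mats]
  refine ⟨⟨⟨fun a b => ?_, fun a => ?_, fun a => ?_, fun a b => ?_, fun a b => ?_⟩, fun a b hab => ?_,
    fun a b hab => ?_⟩, fun a b => ?_⟩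
  · simp only [diffMat, adjMat_symm _ a b]
  · simp only [diffMat, adjMat_diag]
    rfl
  · simp only [diffMat]
    rw [Finset.sum_sub_distrib, Finset.sum_add_distrib, sum_adjMat, sum_adjMat, sum_adjMat]
    ring
  · unfold diffMat
    rcases adjMat_cases (edges G.1) a b with h1 | h1 <;>
      rcases adjMat_cases (edges G'.1) a b with h2 | h2 <;>
      rcases adjMat_cases (edges Z.1) a b with h3 | h3 <;> omega
  · unfold diffMat
    rcases adjMat_cases (edges G.1) a b with h1 | h1 <;>
      rcases adjMat_cases (edges G'.1) a b with h2 | h2 <;>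
      rcases adjMat_cases (edges Z.1) a b with h3 | h3 <;> omega
  · have h4 : s(a, b) ∉ edges (symmDiff G.1 G'.1) := by
      rw [hH a b, hab]
      rcases adjMat_cases (edges Z.1) a b with h3 | h3 <;> omega
    have h5 : s(a, b) ∉ edges G.1 ∧ s(a, b) ∈ edges Z.1 := by
      unfold diffMat at hab
      rcases adjMat_cases (edges G.1) a b with h1 | h1 <;>
        rcases adjMat_cases (edges G'.1) a b with h2 | h2 <;>
        rcases adjMat_cases (edges Z.1) a b with h3 | h3 <;>
        first | exact ⟨h1.1, h3.1⟩ | (exfalso; omega)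
    simp only [Finset.mem_insert, Finset.mem_singleton]
    rcases hchord _ h4 (fun h6 => h5.1 (h6.1 h5.2)) with h6 | h6 | h6 | h6
    · exact Or.inl h6.1
    · exact Or.inr (Or.inl h6.1)
    · exact absurd h5.2 h6.2
    · exact Or.inr (Or.inr h6)
  · have h4 : s(a, b) ∉ edges (symmDiff G.1 G'.1) := by
      rw [hH a b, hab]
      rcases adjMat_cases (edges Z.1) a b with h3 | h3 <;> omega
    have h5 : s(a, b) ∈ edges G.1 ∧ s(a, b) ∉ edges Z.1 := by
      unfold diffMat at hab
      rcases adjMat_cases (edges G.1) a b with h1 | h1 <;>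
        rcases adjMat_cases (edges G'.1) a b with h2 | h2 <;>
        rcases adjMat_cases (edges Z.1) a b with h3 | h3 <;>
        first | exact ⟨h1.1, h3.1⟩ | (exfalso; omega)
    simp only [Finset.mem_insert, Finset.mem_singleton]
    rcases hchord _ h4 (fun h6 => h5.2 (h6.2 h5.1)) with h6 | h6 | h6 | h6
    · exact absurd h6.2 h5.2
    · exact absurd h6.2 h5.2
    · exact Or.inl h6.1
    · exact Or.inr h6
  · unfold diffMat
    rcases adjMat_cases (edges G.1) a b with h1 | h1 <;>
      rcases adjMat_cases (edges G'.1) a b with h2 | h2 <;> omega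

/-- Paired edges have different colours in `G`; they have the same colour in the current graph,
without the chords, only if exactly one of them has been exchanged, that is, at a corner. -/
lemma Encodes.mate_mem (h : Encodes ψ (edges Z.1) Z' c) :
    mate ψ ∈ stepPairings (edges Z.1) c (diffMat (edges G.1) (edges G'.1) (edges Z.1)) := by
  classical
  obtain ⟨F, K, k, h⟩ := h
  have hmoved : ∀ v u, u ∈ moved (edges Z.1) (diffMat (edges G.1) (edges G'.1) (edges Z.1)) v ↔
      s(v, u) ∈ edges (symmDiff G.1 G'.1) := fun v u => by
    rw [mem_symmDiff_iff _ _ (edges Z.1)]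
    simp only [moved, Finset.mem_filter, Finset.mem_univ, true_and]
  unfold stepPairings
  rw [Fintype.mem_piFinset]
  intro v
  rw [mem_involutions]
  refine ⟨mate_involutive ψ v, fun u => ?_, ?_⟩
  · rw [hmoved]
    refine ⟨fun h1 => ?_, mate_ne ψ⟩
    by_contra hcon
    exact h1 (mate_of_notMem ψ hcon)
  · set T := ((K.filter fun e => e.1 = v).map Prod.snd).toFinset with hT
    have hTc : T.card ≤ (cornerList c).count v := by
      refine (List.toFinset_card_le _).trans ?_
      rw [List.length_map]
      refine le_trans (le_of_eq ?_) (h.ends.count_le v)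
      rw [List.count, List.countP_map, List.countP_eq_length_filter]
      congr 2
    have hmemT : ∀ u, (v, u) ∈ K → u ∈ T := fun u hu => by
      rw [hT, List.mem_toFinset, List.mem_map]
      exact ⟨(v, u), List.mem_filter.2 ⟨hu, by simp⟩, rfl⟩
    have hcol : ∀ u, stepColour (edges Z.1) c v u = chi (edges G.1) s(v, u) + F s(v, u) := fun u => by
      unfold stepColour
      rw [h.chi_eq]
      simp only [Pi.add_apply]
      have e1 := zmod_two_add_self (starSum c.1.1 c.1.2.2.2 c.2.1 s(v, u))
      have e2 := zmod_two_add_self (shortSum c.2.2.1 c.2.2.2 s(v, u))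
      linear_combination e1 + e2
    have hsub : ((moved (edges Z.1) (diffMat (edges G.1) (edges G'.1) (edges Z.1)) v).filter fun u =>
        stepColour (edges Z.1) c v u = stepColour (edges Z.1) c v (mate ψ v u)) ⊆
        T ∪ T.image (mate ψ v) := by
      intro u hu
      rw [Finset.mem_filter, hmoved, hcol, hcol] at hu
      have hG := mate_mem_edges_iff ψ v u hu.1
      have hne : F s(v, u) ≠ F s(v, mate ψ v u) := by
        intro hF
        have h1 := hu.2
        rw [hF] at h1
        have h2 := add_right_cancel h1
        rw [← chi_eq_one, ← chi_eq_one, h2] at hG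
        tauto
      rw [Finset.mem_union, Finset.mem_image]
      rcases h.cross v u hne with h1 | h1
      · exact Or.inl (hmemT _ h1)
      · exact Or.inr ⟨_, hmemT _ h1, mate_involutive ψ v u⟩
    have h1 := (Finset.card_le_card hsub).trans (Finset.card_union_le _ _)
    have h2 := Finset.card_image_le (s := T) (f := mate ψ v)
    omega

end

/-- A canonical path is determined by the code of a step, the matrix `G + G' - Z` and the
pairing. -/
lemma Encodes.unique {G₁ G₁' G₂ G₂' : Ω n d} {ψ₁ : Pairing G₁.1 G₁'.1} {ψ₂ : Pairing G₂.1 G₂'.1}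
    {Z Z' : Edges n} {c : StepCode n} (h₁ : Encodes ψ₁ Z Z' c) (h₂ : Encodes ψ₂ Z Z' c)
    (hL : diffMat (edges G₁.1) (edges G₁'.1) Z = diffMat (edges G₂.1) (edges G₂'.1) Z)
    (hm : mate ψ₁ = mate ψ₂) :
    (⟨G₁, G₁', ψ₁⟩ : (G : Ω n d) × (G' : Ω n d) × Pairing G.1 G'.1) = ⟨G₂, G₂', ψ₂⟩ := by
  obtain ⟨F₁, K₁, k₁, h₁⟩ := h₁
  obtain ⟨F₂, K₂, k₂, h₂⟩ := h₂
  have hH : edges (symmDiff G₁.1 G₁'.1) = edges (symmDiff G₂.1 G₂'.1) := by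
    ext e
    induction e with
    | _ a b => rw [mem_symmDiff_iff _ _ Z, mem_symmDiff_iff _ _ Z, hL]
  have hG : edges G₁.1 = edges G₂.1 := by
    have c₁ := mate_mem_edges_iff ψ₁
    have c₂ := mate_mem_edges_iff ψ₂
    have hcl := circuitList_circuits (mate_involutive ψ₂) _ _ (paired_mate ψ₂) le_rfl
    rw [hH, hm] at h₁ c₁
    exact h₁.unique hcl h₂ c₁ c₂
  obtain rfl : G₁ = G₂ := Subtype.ext (edges_injective hG)
  have hG' : edges G₁'.1 = edges G₂'.1 := by
    ext e
    induction e with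
    | _ a b =>
      have := congrFun (congrFun hL a) b
      simp only [diffMat] at this
      rcases adjMat_cases (edges G₁'.1) a b with h1 | h1 <;>
        rcases adjMat_cases (edges G₂'.1) a b with h2 | h2
      · exact iff_of_true h1.1 h2.1
      · omega
      · omega
      · exact iff_of_false h1.1 h2.1
  obtain rfl : G₁' = G₂' := Subtype.ext (edges_injective hG')
  obtain rfl : ψ₁ = ψ₂ := mate_injective hm
  rfl

end

section
variable {n d : ℕ}

/-! ### The bound on the flow -/

lemma card_cycles_le (Z Z' : Edges n) : (cycles Z Z').card ≤ 8 := by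
  rcases (cycles Z Z').eq_empty_or_nonempty with h | ⟨⟨a, b, c, e⟩, h0⟩
  · rw [h]; simp
  have hW : ∀ x ∈ cycles Z Z', x.1 ≠ x.2.1 ∧ x.1 ≠ x.2.2.1 ∧ x.1 ≠ x.2.2.2 ∧ x.2.1 ≠ x.2.2.1 ∧
      x.2.1 ≠ x.2.2.2 ∧ x.2.2.1 ≠ x.2.2.2 ∧
      ({s(x.1, x.2.1), s(x.2.1, x.2.2.1), s(x.2.2.1, x.2.2.2), s(x.2.2.2, x.1)} : Edges n) =
        symmDiff Z Z' := by
    intro x hx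
    simp only [cycles, Finset.mem_filter, Finset.mem_univ, true_and, List.nodup_cons,
      List.mem_cons, List.not_mem_nil, or_false, not_or, List.nodup_nil, not_false_eq_true,
      and_true] at hx
    obtain ⟨⟨⟨h1, h2, h3⟩, ⟨h4, h5⟩, h6⟩, h7⟩ := hx
    refine ⟨h1, h2, h3, h4, h5, h6, ?_⟩
    rw [h7, symmDiff_symmDiff_cancel_left]
  have hcard : ([(a, b), (b, a), (b, c), (c, b), (c, e), (e, c), (e, a), (a, e)] :
      List (Fin n × Fin n)).toFinset.card ≤ 8 := List.toFinset_card_le _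
  refine le_trans (Finset.card_le_card_of_injOn (fun x => (x.1, x.2.1)) ?_ ?_) hcard
  · rintro ⟨v, p, q, t⟩ hx
    have h1 := (hW _ hx).2.2.2.2.2.2.trans (hW _ h0).2.2.2.2.2.2.symm
    have h2 : s(v, p) ∈ ({s(a, b), s(b, c), s(c, e), s(e, a)} : Edges n) := by
      rw [← h1]; simp
    simp only [Finset.mem_insert, Finset.mem_singleton, Sym2.eq_iff] at h2
    simp only [Finset.mem_coe, List.mem_toFinset, List.mem_cons, Prod.mk.injEq, List.not_mem_nil,
      or_false]
    rcases h2 with (⟨rfl, rfl⟩ | ⟨rfl, rfl⟩) | (⟨rfl, rfl⟩ | ⟨rfl, rfl⟩) |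
      (⟨rfl, rfl⟩ | ⟨rfl, rfl⟩) | (⟨rfl, rfl⟩ | ⟨rfl, rfl⟩) <;> simp
  · rintro ⟨v, p, q, t⟩ hx ⟨v', p', q', t'⟩ hx' heq
    obtain ⟨rfl, rfl⟩ := Prod.mk.inj heq
    obtain ⟨_, g2, g3, g4, g5, _, hw⟩ := hW _ hx
    obtain ⟨_, g2', g3', g4', g5', _, hw'⟩ := hW _ hx'
    simp only at g2 g3 g4 g5 g2' g3' g4' g5' hw hw'
    have h1 := hw.trans hw'.symm
    have h2 : s(p, q) ∈ ({s(v, p), s(p, q'), s(q', t'), s(t', v)} : Edges n) := by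
      rw [← h1]; simp
    have h3 : s(t, v) ∈ ({s(v, p), s(p, q'), s(q', t'), s(t', v)} : Edges n) := by
      rw [← h1]; simp
    simp only [Finset.mem_insert, Finset.mem_singleton, Sym2.eq_iff] at h2 h3
    have hq : q = q' := by grind
    have ht : t = t' := by grind
    rw [hq, ht]

lemma card_nbrs (Z : Ω n d) (v : Fin n) : (nbrs (edges Z.1) v).card = d := by
  have h := sum_adjMat Z v
  unfold adjMat at h
  unfold nbrs
  rw [Finset.card_filter]
  exact_mod_cast h

lemma card_stepCodes_le (Z : Ω n d) (Z' : Edges n) :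
    (stepCodes d (edges Z.1) Z').card ≤ 8 * ((d ^ 2 + 1) * if 2 ≤ d then n ^ 2 else 1) := by
  unfold stepCodes
  rw [Finset.card_sigma]
  refine (Finset.sum_le_card_nsmul _ _ ((d ^ 2 + 1) * if 2 ≤ d then n ^ 2 else 1)
    fun c _ => le_of_eq ?_).trans (Nat.mul_le_mul_right _ (card_cycles_le _ _))
  rw [Finset.card_product, Finset.card_insertNone, Finset.card_product, card_nbrs, ← sq]
  congr 1
  split_ifs
  · simp [sq]
  · simp

lemma lt_of_regular (Z : Ω n d) (v : Fin n) : d < n := by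
  classical
  have h := Z.1.degree_lt_card_verts v
  rwa [Z.2 v, Fintype.card_fin] at h

/-- A bound for the number of matrices that a step allows, as a multiple of the number of graphs. -/
def matBound (n d : ℕ) : ℕ :=
  ((n * d + 6) * (n * d + 5) + (n * d + 4) + n ^ 2 + 1) *
    if 2 ≤ d then 1 + n * d + d * d else 1

/-- The entries `-1` and `2` at the chords of the star are repaired first, then those at the shortcut
edge. -/
lemma card_stepMats_le (Z : Ω n d) {Z' : Edges n} {c : StepCode n}
    (hc : c ∈ stepCodes d (edges Z.1) Z') :
    (stepMats d (edges Z.1) c).card ≤ matBound n d * Fintype.card (Ω n d) := by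
  have hd := lt_of_regular Z c.1.1
  refine (Finset.card_filter_le _ _).trans ((card_star_le hd _ _ _ _ _).trans ?_)
  unfold matBound
  rw [mul_assoc]
  refine Nat.mul_le_mul_left _ ?_
  simp only [stepCodes, Finset.mem_sigma, Finset.mem_product] at hc
  have hxy := hc.2.2
  split_ifs at hxy ⊢ with h2
  · exact (card_shortcut_le hd _ _).trans (Nat.mul_le_mul_left _ card_mats_empty_le)
  · have h3 := Finset.mem_singleton.1 hxy
    rw [h3, mats_diag, one_mul]
    exact card_mats_empty_le

/-- At each vertex the symmetric difference of `G` and `G'` has as many blue as red edges, at most `d`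
of each colour; this is read off from the matrix. -/
lemma card_moved (Z : Ω n d) {c : StepCode n} {L : Fin n → Fin n → ℤ}
    (hL : L ∈ stepMats d (edges Z.1) c) (v : Fin n) :
    ∃ θ ≤ d, (moved (edges Z.1) L v).card = 2 * θ := by
  unfold stepMats at hL
  rw [Finset.mem_filter, mem_mats] at hL
  obtain ⟨⟨hM, -, -⟩, hb⟩ := hL
  have hsum : ∑ u, (L v u + adjMat (edges Z.1) v u) = 2 * d := by
    rw [Finset.sum_add_distrib, hM.sum, sum_adjMat]; ring
  have hcard : ((moved (edges Z.1) L v).card : ℤ) =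
      ∑ u, if L v u + adjMat (edges Z.1) v u = 1 then (1 : ℤ) else 0 := by
    unfold moved
    rw [Finset.card_filter]
    push_cast
    rfl
  have heven : Even (∑ u, (L v u + adjMat (edges Z.1) v u) -
      ∑ u, if L v u + adjMat (edges Z.1) v u = 1 then (1 : ℤ) else 0) := by
    rw [← Finset.sum_sub_distrib]
    refine Finset.even_sum _ fun u _ => ?_
    have := hb v u
    split_ifs with h
    · rw [h]; simp
    · rcases (by omega : L v u + adjMat (edges Z.1) v u = 0 ∨
        L v u + adjMat (edges Z.1) v u = 2) with h1 | h1 <;> rw [h1] <;> decide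
  have hle : (∑ u, if L v u + adjMat (edges Z.1) v u = 1 then (1 : ℤ) else 0) ≤
      ∑ u, (L v u + adjMat (edges Z.1) v u) := by
    refine Finset.sum_le_sum fun u _ => ?_
    have := hb v u
    split_ifs <;> omega
  rw [hsum, ← hcard] at hle heven
  obtain ⟨r, hr⟩ := heven
  exact ⟨(d - r).toNat, by omega, by omega⟩

lemma length_cornerList (c : StepCode n) : (cornerList c).length ≤ 10 := by
  have : (starEnds c.1.2.2.2 c.2.1).length ≤ 3 := by
    rcases c.2.1 with _ | ⟨u, u'⟩
    · simp [starEnds]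
    · unfold starEnds
      simp only
      split_ifs <;> simp
  simp only [cornerList, List.length_append, List.length_replicate, List.length_cons,
    List.length_nil]
  omega

/-- The ten corners at which paired edges may have the same colour cost a factor `d` each. -/
lemma card_stepPairings_le (hd : 1 ≤ d) (Z : Ω n d) {c : StepCode n} {L : Fin n → Fin n → ℤ}
    (hL : L ∈ stepMats d (edges Z.1) c) :
    (stepPairings (edges Z.1) c L).card ≤ d ^ 10 * pairingCount (edges Z.1) L := by
  unfold stepPairings pairingCount
  rw [Fintype.card_piFinset]
  calc ∏ v, (involutions (stepColour (edges Z.1) c v) (moved (edges Z.1) L v)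
        ((cornerList c).count v)).card
      ≤ ∏ v, d ^ (cornerList c).count v * ((moved (edges Z.1) L v).card / 2).factorial := by
        refine Finset.prod_le_prod' fun v _ => ?_
        obtain ⟨θ, hθ, hcard⟩ := card_moved Z hL v
        rw [hcard, Nat.mul_div_cancel_left θ two_pos]
        refine (card_involutions_le _ θ _ _ hcard).trans (Nat.mul_le_mul_right _ ?_)
        exact Nat.pow_le_pow_left (max_le hd hθ) _
    _ = d ^ (cornerList c).length * ∏ v, ((moved (edges Z.1) L v).card / 2).factorial := by
        rw [Finset.prod_mul_distrib, Finset.prod_pow_eq_pow_sum]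
        congr 2
        have := Multiset.sum_count_eq_card (s := Finset.univ) (m := (cornerList c : Multiset (Fin n)))
          (fun a _ => Finset.mem_univ a)
        simpa using this
    _ ≤ _ := Nat.mul_le_mul_right _ (Nat.pow_le_pow_right hd (length_cornerList c))

lemma pairingCount_pos (Z : Edges n) (L : Fin n → Fin n → ℤ) : 0 < pairingCount Z L :=
  Finset.prod_pos fun _ _ => Nat.factorial_pos _

/-- The product of the numbers of codes, of matrices per graph and of pairings relative to `θ!`, as
bounded before. The small degrees need separate estimates, since there the constants are not
absorbed by powers of `d`; for `d = 1` there are no 2-circuits. -/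
lemma numeric_bound (hd : 1 ≤ d) (hn : 4 ≤ n) (hdn : d < n) :
    8 * ((d ^ 2 + 1) * if 2 ≤ d then n ^ 2 else 1) * matBound n d * d ^ 10 ≤
      2 * d ^ 20 * n ^ 5 := by
  unfold matBound
  obtain ⟨k, rfl⟩ : ∃ k, n = k + 4 := ⟨n - 4, by omega⟩
  rcases (by omega : d = 1 ∨ d = 2 ∨ 3 ≤ d) with rfl | rfl | h3
  · simp only [if_neg (by omega : ¬ 2 ≤ 1)]
    ring_nf
    nlinarith [Nat.zero_le k, Nat.zero_le (k ^ 2), Nat.zero_le (k ^ 3), Nat.zero_le (k ^ 4),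
      Nat.zero_le (k ^ 5)]
  · simp only [if_pos le_rfl]
    ring_nf
    nlinarith [Nat.zero_le k, Nat.zero_le (k ^ 2), Nat.zero_le (k ^ 3), Nat.zero_le (k ^ 4),
      Nat.zero_le (k ^ 5)]
  · simp only [if_pos (by omega : 2 ≤ d)]
    set n := k + 4 with hn'
    set N := n * d with hN
    have hN8 : 8 ≤ N := by rw [hN]; nlinarith
    have hn2 : 4 * n ^ 2 ≤ N ^ 2 := by
      rw [hN, mul_pow]
      nlinarith [Nat.pow_le_pow_left (by omega : 2 ≤ d) 2]
    have hdd : d * d ≤ N := by rw [hN]; exact Nat.mul_le_mul_right _ hdn.le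
    have hA : 64 * ((N + 6) * (N + 5) + (N + 4) + n ^ 2 + 1) ≤ 211 * N ^ 2 := by nlinarith
    have hB : 8 * (1 + N + d * d) ≤ 17 * N := by omega
    have hD : 4 * (d ^ 2 + 1) ≤ 5 * d ^ 2 := by nlinarith
    have h5 : 36 ≤ d ^ 5 := le_trans (by norm_num) (Nat.pow_le_pow_left h3 5)
    have hprod := Nat.mul_le_mul (Nat.mul_le_mul hD hA) hB
    have hmain : 8 * ((d ^ 2 + 1) * ((N + 6) * (N + 5) + (N + 4) + n ^ 2 + 1) *
        (1 + N + d * d)) ≤ 2 * d ^ 10 * n ^ 3 := by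
      have e : 5 * d ^ 2 * (211 * N ^ 2) * (17 * N) = 17935 * (d ^ 5 * n ^ 3) := by
        rw [hN]; ring
      have f : 36 * (d ^ 5 * n ^ 3) ≤ d ^ 10 * n ^ 3 := by
        calc 36 * (d ^ 5 * n ^ 3) ≤ d ^ 5 * (d ^ 5 * n ^ 3) := Nat.mul_le_mul_right _ h5
          _ = d ^ 10 * n ^ 3 := by ring
      have g : 2048 * ((d ^ 2 + 1) * ((N + 6) * (N + 5) + (N + 4) + n ^ 2 + 1) *
          (1 + N + d * d)) ≤ 17935 * (d ^ 5 * n ^ 3) := by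
        rw [← e]
        exact le_trans (le_of_eq (by ring)) hprod
      rw [mul_assoc 2]
      omega
    calc 8 * ((d ^ 2 + 1) * n ^ 2) * (((N + 6) * (N + 5) + (N + 4) + n ^ 2 + 1) *
          (1 + N + d * d)) * d ^ 10
        = 8 * ((d ^ 2 + 1) * ((N + 6) * (N + 5) + (N + 4) + n ^ 2 + 1) *
          (1 + N + d * d)) * (n ^ 2 * d ^ 10) := by ring
      _ ≤ 2 * d ^ 10 * n ^ 3 * (n ^ 2 * d ^ 10) := Nat.mul_le_mul_right _ hmain
      _ = 2 * d ^ 20 * n ^ 5 := by ring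

/-- A weighted double counting: `r a b` means that `b` encodes `a`, and a code belongs to one element. -/
lemma sum_le_sum_of_encoding {α β : Type*} {A : Finset α} {D : Finset β} {w : α → ℝ} {w' : β → ℝ}
    (hw' : ∀ b ∈ D, 0 ≤ w' b) (r : α → β → Prop) (h : ∀ a ∈ A, ∃ b ∈ D, r a b ∧ w a ≤ w' b)
    (hr : ∀ a a' b, r a b → r a' b → a = a') : ∑ a ∈ A, w a ≤ ∑ b ∈ D, w' b := by
  classical
  choose f hf using h
  have hinj : Set.InjOn (fun a : A => f a.1 a.2) (A.attach : Set A) := by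
    intro a _ a' _ haa
    have h1 := (hf a.1 a.2).2.1
    rw [show f a.1 a.2 = f a'.1 a'.2 from haa] at h1
    exact Subtype.ext (hr _ _ _ h1 (hf a'.1 a'.2).2.1)
  calc ∑ a ∈ A, w a = ∑ a ∈ A.attach, w a := (Finset.sum_attach A w).symm
    _ ≤ ∑ a ∈ A.attach, w' (f a.1 a.2) := Finset.sum_le_sum fun a _ => (hf a.1 a.2).2.2
    _ = ∑ b ∈ A.attach.image fun a : A => f a.1 a.2, w' b := (Finset.sum_image hinj).symm
    _ ≤ ∑ b ∈ D, w' b := by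
        refine Finset.sum_le_sum_of_subset_of_nonneg (fun b hb => ?_) fun b hb _ => hw' b hb
        obtain ⟨a, _, rfl⟩ := Finset.mem_image.1 hb
        exact (hf a.1 a.2).1

/-- The number of canonical paths through a transition, where the paths between two graphs are
counted with total weight `1`. -/
lemma sum_inv_card_pairing_le (hd : 1 ≤ d) (Z Z' : Ω n d)
    (A : Finset ((G : Ω n d) × (G' : Ω n d) × Pairing G.1 G'.1))
    (hA : ∀ τ ∈ A, [edges Z.1, edges Z'.1] <:+: canonicalPath τ.2.2) :
    ∑ τ ∈ A, (1 / (Fintype.card (Pairing τ.1.1 τ.2.1.1) : ℝ)) ≤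
      (8 * ((d ^ 2 + 1) * if 2 ≤ d then n ^ 2 else 1) * matBound n d * d ^ 10 : ℕ) *
        Fintype.card (Ω n d) := by
  set C := stepCodes d (edges Z.1) (edges Z'.1) with hC
  have h1 : ∑ τ ∈ A, (1 / (Fintype.card (Pairing τ.1.1 τ.2.1.1) : ℝ)) ≤
      ∑ x ∈ C.sigma fun c => (stepMats d (edges Z.1) c).sigma fun L =>
        stepPairings (edges Z.1) c L, (1 / (pairingCount (edges Z.1) x.2.1 : ℝ)) := by
    refine sum_le_sum_of_encoding (fun _ _ => by positivity)
      (fun τ x => Encodes τ.2.2 (edges Z.1) (edges Z'.1) x.1 ∧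
        diffMat (edges τ.1.1) (edges τ.2.1.1) (edges Z.1) = x.2.1 ∧ mate τ.2.2 = x.2.2) ?_ ?_
    · rintro ⟨G, G', ψ⟩ hτ
      obtain ⟨c, hc, hcode⟩ := exists_encodes ψ (hA _ hτ)
      refine ⟨⟨c, diffMat (edges G.1) (edges G'.1) (edges Z.1), mate ψ⟩, ?_, ⟨hcode, rfl, rfl⟩, ?_⟩
      · rw [Finset.mem_sigma, Finset.mem_sigma]
        exact ⟨hc, hcode.diffMat_mem, hcode.mate_mem⟩
      · rw [card_pairing (edges Z.1) G.1 G'.1 ψ]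
    · rintro ⟨G₁, G₁', ψ₁⟩ ⟨G₂, G₂', ψ₂⟩ x ⟨e1, l1, m1⟩ ⟨e2, l2, m2⟩
      exact e1.unique e2 (l1.trans l2.symm) (m1.trans m2.symm)
  refine h1.trans ?_
  rw [Finset.sum_sigma]
  have h2 : ∀ c ∈ C, ∑ x ∈ (stepMats d (edges Z.1) c).sigma fun L =>
      stepPairings (edges Z.1) c L, (1 / (pairingCount (edges Z.1) x.1 : ℝ)) ≤
      ((matBound n d * Fintype.card (Ω n d) : ℕ) : ℝ) * ((d ^ 10 : ℕ) : ℝ) := by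
    intro c hc
    rw [Finset.sum_sigma]
    have h3 : ∀ L ∈ stepMats d (edges Z.1) c, ∑ _m ∈ stepPairings (edges Z.1) c L,
        (1 / (pairingCount (edges Z.1) L : ℝ)) ≤ ((d ^ 10 : ℕ) : ℝ) := by
      intro L hL
      rw [Finset.sum_const, nsmul_eq_mul, mul_one_div,
        div_le_iff₀ (by exact_mod_cast pairingCount_pos _ _)]
      exact_mod_cast card_stepPairings_le hd Z hL
    refine (Finset.sum_le_card_nsmul _ _ _ h3).trans ?_
    rw [nsmul_eq_mul]
    gcongr
    exact card_stepMats_le Z hc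
  refine (Finset.sum_le_card_nsmul _ _ _ h2).trans ?_
  rw [nsmul_eq_mul]
  have h4 := card_stepCodes_le Z (edges Z'.1)
  calc (C.card : ℝ) * (((matBound n d * Fintype.card (Ω n d) : ℕ) : ℝ) * ((d ^ 10 : ℕ) : ℝ))
      ≤ ((8 * ((d ^ 2 + 1) * if 2 ≤ d then n ^ 2 else 1) : ℕ) : ℝ) *
        (((matBound n d * Fintype.card (Ω n d) : ℕ) : ℝ) * ((d ^ 10 : ℕ) : ℝ)) := by
        gcongr
    _ = _ := by push_cast; ring

end

section
variable {n d : ℕ}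

lemma flow_eq_sum (Z Z' : Ω n d) :
    ∃ A : Finset ((G : Ω n d) × (G' : Ω n d) × Pairing G.1 G'.1),
      (∀ τ ∈ A, τ.1 ≠ τ.2.1 ∧ [edges Z.1, edges Z'.1] <:+: canonicalPath τ.2.2) ∧
      flow Z Z' = ∑ τ ∈ A, pathFlow τ.1 τ.2.1 := by
  classical
  refine ⟨Finset.univ.filter fun τ =>
    τ.1 ≠ τ.2.1 ∧ [edges Z.1, edges Z'.1] <:+: canonicalPath τ.2.2,
    fun τ hτ => (Finset.mem_filter.1 hτ).2, ?_⟩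
  rw [Finset.sum_filter, Fintype.sum_sigma]
  unfold flow
  refine Finset.sum_congr rfl fun G _ => ?_
  rw [Fintype.sum_sigma]

lemma eq_of_degree_zero (G G' : Ω n 0) : G = G' := by
  classical
  have key : ∀ (G : Ω n 0) a b, ¬ G.1.Adj a b := fun G a b h => by
    have h1 := G.2 a
    rw [← SimpleGraph.card_neighborFinset_eq_degree, Finset.card_eq_zero] at h1
    have h2 : b ∈ G.1.neighborFinset a := by rwa [SimpleGraph.mem_neighborFinset]
    rw [h1] at h2
    exact Finset.notMem_empty _ h2
  refine Subtype.ext (SimpleGraph.ext ?_)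
  funext a b
  exact propext (iff_of_false (key G a b) (key G' a b))

/-- A transition that lies on no canonical path carries no flow; otherwise `1 ≤ d` and `4 ≤ n`, as a
switch involves four vertices. -/
lemma flow_le (Z Z' : Ω n d) :
    flow Z Z' ≤ 2 * (d : ℝ) ^ 20 * (n : ℝ) ^ 5 / (Fintype.card (Ω n d) : ℝ) := by
  obtain ⟨A, hA, hflow⟩ := flow_eq_sum Z Z'
  rw [hflow]
  rcases A.eq_empty_or_nonempty with rfl | ⟨⟨G, G', ψ⟩, hτ⟩
  · rw [Finset.sum_empty]; positivity
  obtain ⟨hne, hin⟩ := hA _ hτ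
  have hd : 1 ≤ d := by
    rcases Nat.eq_zero_or_pos d with rfl | h
    · exact absurd (eq_of_degree_zero G G') hne
    · exact h
  obtain ⟨v, p, q, t, _, _, _, _, _, _, hD, _⟩ := pathStep_of_infix ψ hin
  have hn : 4 ≤ n := by
    have := hD.nodup.length_le_card
    simpa using this
  have hN : (0 : ℝ) < Fintype.card (Ω n d) := by
    exact_mod_cast Fintype.card_pos_iff.2 ⟨Z⟩
  have hsum := sum_inv_card_pairing_le hd Z Z' A fun τ hτ => (hA τ hτ).2
  have hbound := numeric_bound hd hn (lt_of_regular Z v)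
  have hpath : ∑ τ ∈ A, pathFlow τ.1 τ.2.1 =
      (∑ τ ∈ A, (1 / (Fintype.card (Pairing τ.1.1 τ.2.1.1) : ℝ))) /
        (Fintype.card (Ω n d) : ℝ) ^ 2 := by
    rw [Finset.sum_div]
    refine Finset.sum_congr rfl fun τ _ => ?_
    unfold pathFlow stationary
    rw [div_mul_div_comm, div_div, div_div, one_mul, sq, mul_comm]
  rw [hpath, div_le_div_iff₀ (by positivity) hN]
  calc (∑ τ ∈ A, (1 / (Fintype.card (Pairing τ.1.1 τ.2.1.1) : ℝ))) * (Fintype.card (Ω n d) : ℝ)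
      ≤ ((2 * d ^ 20 * n ^ 5 : ℕ) : ℝ) * (Fintype.card (Ω n d) : ℝ) * (Fintype.card (Ω n d) : ℝ) := by
        refine mul_le_mul_of_nonneg_right (hsum.trans ?_) hN.le
        refine mul_le_mul_of_nonneg_right ?_ hN.le
        exact_mod_cast hbound
    _ = _ := by push_cast; ring

end

end SwitchChain

theorem lemma2 (n d : ℕ) (Z Z' : SwitchChain.Ω n d) (e : SwitchChain.IsTransition Z Z') :
    SwitchChain.flow Z Z' ≤
      2 * (d : ℝ) ^ 20 * (n : ℝ) ^ 5 / (Fintype.card (SwitchChain.Ω n d) : ℝ) :=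
  SwitchChain.flow_le Z Z'
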